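/- Let $m\ge 1$, $\mathcal A=\{1,\dots,m\}$, and let $\zeta$ be a substitution on $\mathcal A$, i.e. a map from $\mathcal A$ to the nonempty finite words over $\mathcal A$, extended to words by concatenation. Let $\mathsf S$ be its substitution matrix, $\mathsf S(i,j)$ = number of symbols $i$ in $\zeta(j)$, with complex eigenvalues $\theta_1,\theta_2,\dots$ ordered so that $|\theta_1|\ge|\theta_2|\ge\dots$. Let $X_\zeta\subset\mathcal A^{\mathbb Z}$ be the set of two-sided sequences $x$ such that every block $x[-n,n]$ occurs as a subword of some $\zeta^k(a)$, and let $T_\zeta$ be the left shift on $X_\zeta$. Suppose that $\zeta$ is primitive (some power of $\mathsf S$ has only positive entries) and aperiodic ($(X_\zeta,T_\zeta)$ has no periodic points), that the characteristic polynomial of $\mathsf S$ is irreducible over $\mathbb Q$, and that there is a second eigenvalue, with $|\theta_2|>1$. Let $\mu$ be the (unique) $T_\zeta$-invariant Borel probability measure on $X_\zeta$. For a strictly positive vector $\vec s=(s_1,\dots,s_m)$ let $(\mathfrak X_\zeta^{\vec s},\widetilde\mu,h_t)$ be the suspension flow over $(X_\zeta,\mu,T_\zeta)$ with roof function equal to $s_j$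 on $\{x: x_0=j\}$; thus $\mathfrak X_\zeta^{\vec s}=\{(x,r): x\in X_\zeta,\ 0\le r\le s_{x_0}\}$ with $(x,s_{x_0})$ identified with $(T_\zeta x,0)$, $h_t$ is the unit-speed vertical flow, and $\widetilde\mu$ is the normalized restriction of $\mu\times\mathrm{Leb}$. A Lip-cylindrical function on $\mathfrak X_\zeta^{\vec s}$ is a function $f(x,r)=\psi_{x_0}(r)$, $0\le r<s_{x_0}$, with Lipschitz $\psi_a:[0,s_a]\to\mathbb C$, and $\|f\|_L=\max_a\|\psi_a\|_L$, where $\|\psi\|_L$ is the sum of the supremum norm and the least Lipschitz constant. Let $\Delta^{m-1}=\{\vec s\in\mathbb R^m: s_j>0,\ \sum_j s_j=1\}$. Then there exists $\alpha>0$, depending only on $\zeta$, such that for Lebesgue-almost every $\vec s\in\Delta^{m-1}$ the following holds: for every Lip-cylindrical function $f$ on $\mathfrak X_\zeta^{\vec s}$ with $\int f\,d\widetilde\mu=0$, every ergodic measurable probability-preserving flow $(Y,H_t,\nu)$ and every $g\in L^2(Y,\nu)$ with $\int g\,d\nu=0$, $$ \left|\int_0^R\bigl\langle (f\otimes g)\circ(h_t\times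 H_t),\,f\otimes g\bigr\rangle\,dt\right|\le C\,R^{1-\alpha}\qquad\text{for all }R>0, $$ where $(f\otimes g)(x,y)=f(x)g(y)$, $\langle\cdot,\cdot\rangle$ is the inner product of $L^2(\mathfrak X_\zeta^{\vec s}\times Y,\widetilde\mu\times\nu)$, and $C>0$ depends only on $\zeta$, $\vec s$, $\|f\|_L$ and $\|g\|_2$. -/

import Mathlib

open MeasureTheory

/-- A substitution on the alphabet `Fin m`: every letter is mapped to a nonempty finite word. -/
structure Substitution (m : ℕ) where
  toFun : Fin m → List (Fin m)
  nonempty : ∀ a, toFun a ≠ []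

namespace Substitution

variable {m : ℕ}

/-- The action of a substitution on finite words, by concatenation. -/
def onWord (ζ : Substitution m) (w : List (Fin m)) : List (Fin m) :=
  w.flatMap ζ.toFun

/-- The substitution matrix: the entry `(i, j)` is the number of symbols `i` in `ζ(j)`. -/
def matrix (ζ : Substitution m) : Matrix (Fin m) (Fin m) ℤ :=
  Matrix.of fun i j => ((ζ.toFun j).count i : ℤ)

/-- The block `x_i x_{i+1} … x_{i+N-1}` of a two-sided sequence. -/
def block (x : ℤ → Fin m) (i : ℤ) (N : ℕ) : List (Fin m) :=
  (List.range N).map fun k : ℕ => x (i + (k : ℤ))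

/-- The two-sided sequences `x` all of whose central blocks `x[-n,n]` occur as subwords in some
`ζ^k(a)`. -/
def spaceSet (ζ : Substitution m) : Set (ℤ → Fin m) :=
  {x | ∀ n : ℕ, ∃ (k : ℕ) (a : Fin m), block x (-(n : ℤ)) (2 * n + 1) <:+: ζ.onWord^[k] [a]}

/-- The substitution space `X_ζ`, with the product (Borel) σ-algebra. -/
abbrev Space (ζ : Substitution m) : Type := ↥(ζ.spaceSet)

theorem block_add (x : ℤ → Fin m) (i : ℤ) (a b : ℕ) :
    block x i (a + b) = block x i a ++ block x (i + a) b := by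
  simp [block, List.range_add, add_assoc, Function.comp_def]

theorem block_infix (x : ℤ → Fin m) (i i' : ℤ) (N N' : ℕ) (h1 : i' ≤ i)
    (h2 : i + N ≤ i' + N') : block x i N <:+: block x i' N' := by
  obtain ⟨a, ha⟩ := Int.eq_ofNat_of_zero_le (sub_nonneg.2 h1)
  obtain ⟨b, hb⟩ := Int.eq_ofNat_of_zero_le (sub_nonneg.2 h2)
  have hN : N' = a + (N + b) := by omega
  have hi : i = i' + a := by omega
  subst hN hi
  rw [block_add, block_add]
  exact ⟨block x i' a, block x (i' + a + N) b, by simp⟩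

theorem shift_mem (ζ : Substitution m) (j : ℤ) {x : ℤ → Fin m} (hx : x ∈ ζ.spaceSet) :
    (fun k => x (k + j)) ∈ ζ.spaceSet := by
  intro n
  obtain ⟨k, a, h⟩ := hx (n + j.natAbs)
  refine ⟨k, a, List.IsInfix.trans ?_ h⟩
  have : block (fun k => x (k + j)) (-(n : ℤ)) (2 * n + 1) =
      block x (-(n : ℤ) + j) (2 * n + 1) := by
    simp only [block]
    refine List.map_congr_left fun k _ => ?_
    congr 1
    ring
  rw [this]
  apply block_infix <;> omega

/-- The `j`-th power of the left shift on `X_ζ`, for `j ∈ ℤ`. -/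
def shift (ζ : Substitution m) (j : ℤ) (x : ζ.Space) : ζ.Space :=
  ⟨fun k => x.1 (k + j), ζ.shift_mem j x.2⟩

/-- Primitivity: some power of the substitution matrix is entrywise positive. -/
def Primitive (ζ : Substitution m) : Prop := ζ.matrix.IsPrimitive

/-- Aperiodicity: the system `(X_ζ, T_ζ)` has no periodic points. -/
def Aperiodic (ζ : Substitution m) : Prop := Function.periodicPts (ζ.shift 1) = ∅

/-- The moduli of the complex eigenvalues of the substitution matrix, counted with algebraic
multiplicity and listed in decreasing order: `|θ₁|, |θ₂|, …`. -/
noncomputable def eigenvalueModuli (ζ : Substitution m) : List ℝ :=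
  ((ζ.matrix.map (Int.cast : ℤ → ℂ)).charpoly.roots.map fun z => ‖z‖).sort (· ≥ ·)

/-- The modulus `|θ₂|` of the second eigenvalue (with value `0` if there is none, i.e. if
`m ≤ 1`). -/
noncomputable def absTheta₂ (ζ : Substitution m) : ℝ := ζ.eigenvalueModuli.getD 1 0

/-- The signed tiling length: `s_{x_0} + … + s_{x_{n-1}}` for `n ≥ 0`, and
`-(s_{x_{-1}} + … + s_{x_n})` for `n < 0`. -/
def roofSum (s : Fin m → ℝ) (x : ℤ → Fin m) : ℤ → ℝ
  | Int.ofNat n => ∑ i ∈ Finset.range n, s (x i)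
  | Int.negSucc n => -∑ i ∈ Finset.range (n + 1), s (x (-(i : ℤ) - 1))

theorem roofSum_add_one (s : Fin m → ℝ) (x : ℤ → Fin m) (n : ℤ) :
    roofSum s x (n + 1) = roofSum s x n + s (x n) := by
  rcases n with n | n
  · exact Finset.sum_range_succ _ _
  · rcases n with _ | n
    · change roofSum s x (Int.ofNat 0) = _
      simp [roofSum, Int.negSucc_eq]
    · have h1 : Int.negSucc (n + 1) + 1 = Int.negSucc n := rfl
      have h2 : Int.negSucc (n + 1) = -((n + 1 : ℕ) : ℤ) - 1 := by
        simp [Int.negSucc_eq]; ring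
      rw [h1]
      simp only [roofSum]
      rw [Finset.sum_range_succ _ (n + 1), ← h2]
      ring

theorem exists_tile (s : Fin m → ℝ) (hs : ∀ a, 0 < s a) (x : ℤ → Fin m) (u : ℝ) :
    ∃ n : ℤ, roofSum s x n ≤ u ∧ u < roofSum s x (n + 1) := by
  have : Nonempty (Fin m) := ⟨x 0⟩
  obtain ⟨a, ha⟩ := Finite.exists_min s
  have hc : 0 < s a := hs a
  have hz : roofSum s x 0 = 0 := by
    change roofSum s x (Int.ofNat 0) = 0
    simp [roofSum]
  have hpos : ∀ n : ℕ, (n : ℝ) * s a ≤ roofSum s x n := by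
    intro n
    induction n with
    | zero => simp [hz]
    | succ n ih =>
      push_cast
      rw [roofSum_add_one]
      have := ha (x n)
      linarith
  have hneg : ∀ n : ℕ, roofSum s x (-(n : ℤ)) ≤ -((n : ℝ) * s a) := by
    intro n
    induction n with
    | zero => simp [hz]
    | succ n ih =>
      have h := roofSum_add_one s x (-((n + 1 : ℕ) : ℤ))
      have e : -((n + 1 : ℕ) : ℤ) + 1 = -(n : ℤ) := by push_cast; ring
      rw [e] at h
      have := ha (x (-((n + 1 : ℕ) : ℤ)))
      push_cast at h this ⊢
      linarith
  have hmono : StrictMono (roofSum s x) :=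
    strictMono_int_of_lt_succ fun n => by
      rw [roofSum_add_one]; linarith [hs (x n)]
  obtain ⟨N, hN⟩ := exists_nat_gt (|u| / s a)
  rw [div_lt_iff₀ hc] at hN
  have hu1 := le_abs_self u
  have hu2 := neg_abs_le u
  obtain ⟨n, hn1, hn2⟩ := Int.exists_greatest_of_bdd (P := fun n => roofSum s x n ≤ u)
    ⟨N, fun z hz' => by
      by_contra hlt
      have := hmono (not_le.1 hlt)
      have := hpos N
      linarith⟩
    ⟨-(N : ℤ), by have := hneg N; linarith⟩
  refine ⟨n, hn1, ?_⟩
  by_contra h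
  have := hn2 (n + 1) (not_lt.1 h)
  omega

/-- The space of the suspension over `(X_ζ, T_ζ)` with the piecewise constant roof function equal to
`s_j` on the cylinder `[j]`, as the fundamental domain `{(x, r) : 0 ≤ r < s_{x_0}}`
(in the suspension the point `(x, s_{x_0})` is identified with `(T x, 0)`). -/
abbrev Suspension (ζ : Substitution m) (s : Fin m → ℝ) : Type :=
  {p : ζ.Space × ℝ // 0 ≤ p.2 ∧ p.2 < s (p.1.1 0)}

/-- The number `n` of tiles crossed when the point `(x, 0)` moves by `u`; it is the unique integer
with `roofSum s x n ≤ u < roofSum s x (n + 1)`. -/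
noncomputable def tileIndex (s : Fin m → ℝ) (hs : ∀ a, 0 < s a) (x : ℤ → Fin m) (u : ℝ) : ℤ :=
  (exists_tile s hs x u).choose

/-- The suspension flow `h_t`: `(x, r)` moves to `(T^n x, r + t - roofSum s x n)`, with the unique
`n` for which this is a point of the fundamental domain. -/
noncomputable def flow (ζ : Substitution m) (s : Fin m → ℝ) (hs : ∀ a, 0 < s a) (t : ℝ)
    (p : ζ.Suspension s) : ζ.Suspension s :=
  ⟨(ζ.shift (tileIndex s hs p.1.1.1 (p.1.2 + t)) p.1.1,
    p.1.2 + t - roofSum s p.1.1.1 (tileIndex s hs p.1.1.1 (p.1.2 + t))), by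
    have h := (exists_tile s hs p.1.1.1 (p.1.2 + t)).choose_spec
    rw [roofSum_add_one] at h
    simp only [shift, zero_add, tileIndex]
    constructor <;> linarith [h.1, h.2]⟩

/-- The flow-invariant probability measure on the suspension induced by a shift-invariant measure
`μ` on `X_ζ`: the normalized restriction of `μ × Lebesgue`. -/
noncomputable def suspensionMeasure (ζ : Substitution m) (s : Fin m → ℝ) (μ : Measure ζ.Space) :
    Measure (ζ.Suspension s) :=
  let ρ : Measure (ζ.Suspension s) := (μ.prod (volume : Measure ℝ)).comap Subtype.val
  (ρ Set.univ)⁻¹ • ρ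

/-- The cylindrical function `f(x, r) = ψ_{x_0}(r)`. -/
def cylindrical (ζ : Substitution m) (s : Fin m → ℝ) (ψ : Fin m → ℝ → ℂ)
    (p : ζ.Suspension s) : ℂ :=
  ψ (p.1.1.1 0) p.1.2

end Substitution

/-- The Lipschitz norm of `φ` on `[0, ℓ]`: the supremum norm plus the best Lipschitz constant. -/
noncomputable def lipNorm (ℓ : ℝ) (φ : ℝ → ℂ) : ℝ :=
  (⨆ t : Set.Icc (0 : ℝ) ℓ, ‖φ t‖) +
    ⨆ p : Set.Icc (0 : ℝ) ℓ × Set.Icc (0 : ℝ) ℓ, ‖φ p.1 - φ p.2‖ / |(p.1 : ℝ) - p.2|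

/-- The norm `‖f‖_L = max_a ‖ψ_a‖_L` of a Lipschitz cylindrical function. -/
noncomputable def cylLipNorm {m : ℕ} (s : Fin m → ℝ) (ψ : Fin m → ℝ → ℂ) : ℝ :=
  ⨆ a, lipNorm (s a) (ψ a)

/-- The open simplex of strictly positive roof vectors of total length one. -/
def roofSimplex (m : ℕ) : Set (Fin m → ℝ) :=
  {s | (∀ a, 0 < s a) ∧ ∑ a, s a = 1}

/-- The tensor product `(f ⊗ g)(x, y) = f(x) g(y)`. -/
def tensorFun {X Y : Type*} (f : X → ℂ) (g : Y → ℂ) (p : X × Y) : ℂ := f p.1 * g p.2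

/-! Along a flow orbit, the twisted integral `∫₀ᴿ 𝐞(ω t) f(h_t p) dt` is, up to two boundary tiles,
an exponential sum over the word of tiles crossed. Cut that word into blocks `ζ^k(a)`. By
primitivity some word `d v d` occurs in every `ζ^q(a)`, so every block of level `k + q` contains two
copies of `ζ^k(d)` whose phases differ by `𝐞(ω |ζ^k(d v)|)`. Hence the bound on blocks improves by a
factor `1 - c ‖ω |ζ^k(d v)|‖²`, with `‖·‖` the distance to `ℤ`, and it decays exponentially in `k`
as soon as these distances are bounded below in quadratic mean.

The lengths `|ζ^k(d v)|` satisfy the recurrence given by the characteristic polynomial of `𝖲`. On a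
line of roof vectors, a small quadratic mean forces the integer parts of `ω |ζ^k(d v)|` to satisfy
the recurrence at all but few times, so that they take few values up to time `n` (the Erdős–Kahane
argument), while the two expanding eigenvalues, distinct by irreducibility, confine each resulting
set of parameters to an exponentially short interval, whatever `ω` is. By Borel–Cantelli almost
every parameter is good, and by Fubini so is almost every roof vector. Very small and very large
`ω` are treated separately: the former by the vanishing mean of `f`, the latter by the decay of the
Fourier transforms of the Lipschitz profiles.

The correlation of `f ⊗ g` is the product of those of `f` and `g`. A bound `M` on all twisted
integrals of `f` over `[0, R]` bounds the Fourier coefficients of `f` along an orbit, viewed on a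
circle of length `2 R`. Averaging over the second flow and applying Parseval's identity gives
`|∫₀ᴿ f(h_t p) ⟨g ∘ H_t, g⟩ dt| ≤ 2 M ‖g‖²`, to be integrated against `conj (f p)`. -/

/-! ### Words -/

section Words

variable {α β : Type*} {f : α → List β} {L : ℕ}

theorem exists_eq_flatMap_append_of_isPrefix (hL : ∀ a, (f a).length ≤ L) {u : List α}
    {w : List β} (h : w <+: u.flatMap f) :
    ∃ (v : List α) (q : List β), w = v.flatMap f ++ q ∧ q.length ≤ L := by
  induction u generalizing w with
  | nil => exact ⟨[], [], by simpa using h, Nat.zero_le _⟩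
  | cons a u ih =>
    obtain ⟨r, hr⟩ := h
    rw [List.flatMap_cons] at hr
    rcases List.append_eq_append_iff.1 hr with ⟨t, hfa, -⟩ | ⟨t, rfl, ht⟩
    · exact ⟨[], w, rfl, (hfa ▸ List.prefix_append w t).length_le.trans (hL a)⟩
    · obtain ⟨v, q, rfl, hq⟩ := ih ⟨r, ht.symm⟩
      exact ⟨a :: v, q, by simp, hq⟩

theorem exists_eq_append_flatMap_append_of_isInfix (hL : ∀ a, (f a).length ≤ L) {u : List α}
    {w : List β} (h : w <:+: u.flatMap f) :
    ∃ (p : List β) (v : List α) (q : List β),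
      w = p ++ v.flatMap f ++ q ∧ p.length ≤ L ∧ q.length ≤ L := by
  induction u with
  | nil => exact ⟨[], [], [], by simpa using h, Nat.zero_le _, Nat.zero_le _⟩
  | cons a u ih =>
    rcases List.infix_append_iff.1 h with h | h | ⟨p, t, rfl, hp, ht⟩
    · exact ⟨w, [], [], by simp, h.length_le.trans (hL a), Nat.zero_le _⟩
    · exact ih h
    · obtain ⟨v, q, rfl, hq⟩ := exists_eq_flatMap_append_of_isPrefix hL ht
      exact ⟨p, v, q, by simp, hp.length_le.trans (hL a), hq⟩

end Words

namespace Substitution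

section Iterates

variable {m : ℕ} (ζ : Substitution m)

theorem onWord_iterate_append (n : ℕ) (w w' : List (Fin m)) :
    ζ.onWord^[n] (w ++ w') = ζ.onWord^[n] w ++ ζ.onWord^[n] w' := by
  induction n generalizing w w' with
  | zero => rfl
  | succ n ih => rw [Function.iterate_succ_apply, onWord, List.flatMap_append, ih]; rfl

theorem onWord_iterate_eq_flatMap (n : ℕ) (w : List (Fin m)) :
    ζ.onWord^[n] w = w.flatMap fun a => ζ.onWord^[n] [a] := by
  induction w with
  | nil => exact Function.iterate_fixed rfl n
  | cons a w ih => rw [List.flatMap_cons, ← ih, ← onWord_iterate_append, List.singleton_append]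

theorem onWord_iterate_isInfix (n : ℕ) {w w' : List (Fin m)} (h : w <:+: w') :
    ζ.onWord^[n] w <:+: ζ.onWord^[n] w' := by
  obtain ⟨p, r, rfl⟩ := h
  exact ⟨ζ.onWord^[n] p, ζ.onWord^[n] r, by simp only [onWord_iterate_append]⟩

/-- An upper bound for the lengths of the words `ζ(a)`, taken to be at least `2` so that its powers
grow exponentially. -/
def maxLength : ℕ := max 2 (Finset.univ.sup fun a => (ζ.toFun a).length)

theorem two_le_maxLength : 2 ≤ ζ.maxLength := le_max_left _ _

theorem one_le_maxLength : (1 : ℝ) ≤ ζ.maxLength := by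
  exact_mod_cast one_le_two.trans ζ.two_le_maxLength

theorem length_toFun_le (a : Fin m) : (ζ.toFun a).length ≤ ζ.maxLength :=
  (Finset.le_sup (f := fun a => (ζ.toFun a).length) (Finset.mem_univ a)).trans (le_max_right _ _)

theorem length_onWord_iterate_le (n : ℕ) (w : List (Fin m)) :
    (ζ.onWord^[n] w).length ≤ w.length * ζ.maxLength ^ n := by
  induction n with
  | zero => simp
  | succ n ih =>
    rw [Function.iterate_succ_apply', onWord, List.length_flatMap]
    calc ((ζ.onWord^[n] w).map fun a => (ζ.toFun a).length).sum
        ≤ (ζ.onWord^[n] w).length * ζ.maxLength := by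
          simpa using List.sum_le_card_nsmul ((ζ.onWord^[n] w).map fun a => (ζ.toFun a).length)
            ζ.maxLength (by simpa using fun a _ => ζ.length_toFun_le a)
      _ ≤ w.length * ζ.maxLength ^ n * ζ.maxLength := Nat.mul_le_mul_right _ ih
      _ = w.length * ζ.maxLength ^ (n + 1) := by ring

theorem length_onWord_iterate_singleton_le (n : ℕ) (a : Fin m) :
    (ζ.onWord^[n] [a]).length ≤ ζ.maxLength ^ n := by
  simpa using ζ.length_onWord_iterate_le n [a]

theorem onWord_iterate_ne_nil (n : ℕ) {w : List (Fin m)} (hw : w ≠ []) :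
    ζ.onWord^[n] w ≠ [] := by
  induction n with
  | zero => exact hw
  | succ n ih =>
    obtain ⟨a, ha⟩ := List.exists_mem_of_ne_nil _ ih
    rw [Function.iterate_succ_apply', onWord, Ne, List.flatMap_eq_nil_iff]
    exact fun h => ζ.nonempty a (h a ha)

/-- The abelianization of a word. -/
def population (w : List (Fin m)) : Fin m → ℤ := fun i => w.count i

theorem population_onWord (w : List (Fin m)) :
    population (ζ.onWord w) = ζ.matrix.mulVec (population w) := by
  ext i
  have hcount : (ζ.onWord w).count i = ∑ j, w.count j * (ζ.toFun j).count i := by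
    rw [onWord, List.count_flatMap, Finset.sum_list_map_count]
    refine Finset.sum_subset (Finset.subset_univ _) fun j _ hj => ?_
    rw [List.count_eq_zero.2 (by simpa using hj), zero_smul]
  simp only [population, hcount, matrix, Matrix.mulVec, dotProduct, Matrix.of_apply]
  push_cast
  exact Finset.sum_congr rfl fun j _ => mul_comm _ _

theorem population_onWord_iterate (n : ℕ) (w : List (Fin m)) :
    population (ζ.onWord^[n] w) = (ζ.matrix ^ n).mulVec (population w) := by
  induction n with
  | zero => simp
  | succ n ih =>
    rw [Function.iterate_succ_apply', population_onWord, ih, pow_succ', Matrix.mulVec_mulVec]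

end Iterates

section Primitive

variable {m : ℕ} {ζ : Substitution m}

theorem Primitive.exists_forall_mem (h : ζ.Primitive) :
    ∃ p : ℕ, 0 < p ∧ ∀ a b, a ∈ ζ.onWord^[p] [b] := by
  obtain ⟨p, hp, hpos⟩ := h.exists_pos_pow
  refine ⟨p, hp, fun a b => List.count_pos_iff.1 ?_⟩
  have hsingle : population [b] = Pi.single b 1 := by
    ext i
    by_cases hi : i = b
    · simp [population, hi]
    · simp [population, hi, Ne.symm hi]
  have hcount := congrFun (ζ.population_onWord_iterate p [b]) a
  rw [hsingle, Matrix.mulVec_single_one, Matrix.col_apply] at hcount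
  exact Int.natCast_pos.1 (lt_of_lt_of_eq (hpos a b) hcount.symm)

theorem length_onWord_iterate_singleton_le_mul {p : ℕ}
    (hp : ∀ a b, a ∈ ζ.onWord^[p] [b]) (n : ℕ) (a d : Fin m) :
    (ζ.onWord^[n] [a]).length ≤ ζ.maxLength ^ p * (ζ.onWord^[n] [d]).length := by
  have hle := (ζ.onWord_iterate_isInfix n ((List.singleton_infix_iff _ _).2 (hp a d))).length_le
  rw [← Function.iterate_add_apply, add_comm, Function.iterate_add_apply] at hle
  exact hle.trans ((ζ.length_onWord_iterate_le p _).trans_eq (mul_comm _ _))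

theorem length_onWord_iterate_add_le_mul {p : ℕ}
    (hp : ∀ a b, a ∈ ζ.onWord^[p] [b]) (n q : ℕ) (b d : Fin m) :
    (ζ.onWord^[n + q] [b]).length ≤ ζ.maxLength ^ (p + q) * (ζ.onWord^[n] [d]).length := by
  set w := ζ.onWord^[q] [b]
  calc (ζ.onWord^[n + q] [b]).length
      = (w.map fun a => (ζ.onWord^[n] [a]).length).sum := by
        rw [Function.iterate_add_apply, onWord_iterate_eq_flatMap, List.length_flatMap]
    _ ≤ w.length * (ζ.maxLength ^ p * (ζ.onWord^[n] [d]).length) := by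
        simpa using List.sum_le_card_nsmul (w.map fun a => (ζ.onWord^[n] [a]).length) _
          (by simpa using fun a _ => length_onWord_iterate_singleton_le_mul hp n a d)
    _ ≤ ζ.maxLength ^ q * (ζ.maxLength ^ p * (ζ.onWord^[n] [d]).length) :=
        Nat.mul_le_mul_right _ (ζ.length_onWord_iterate_singleton_le q b)
    _ = _ := by ring

theorem Primitive.exists_return_word (h : ζ.Primitive) (hm : 2 ≤ m) :
    ∃ (q : ℕ) (c : Fin m) (v : List (Fin m)), 0 < q ∧
      ∀ b, c :: v ++ [c] <:+: ζ.onWord^[q] [b] := by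
  obtain ⟨p, hp, hmem⟩ := h.exists_forall_mem
  let c : Fin m := ⟨0, by omega⟩
  let d : Fin m := ⟨1, by omega⟩
  obtain ⟨x, y, w, hxy⟩ : ∃ x y w, ζ.onWord^[p] [c] = x :: y :: w := by
    have hc := hmem c c
    have hd := hmem d c
    match hw : ζ.onWord^[p] [c] with
    | [] => simp [hw] at hc
    | [x] =>
      rw [hw, List.mem_singleton] at hc hd
      exact absurd (hc.trans hd.symm) (by simp [c, d])
    | x :: y :: w => exact ⟨x, y, w, rfl⟩
  obtain ⟨u₁, v₁, h₁⟩ := List.append_of_mem (hmem c x)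
  obtain ⟨u₂, v₂, h₂⟩ := List.append_of_mem (hmem c y)
  refine ⟨p + p + p, c, v₁ ++ u₂, by omega, fun b => ?_⟩
  have hcc : c :: (v₁ ++ u₂) ++ [c] <:+: ζ.onWord^[p + p] [c] := by
    refine ⟨u₁, v₂ ++ ζ.onWord^[p] w, ?_⟩
    rw [Function.iterate_add_apply, hxy, ← List.singleton_append (x := x),
      ← List.singleton_append (x := y), onWord_iterate_append, onWord_iterate_append, h₁, h₂]
    simp
  rw [Function.iterate_add_apply]
  exact hcc.trans (ζ.onWord_iterate_isInfix _ ((List.singleton_infix_iff _ _).2 (hmem c b)))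

end Primitive

end Substitution

/-! ### Twisted sums over words -/

section FourierChar

open scoped FourierTransform

theorem fourierChar_sub_intCast (x : ℝ) (n : ℤ) : 𝐞 (x - n) = 𝐞 x := by
  rw [AddChar.map_sub_eq_div, Real.fourierChar_apply' n, mul_comm, Circle.exp_int_mul_two_pi,
    div_one]

theorem norm_one_add_fourierChar_le (x : ℝ) :
    ‖1 + (𝐞 x : ℂ)‖ ≤ 2 - 4 * ‖(x : UnitAddCircle)‖ ^ 2 := by
  set y := x - round x with hy
  have hy_le : |y| ≤ 1 / 2 := abs_sub_round x
  have hpi_abs : |Real.pi * y| ≤ Real.pi / 2 := by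
    rw [abs_mul, abs_of_pos Real.pi_pos]
    nlinarith [Real.pi_pos]
  have hfactor : 1 + (𝐞 y : ℂ) =
      2 * Real.cos (Real.pi * y) * Complex.exp ((Real.pi * y : ℝ) * Complex.I) := by
    rw [Real.fourierChar_apply, Complex.ofReal_cos, Complex.two_cos, add_mul, ← Complex.exp_add,
      ← Complex.exp_add]
    rw [show -(((Real.pi * y : ℝ) : ℂ)) * Complex.I + ((Real.pi * y : ℝ) : ℂ) * Complex.I = 0 by
      ring, Complex.exp_zero, add_comm]
    congr 2
    push_cast
    ring
  have hcos := Real.cos_nonneg_of_mem_Icc (abs_le.1 hpi_abs)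
  rw [UnitAddCircle.norm_eq, ← fourierChar_sub_intCast x (round x), ← hy, hfactor, norm_mul,
    Complex.norm_exp_ofReal_mul_I, mul_one, norm_mul, Complex.norm_two, Complex.norm_real,
    Real.norm_of_nonneg hcos, sq_abs]
  have hquad := Real.cos_le_one_sub_mul_cos_sq (hpi_abs.trans (by linarith [Real.pi_pos]))
  have : 2 / Real.pi ^ 2 * (Real.pi * y) ^ 2 = 2 * y ^ 2 := by field_simp
  linarith

theorem norm_fourierChar_sub_one_le (x : ℝ) : ‖(𝐞 x : ℂ) - 1‖ ≤ 2 * Real.pi * |x| := by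
  rw [Real.fourierChar_apply, mul_comm]
  refine Real.norm_exp_I_mul_ofReal_sub_one_le.trans_eq ?_
  rw [Real.norm_eq_abs, abs_mul, abs_of_pos Real.two_pi_pos]

end FourierChar

section TwistedSum

open scoped FourierTransform

variable {α : Type*}

/-- The length of a word whose letter `a` is a tile of length `s a`. -/
def wordLength (s : α → ℝ) (w : List α) : ℝ := (w.map s).sum

theorem wordLength_cons (s : α → ℝ) (a : α) (w : List α) :
    wordLength s (a :: w) = s a + wordLength s w := List.sum_cons

theorem wordLength_append (s : α → ℝ) (w w' : List α) :
    wordLength s (w ++ w') = wordLength s w + wordLength s w' := by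
  simp [wordLength]

/-- The exponential sum `∑_j exp(2πiω |w_0 … w_{j-1}|) c(w_j)` over a word `w`, where `|·|` is the
tiling length. -/
noncomputable def twistedSum (s : α → ℝ) (ω : ℝ) (c : α → ℂ) : List α → ℂ
  | [] => 0
  | a :: w => c a + 𝐞 (ω * s a) * twistedSum s ω c w

theorem twistedSum_append (s : α → ℝ) (ω : ℝ) (c : α → ℂ) (w w' : List α) :
    twistedSum s ω c (w ++ w') =
      twistedSum s ω c w + 𝐞 (ω * wordLength s w) * twistedSum s ω c w' := by
  induction w with
  | nil => simp [twistedSum, wordLength]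
  | cons a w ih =>
    rw [List.cons_append, twistedSum, ih, twistedSum, wordLength_cons, mul_add ω,
      AddChar.map_add_eq_mul, Circle.coe_mul]
    ring

theorem norm_twistedSum_append_le (s : α → ℝ) (ω : ℝ) (c : α → ℂ) (w w' : List α) :
    ‖twistedSum s ω c (w ++ w')‖ ≤ ‖twistedSum s ω c w‖ + ‖twistedSum s ω c w'‖ := by
  rw [twistedSum_append]
  refine (norm_add_le _ _).trans_eq ?_
  rw [norm_mul, Circle.norm_coe, one_mul]

theorem norm_twistedSum_le (s : α → ℝ) (ω : ℝ) {c : α → ℂ} {B : ℝ} (hB : ∀ a, ‖c a‖ ≤ B)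
    (w : List α) : ‖twistedSum s ω c w‖ ≤ B * w.length := by
  induction w with
  | nil => simp [twistedSum]
  | cons a w ih =>
    have hcons := norm_twistedSum_append_le s ω c [a] w
    have ha : ‖twistedSum s ω c [a]‖ ≤ B := by simpa [twistedSum] using hB a
    rw [List.singleton_append] at hcons
    push_cast [List.length_cons]
    linarith

theorem norm_twistedSum_flatMap_le {β : Type*} {s : β → ℝ} {ω : ℝ} {c : β → ℂ} {ρ : ℝ}
    {f : α → List β} (hf : ∀ a, ‖twistedSum s ω c (f a)‖ ≤ ρ * (f a).length) (w : List α) :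
    ‖twistedSum s ω c (w.flatMap f)‖ ≤ ρ * (w.flatMap f).length := by
  induction w with
  | nil => simp [twistedSum]
  | cons a w ih =>
    rw [List.flatMap_cons, List.length_append]
    have happ := norm_twistedSum_append_le s ω c (f a) (w.flatMap f)
    have ha := hf a
    push_cast
    linarith

/-- The two copies of `x` enter with phases that differ by `exp(2πiω |xv|)`, so that they cancel
partially when `ω |xv|` is far from an integer. -/
theorem norm_twistedSum_return_le (s : α → ℝ) (ω : ℝ) (c : α → ℂ) (u x v r : List α) :
    ‖twistedSum s ω c (u ++ (x ++ (v ++ (x ++ r))))‖ ≤ ‖twistedSum s ω c u‖ +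
      (2 - 4 * ‖((ω * wordLength s (x ++ v) : ℝ) : UnitAddCircle)‖ ^ 2) * ‖twistedSum s ω c x‖ +
        ‖twistedSum s ω c v‖ + ‖twistedSum s ω c r‖ := by
  set y := ω * wordLength s x with hy
  set z := ω * wordLength s v with hz
  have hphase : ω * wordLength s (x ++ v) = y + z := by rw [wordLength_append, mul_add]
  have hexpand : twistedSum s ω c (x ++ (v ++ (x ++ r))) =
      (1 + 𝐞 (y + z)) * twistedSum s ω c x + 𝐞 y * twistedSum s ω c v +
        𝐞 (y + z) * 𝐞 y * twistedSum s ω c r := by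
    rw [twistedSum_append, twistedSum_append, twistedSum_append, ← hy, ← hz,
      AddChar.map_add_eq_mul, Circle.coe_mul]
    ring
  have hreturn := norm_add₃_le (a := (1 + (𝐞 (y + z) : ℂ)) * twistedSum s ω c x)
    (b := 𝐞 y * twistedSum s ω c v) (c := 𝐞 (y + z) * 𝐞 y * twistedSum s ω c r)
  rw [← hexpand] at hreturn
  simp only [norm_mul, Circle.norm_coe, one_mul] at hreturn
  have hgain := mul_le_mul_of_nonneg_right (norm_one_add_fourierChar_le (y + z))
    (norm_nonneg (twistedSum s ω c x))
  have happ := norm_twistedSum_append_le s ω c u (x ++ (v ++ (x ++ r)))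
  rw [hphase]
  linarith

theorem norm_twistedSum_sub_le {s : α → ℝ} (hs : ∀ a, |s a| ≤ 1) {ω : ℝ} {c d : α → ℂ}
    {B κ : ℝ} (hB0 : 0 ≤ B) (hB : ∀ a, ‖c a‖ ≤ B) (hκ : ∀ a, ‖c a - d a‖ ≤ κ) (w : List α) :
    ‖twistedSum s ω c w - twistedSum s 0 d w‖ ≤
      w.length * (κ + 2 * Real.pi * |ω| * B * w.length) := by
  induction w with
  | nil => simp [twistedSum]
  | cons a w ih =>
    have hsplit : twistedSum s ω c (a :: w) - twistedSum s 0 d (a :: w) = (c a - d a) +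
        (𝐞 (ω * s a) - 1) * twistedSum s ω c w + (twistedSum s ω c w - twistedSum s 0 d w) := by
      rw [twistedSum, twistedSum, zero_mul, AddChar.map_zero_eq_one, Circle.coe_one]
      ring
    have hphase : ‖((𝐞 (ω * s a) : ℂ) - 1) * twistedSum s ω c w‖ ≤
        2 * Real.pi * |ω| * (B * w.length) := by
      rw [norm_mul]
      refine mul_le_mul ((norm_fourierChar_sub_one_le _).trans ?_) (norm_twistedSum_le s ω hB w)
        (norm_nonneg _) (by positivity)
      rw [abs_mul, ← mul_assoc]
      exact mul_le_of_le_one_right (by positivity) (hs a)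
    rw [hsplit]
    refine norm_add₃_le.trans ?_
    have ha := hκ a
    have hnonneg : 0 ≤ 2 * Real.pi * |ω| * B := by positivity
    push_cast [List.length_cons]
    nlinarith [mul_nonneg hnonneg (Nat.cast_nonneg (α := ℝ) w.length)]

end TwistedSum

/-- Gains `g n` made on passing from level `n` to level `n + q` can be collected along a residue
class modulo `q` in which the average gain is at least `(∑_{k < n} g k) / q`. -/
theorem exists_sum_range_eq_of_add_step {P : ℕ → ℝ → Prop} (hsucc : ∀ n x, P n x → P (n + 1) x)
    {q : ℕ} {g : ℕ → ℝ} (hstep : ∀ n x, P n x → P (n + (q + 1)) (x + g n)) (h0 : P 0 0) (n : ℕ) :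
    ∃ G : ℕ → ℝ, (∀ i ≤ q, P (n + i) (G i)) ∧
      ∑ k ∈ Finset.range n, g k = ∑ i ∈ Finset.range (q + 1), G i := by
  induction n with
  | zero =>
    refine ⟨0, fun i _ => ?_, by simp⟩
    rw [zero_add]
    induction i with
    | zero => exact h0
    | succ i ih => exact hsucc i 0 (ih (by omega))
  | succ n ih =>
    obtain ⟨G, hG, hsum⟩ := ih
    refine ⟨fun i => if i = q then G 0 + g n else G (i + 1), fun i hi => ?_, ?_⟩
    · dsimp only
      split_ifs with hiq
      · subst hiq
        simpa [add_comm, add_left_comm] using hstep n _ (hG 0 (Nat.zero_le _))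
      · simpa [add_comm, add_left_comm] using hG (i + 1) (by omega)
    · have hlt : ∀ i ∈ Finset.range q, (if i = q then G 0 + g n else G (i + 1)) = G (i + 1) :=
        fun i hi => if_neg (Finset.mem_range.1 hi).ne
      rw [Finset.sum_range_succ, hsum, Finset.sum_range_succ', Finset.sum_range_succ,
        Finset.sum_congr rfl hlt, if_pos rfl, add_assoc]

namespace Substitution

section BlockBound

variable {m : ℕ}

/-- The twisted sums over the blocks `ζ^n(b)` are bounded by `ρ` times the length of the block. -/
def BlockBound (ζ : Substitution m) (s : Fin m → ℝ) (ω : ℝ) (c : Fin m → ℂ) (n : ℕ) (ρ : ℝ) :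
    Prop :=
  ∀ b, ‖twistedSum s ω c (ζ.onWord^[n] [b])‖ ≤ ρ * (ζ.onWord^[n] [b]).length

namespace BlockBound

variable {ζ : Substitution m} {s : Fin m → ℝ} {ω : ℝ} {c : Fin m → ℂ} {n : ℕ} {ρ : ℝ}

theorem norm_le (h : ζ.BlockBound s ω c n ρ) (w : List (Fin m)) :
    ‖twistedSum s ω c (ζ.onWord^[n] w)‖ ≤ ρ * (ζ.onWord^[n] w).length := by
  rw [onWord_iterate_eq_flatMap]
  exact norm_twistedSum_flatMap_le h w

theorem add (h : ζ.BlockBound s ω c n ρ) (k : ℕ) : ζ.BlockBound s ω c (n + k) ρ := by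
  intro b
  rw [Function.iterate_add_apply]
  exact h.norm_le _

theorem mono (h : ζ.BlockBound s ω c n ρ) {ρ' : ℝ} (hρ : ρ ≤ ρ') : ζ.BlockBound s ω c n ρ' :=
  fun b => (h b).trans (by gcongr)

theorem norm_le_of_isInfix (h : ζ.BlockBound s ω c n ρ) (hρ : 0 ≤ ρ) {B : ℝ}
    (hB0 : 0 ≤ B) (hB : ∀ a, ‖c a‖ ≤ B) {w : List (Fin m)} {K : ℕ} {a : Fin m}
    (hw : w <:+: ζ.onWord^[K] [a]) :
    ‖twistedSum s ω c w‖ ≤ ρ * w.length + 2 * B * ζ.maxLength ^ n := by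
  have hshort : ∀ p : List (Fin m), p.length ≤ ζ.maxLength ^ n →
      ‖twistedSum s ω c p‖ ≤ B * ζ.maxLength ^ n := fun p hp =>
    (norm_twistedSum_le s ω hB p).trans (by gcongr; exact_mod_cast hp)
  rcases le_total n K with hK | hK
  · obtain ⟨k, rfl⟩ := Nat.exists_eq_add_of_le hK
    rw [Function.iterate_add_apply, onWord_iterate_eq_flatMap] at hw
    obtain ⟨p, v, q, rfl, hp, hq⟩ := exists_eq_append_flatMap_append_of_isInfix
      (ζ.length_onWord_iterate_singleton_le n) hw
    rw [← onWord_iterate_eq_flatMap, List.length_append, List.length_append]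
    have hpv := norm_twistedSum_append_le s ω c p (ζ.onWord^[n] v)
    have hpvq := norm_twistedSum_append_le s ω c (p ++ ζ.onWord^[n] v) q
    have hρp : 0 ≤ ρ * p.length := by positivity
    have hρq : 0 ≤ ρ * q.length := by positivity
    push_cast
    linarith [h.norm_le v, hshort p hp, hshort q hq]
  · have hlen : w.length ≤ ζ.maxLength ^ n :=
      hw.length_le.trans ((ζ.length_onWord_iterate_singleton_le K a).trans
        (Nat.pow_le_pow_right (by linarith [ζ.two_le_maxLength]) hK))
    have hρw : 0 ≤ ρ * w.length := by positivity
    have hBn : 0 ≤ B * ζ.maxLength ^ n := by positivity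
    linarith [hshort w hlen]

theorem mul_exp_of_return_word (h : ζ.BlockBound s ω c n ρ) (hρ : 0 ≤ ρ) {p q : ℕ}
    (hp : ∀ a b, a ∈ ζ.onWord^[p] [b]) {d : Fin m} {v : List (Fin m)}
    (hv : ∀ b, d :: v ++ [d] <:+: ζ.onWord^[q] [b]) :
    ζ.BlockBound s ω c (n + q) (ρ * Real.exp (-(4 / (ζ.maxLength : ℝ) ^ (p + q) *
      ‖((ω * wordLength s (ζ.onWord^[n] (d :: v)) : ℝ) : UnitAddCircle)‖ ^ 2))) := by
  intro b
  obtain ⟨P, r, hb⟩ := hv b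
  set ε := ‖((ω * wordLength s (ζ.onWord^[n] (d :: v)) : ℝ) : UnitAddCircle)‖ ^ 2 with hε
  set N : ℝ := ((ζ.onWord^[n + q] [b]).length : ℝ) with hN
  set D : ℝ := ((ζ.onWord^[n] [d]).length : ℝ) with hD
  have hdv : ζ.onWord^[n] (d :: v) = ζ.onWord^[n] [d] ++ ζ.onWord^[n] v := by
    rw [← onWord_iterate_append, List.singleton_append]
  have hsplit : ζ.onWord^[n + q] [b] = ζ.onWord^[n] P ++ (ζ.onWord^[n] [d] ++
      (ζ.onWord^[n] v ++ (ζ.onWord^[n] [d] ++ ζ.onWord^[n] r))) := by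
    rw [Function.iterate_add_apply, ← hb]
    simp only [onWord_iterate_append, hdv, List.append_assoc]
  have hlen : N = (ζ.onWord^[n] P).length + 2 * D + (ζ.onWord^[n] v).length +
      (ζ.onWord^[n] r).length := by
    rw [hN, hsplit]
    simp only [List.length_append]
    push_cast
    ring
  have hsum : ‖twistedSum s ω c (ζ.onWord^[n + q] [b])‖ ≤ ρ * (N - 4 * ε * D) := by
    have hreturn := norm_twistedSum_return_le s ω c (ζ.onWord^[n] P) (ζ.onWord^[n] [d])
      (ζ.onWord^[n] v) (ζ.onWord^[n] r)
    rw [← hsplit, ← hdv, ← hε] at hreturn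
    have hε_le : 0 ≤ 2 - 4 * ε := (norm_nonneg _).trans (norm_one_add_fourierChar_le _)
    have hblock := mul_le_mul_of_nonneg_left (h d) hε_le
    rw [hlen]
    linarith [h.norm_le P, h.norm_le v, h.norm_le r]
  have hproportion : 4 / (ζ.maxLength : ℝ) ^ (p + q) * ε * N ≤ 4 * ε * D := by
    have hA : 0 < (ζ.maxLength : ℝ) ^ (p + q) := pow_pos (by linarith [ζ.one_le_maxLength]) _
    have hcomp : N ≤ (ζ.maxLength : ℝ) ^ (p + q) * D := by
      rw [hN, hD]
      exact_mod_cast length_onWord_iterate_add_le_mul hp n q b d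
    calc 4 / (ζ.maxLength : ℝ) ^ (p + q) * ε * N
        ≤ 4 / (ζ.maxLength : ℝ) ^ (p + q) * ε * ((ζ.maxLength : ℝ) ^ (p + q) * D) := by gcongr
      _ = 4 * ε * D := by field_simp
  have hexp := mul_le_mul_of_nonneg_right
    (Real.one_sub_le_exp_neg (4 / (ζ.maxLength : ℝ) ^ (p + q) * ε)) (by positivity : 0 ≤ N)
  refine hsum.trans ?_
  rw [mul_assoc ρ]
  exact mul_le_mul_of_nonneg_left (by linarith) hρ

theorem mul_exp_sum (hρ : 0 ≤ ρ) (h0 : ζ.BlockBound s ω c 0 ρ) {q : ℕ} (hq : 0 < q)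
    {g : ℕ → ℝ} (hg : ∀ n ρ, 0 ≤ ρ → ζ.BlockBound s ω c n ρ →
      ζ.BlockBound s ω c (n + q) (ρ * Real.exp (-g n))) (n : ℕ) :
    ζ.BlockBound s ω c (n + q) (ρ * Real.exp (-((∑ k ∈ Finset.range n, g k) / q))) := by
  obtain ⟨q, rfl⟩ : ∃ q', q = q' + 1 := ⟨q - 1, by omega⟩
  obtain ⟨G, hG, hsum⟩ := exists_sum_range_eq_of_add_step
    (P := fun n x => ζ.BlockBound s ω c n (ρ * Real.exp (-x))) (fun n x h => h.add 1)
    (fun n x h => by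
      simpa [neg_add_rev, Real.exp_add, mul_assoc, mul_comm, mul_left_comm] using
        hg n _ (by positivity) h) (by simpa using h0) n
  obtain ⟨i, hi, hle⟩ : ∃ i ∈ Finset.range (q + 1),
      (∑ k ∈ Finset.range n, g k) / (q + 1 : ℕ) ≤ G i := by
    refine Finset.exists_le_of_sum_le Finset.nonempty_range_add_one ?_
    rw [← hsum, Finset.sum_const, Finset.card_range, nsmul_eq_mul,
      mul_div_cancel₀ _ (Nat.cast_ne_zero.2 q.succ_ne_zero)]
  rw [Finset.mem_range] at hi
  have hlevel := (hG i (by omega)).add (q + 1 - i)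
  rw [show n + i + (q + 1 - i) = n + (q + 1) by omega] at hlevel
  exact hlevel.mono (by gcongr)

end BlockBound

end BlockBound

end Substitution

/-! ### The Erdős–Kahane argument on a line -/

/-- The integer vectors of length `N` with entries of absolute value at most `H`, of which at most
`J` are nonzero. -/
noncomputable def sparseVectors (N H : ℕ) (J : ℝ) : Finset (Fin N → ℤ) :=
  (Fintype.piFinset fun _ : Fin N => Finset.Icc (-(H : ℤ)) H).filter fun d =>
    ((Finset.univ.filter fun k => d k ≠ 0).card : ℝ) ≤ J

theorem mem_sparseVectors {N H : ℕ} {J : ℝ} {d : Fin N → ℤ} :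
    d ∈ sparseVectors N H J ↔
      (∀ k, |d k| ≤ H) ∧ ((Finset.univ.filter fun k => d k ≠ 0).card : ℝ) ≤ J := by
  simp only [sparseVectors, Finset.mem_filter, Fintype.mem_piFinset, Finset.mem_Icc, abs_le]

-- Weight each nonzero entry by `x`: the total weight of all vectors is `(1 + 2 H x) ^ N`.
theorem card_sparseVectors_mul_rpow_le (N H : ℕ) (J : ℝ) {x : ℝ} (hx0 : 0 < x) (hx1 : x ≤ 1) :
    (sparseVectors N H J).card * x ^ J ≤ (1 + 2 * H * x) ^ N := by
  classical
  have hfactor : ∑ j ∈ Finset.Icc (-(H : ℤ)) H, (if j ≠ 0 then x else 1) = 1 + 2 * H * x := by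
    have h0 : (0 : ℤ) ∈ Finset.Icc (-(H : ℤ)) H := by simp
    rw [← Finset.add_sum_erase _ _ h0, Finset.sum_congr rfl fun j hj =>
      if_pos (Finset.ne_of_mem_erase hj), Finset.sum_const, Finset.card_erase_of_mem h0,
      Int.card_Icc, nsmul_eq_mul, show ((H : ℤ) + 1 - -(H : ℤ)).toNat - 1 = 2 * H by omega]
    simp
  have htotal : (1 + 2 * H * x) ^ N = ∑ d ∈ Fintype.piFinset fun _ : Fin N =>
      Finset.Icc (-(H : ℤ)) H, ∏ k, (if d k ≠ 0 then x else 1) := by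
    rw [← Finset.prod_univ_sum (fun _ : Fin N => Finset.Icc (-(H : ℤ)) H)
      (fun _ j => if j ≠ 0 then x else (1 : ℝ)), hfactor, Finset.prod_const, Finset.card_univ,
      Fintype.card_fin]
  have hnonneg : ∀ d : Fin N → ℤ, 0 ≤ ∏ k, (if d k ≠ 0 then x else (1 : ℝ)) := fun d =>
    Finset.prod_nonneg fun k _ => by split_ifs <;> positivity
  have hweight : ∀ d ∈ sparseVectors N H J, x ^ J ≤ ∏ k, (if d k ≠ 0 then x else (1 : ℝ)) := by
    intro d hd
    rw [Finset.prod_ite, Finset.prod_const, Finset.prod_const_one, mul_one, ← Real.rpow_natCast]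
    exact Real.rpow_le_rpow_of_exponent_ge hx0 hx1 (mem_sparseVectors.1 hd).2
  rw [htotal, ← nsmul_eq_mul]
  refine (Finset.card_nsmul_le_sum _ _ _ hweight).trans ?_
  refine Finset.sum_le_sum_of_subset_of_nonneg (fun d hd => ?_) fun d _ _ => hnonneg d
  simpa only [Fintype.mem_piFinset, Finset.mem_Icc, abs_le] using (mem_sparseVectors.1 hd).1

theorem exists_card_sparseVectors_le_exp (H : ℕ) {ε : ℝ} (hε : 0 < ε) :
    ∃ δ > 0, ∀ (N : ℕ) (n : ℝ), N ≤ n →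
      ((sparseVectors N H (δ * n)).card : ℝ) ≤ Real.exp (2 * (ε * n)) := by
  set x : ℝ := min 1 (ε / (2 * H + 1))
  have hx0 : 0 < x := lt_min one_pos (by positivity)
  have hx1 : x ≤ 1 := min_le_left _ _
  have hHx : 2 * H * x ≤ ε := by
    have h := (le_div_iff₀ (by positivity)).1 (min_le_right 1 (ε / (2 * (H : ℝ) + 1)))
    linarith
  have hlog : 0 < 1 - Real.log x := by linarith [Real.log_nonpos hx0.le hx1]
  refine ⟨ε / (1 - Real.log x), by positivity, fun N n hNn => ?_⟩
  have hn : 0 ≤ n := (Nat.cast_nonneg N).trans hNn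
  have hcount : (1 + 2 * H * x) ^ N ≤ Real.exp (ε * n) := calc
    (1 + 2 * H * x) ^ N ≤ Real.exp ε ^ N := by
      refine pow_le_pow_left₀ (by positivity) ?_ N
      linarith [Real.add_one_le_exp ε]
    _ ≤ Real.exp (ε * n) := by
      rw [← Real.exp_nat_mul, mul_comm]
      gcongr
  have hweight : Real.exp (-(ε * n)) ≤ x ^ (ε / (1 - Real.log x) * n) := by
    rw [Real.rpow_def_of_pos hx0]
    refine Real.exp_le_exp.2 ?_
    have hδn : 0 ≤ ε / (1 - Real.log x) * n := by positivity
    have hcancel : (1 - Real.log x) * (ε / (1 - Real.log x) * n) = ε * n := by field_simp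
    linarith
  have h := (mul_le_mul_of_nonneg_left hweight (Nat.cast_nonneg _)).trans
    ((card_sparseVectors_mul_rpow_le N H _ hx0 hx1).trans hcount)
  rwa [Real.exp_neg, ← div_eq_mul_inv, div_le_iff₀ (Real.exp_pos _), ← Real.exp_add,
    ← two_mul] at h

theorem volume_le_card_mul_of_abs_sub_le {ι : Type*} {S : Set ℝ} {code : ℝ → ι} {F : Finset ι}
    (hF : ∀ t ∈ S, code t ∈ F) {r : ℝ}
    (hr : ∀ t ∈ S, ∀ t' ∈ S, code t = code t' → |t - t'| ≤ r) :
    volume S ≤ ENNReal.ofReal (F.card * r) := by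
  have hsub : S ⊆ ⋃ i ∈ F, {t ∈ S | code t = i} := fun t ht => by
    simp only [Set.mem_iUnion]
    exact ⟨code t, hF t ht, ht, rfl⟩
  refine (measure_mono hsub).trans ((measure_biUnion_finset_le _ _).trans ?_)
  rw [ENNReal.ofReal_mul (by positivity), ENNReal.ofReal_natCast, ← nsmul_eq_mul]
  refine Finset.sum_le_card_nsmul _ _ _ fun i _ => ?_
  refine (Real.volume_le_diam _).trans (Metric.ediam_le fun t ht t' ht' => ?_)
  rw [edist_dist, Real.dist_eq]
  exact ENNReal.ofReal_le_ofReal (hr t ht.1 t' ht'.1 (ht.2.trans ht'.2.symm))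

section Recurrence

open Polynomial

/-- The defect at time `k` of the sequence `y` with respect to the linear recurrence with
characteristic polynomial `p`. -/
def recDefect {R : Type*} [Ring R] (p : ℤ[X]) (y : ℕ → R) (k : ℕ) : R :=
  ∑ i ∈ Finset.range (p.natDegree + 1), (p.coeff i : R) * y (k + i)

theorem eq_of_recDefect_eq {p : ℤ[X]} (hp : p.Monic) {K K' : ℕ → ℤ} {N : ℕ}
    (hinit : ∀ i < p.natDegree, K i = K' i)
    (hdefect : ∀ k < N, recDefect p K k = recDefect p K' k) :
    ∀ k < N + p.natDegree, K k = K' k := by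
  intro k
  induction k using Nat.strong_induction_on with
  | _ k ih =>
    intro hk
    rcases lt_or_ge k p.natDegree with hkm | hkm
    · exact hinit k hkm
    obtain ⟨j, rfl⟩ := Nat.exists_eq_add_of_le' hkm
    have hj := hdefect j (by omega)
    have hlower : ∀ i ∈ Finset.range p.natDegree,
        (p.coeff i : ℤ) * K (j + i) = p.coeff i * K' (j + i) := fun i hi => by
      have hi := Finset.mem_range.1 hi
      rw [ih (j + i) (by omega) (by omega)]
    simp only [recDefect, Finset.sum_range_succ, hp.coeff_natDegree, Int.cast_id] at hj
    rw [Finset.sum_congr rfl hlower] at hj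
    simpa using hj

variable {p : ℤ[X]} {y : ℕ → ℝ}

theorem abs_recDefect_round_le (hy : ∀ k, recDefect p y k = 0) (k : ℕ) :
    |((recDefect p (fun k => round (y k)) k : ℤ) : ℝ)| ≤
      ∑ i ∈ Finset.range (p.natDegree + 1), |(p.coeff i : ℝ)| * ‖(y (k + i) : UnitAddCircle)‖ := by
  have hdiff : ((recDefect p (fun k => round (y k)) k : ℤ) : ℝ) =
      -∑ i ∈ Finset.range (p.natDegree + 1),
        (p.coeff i : ℝ) * (y (k + i) - round (y (k + i))) := by
    have h := hy k
    simp only [recDefect] at h ⊢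
    simp only [mul_sub, Finset.sum_sub_distrib, h]
    push_cast
    ring
  rw [hdiff, abs_neg]
  refine (Finset.abs_sum_le_sum_abs _ _).trans (Finset.sum_le_sum fun i _ => ?_)
  rw [abs_mul, UnitAddCircle.norm_eq]

theorem abs_recDefect_round_le_sum_natAbs (hy : ∀ k, recDefect p y k = 0) (k : ℕ) :
    |recDefect p (fun k => round (y k)) k| ≤
      (∑ i ∈ Finset.range (p.natDegree + 1), (p.coeff i).natAbs : ℕ) := by
  have hle : |((recDefect p (fun k => round (y k)) k : ℤ) : ℝ)| ≤
      ∑ i ∈ Finset.range (p.natDegree + 1), |(p.coeff i : ℝ)| := by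
    refine (abs_recDefect_round_le hy k).trans (Finset.sum_le_sum fun i _ => ?_)
    refine mul_le_of_le_one_right (abs_nonneg _) ?_
    rw [UnitAddCircle.norm_eq]
    exact (abs_sub_round _).trans (by norm_num)
  push_cast
  exact_mod_cast hle

-- A nonzero integer defect is at least `1` in absolute value, so by Cauchy–Schwarz it forces some
-- nearby term of `y` away from the integers.
theorem card_recDefect_ne_zero_le (hy : ∀ k, recDefect p y k = 0) (N : ℕ) :
    (((Finset.univ : Finset (Fin N)).filter fun k : Fin N =>
      recDefect p (fun k => round (y k)) k ≠ 0).card : ℝ) ≤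
    ((∑ i ∈ Finset.range (p.natDegree + 1), |(p.coeff i : ℝ)| ^ 2) * (p.natDegree + 1)) *
      ∑ k ∈ Finset.range (N + p.natDegree), ‖(y k : UnitAddCircle)‖ ^ 2 := by
  set P : ℝ := ∑ i ∈ Finset.range (p.natDegree + 1), |(p.coeff i : ℝ)| ^ 2
  have hone : ∀ k : Fin N, recDefect p (fun k => round (y k)) k ≠ 0 →
      1 ≤ P * ∑ i ∈ Finset.range (p.natDegree + 1), ‖(y (k + i) : UnitAddCircle)‖ ^ 2 := by
    intro k hk
    have h1 : (1 : ℝ) ≤ |((recDefect p (fun k => round (y k)) k : ℤ) : ℝ)| := by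
      exact_mod_cast Int.one_le_abs hk
    exact (one_le_pow₀ (h1.trans (abs_recDefect_round_le hy k))).trans
      (Finset.sum_mul_sq_le_sq_mul_sq _ _ _)
  have hshift : ∀ i ∈ Finset.range (p.natDegree + 1),
      ∑ k : Fin N, ‖(y (k + i) : UnitAddCircle)‖ ^ 2 ≤
        ∑ k ∈ Finset.range (N + p.natDegree), ‖(y k : UnitAddCircle)‖ ^ 2 := by
    intro i hi
    have hi := Finset.mem_range.1 hi
    rw [Fin.sum_univ_eq_sum_range (fun k => ‖(y (k + i) : UnitAddCircle)‖ ^ 2) N]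
    refine (Finset.sum_map (Finset.range N) (addRightEmbedding i)
      (fun k => ‖(y k : UnitAddCircle)‖ ^ 2)).symm.le.trans ?_
    refine Finset.sum_le_sum_of_subset_of_nonneg (fun k hk => ?_) fun _ _ _ => sq_nonneg _
    simp only [Finset.mem_map, Finset.mem_range, addRightEmbedding_apply] at hk ⊢
    omega
  calc (((Finset.univ : Finset (Fin N)).filter fun k : Fin N =>
        recDefect p (fun k => round (y k)) k ≠ 0).card : ℝ)
      = ∑ k : Fin N, if recDefect p (fun k => round (y k)) k ≠ 0 then 1 else 0 := by
        rw [Finset.sum_boole]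
    _ ≤ ∑ k : Fin N, P * ∑ i ∈ Finset.range (p.natDegree + 1),
          ‖(y (k + i) : UnitAddCircle)‖ ^ 2 := by
        refine Finset.sum_le_sum fun k _ => ?_
        split_ifs with hk
        · exact hone k hk
        · positivity
    _ = P * ∑ i ∈ Finset.range (p.natDegree + 1),
          ∑ k : Fin N, ‖(y (k + i) : UnitAddCircle)‖ ^ 2 := by
        rw [← Finset.mul_sum, Finset.sum_comm]
    _ ≤ P * ((p.natDegree + 1) * ∑ k ∈ Finset.range (N + p.natDegree),
          ‖(y k : UnitAddCircle)‖ ^ 2) := by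
        gcongr
        simpa using Finset.sum_le_card_nsmul _ _ _ hshift
    _ = _ := by ring

end Recurrence

section Line

open Polynomial

/-- A line `t ↦ A + t B` of real solutions of the recurrence with characteristic polynomial `p`,
together with two eigenfunctionals of the shift, with eigenvalues `θ j` of modulus at least `ρ`,
whose values `α j + t β j` along the line are not proportional. -/
structure ExpandingLine (p : ℤ[X]) (ρ : ℝ) where
  A : ℕ → ℝ
  B : ℕ → ℝ
  θ : Fin 2 → ℂ
  g : Fin 2 → ℕ → ℂ
  α : Fin 2 → ℂ
  β : Fin 2 → ℂ
  recDefect_A : ∀ k, recDefect p A k = 0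
  recDefect_B : ∀ k, recDefect p B k = 0
  le_norm : ∀ j, ρ ≤ ‖θ j‖
  sum_A : ∀ j N, ∑ i ∈ Finset.range p.natDegree, g j i * A (N + i) = θ j ^ N * α j
  sum_B : ∀ j N, ∑ i ∈ Finset.range p.natDegree, g j i * B (N + i) = θ j ^ N * β j
  det_ne_zero : α 0 * β 1 - α 1 * β 0 ≠ 0

theorem abs_sub_mul_norm_det_le {α β : Fin 2 → ℂ} {t t' ω ω' E X : ℝ}
    (hE : ∀ j, ‖α j + t * β j‖ ≤ E)
    (hX : ∀ j, ‖ω * (α j + t * β j) - ω' * (α j + t' * β j)‖ ≤ X) :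
    |t - t'| * (|ω'| * ‖α 0 * β 1 - α 1 * β 0‖) ≤ 2 * E * X := by
  set a : Fin 2 → ℂ := fun j => α j + t * β j with ha
  set D : Fin 2 → ℂ := fun j => ω * (α j + t * β j) - ω' * (α j + t' * β j) with hD
  have hdet : a 1 * D 0 - a 0 * D 1 = ((ω' * (t' - t) : ℝ) : ℂ) * (α 0 * β 1 - α 1 * β 0) := by
    simp only [ha, hD]
    push_cast
    ring
  calc |t - t'| * (|ω'| * ‖α 0 * β 1 - α 1 * β 0‖)
      = ‖a 1 * D 0 - a 0 * D 1‖ := by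
        rw [hdet, norm_mul, Complex.norm_real, Real.norm_eq_abs, abs_mul, abs_sub_comm t' t]
        ring
    _ ≤ ‖a 1‖ * ‖D 0‖ + ‖a 0‖ * ‖D 1‖ := by
        rw [← norm_mul, ← norm_mul]
        exact norm_sub_le _ _
    _ ≤ E * X + E * X := by
        have hE0 : 0 ≤ E := (norm_nonneg _).trans (hE 0)
        gcongr
        exacts [hE 1, hX 0, hE 0, hX 1]
    _ = 2 * E * X := by ring

namespace ExpandingLine

variable {p : ℤ[X]} {ρ : ℝ} (ℓ : ExpandingLine p ρ)

/-- The orbit of the frequency `ω` at the point of parameter `t` of the line. -/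
def orbit (ω t : ℝ) (k : ℕ) : ℝ := ω * (ℓ.A k + t * ℓ.B k)

theorem recDefect_orbit (ω t : ℝ) (k : ℕ) : recDefect p (ℓ.orbit ω t) k = 0 := by
  have hA := ℓ.recDefect_A k
  have hB := ℓ.recDefect_B k
  simp only [recDefect, orbit] at hA hB ⊢
  rw [← mul_zero (ω * 1), ← add_zero 0, mul_add, mul_one]
  nth_rewrite 1 [← hA]
  rw [← mul_zero t, ← hB]
  simp only [Finset.mul_sum, ← Finset.sum_add_distrib]
  exact Finset.sum_congr rfl fun i _ => by ring

theorem sum_orbit (ω t : ℝ) (j : Fin 2) (N : ℕ) :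
    ∑ i ∈ Finset.range p.natDegree, ℓ.g j i * ℓ.orbit ω t (N + i) =
      ℓ.θ j ^ N * (ω * (ℓ.α j + t * ℓ.β j)) := by
  calc ∑ i ∈ Finset.range p.natDegree, ℓ.g j i * (ℓ.orbit ω t (N + i) : ℂ)
      = ω * (∑ i ∈ Finset.range p.natDegree, ℓ.g j i * ℓ.A (N + i) +
          t * ∑ i ∈ Finset.range p.natDegree, ℓ.g j i * ℓ.B (N + i)) := by
        simp only [Finset.mul_sum, ← Finset.sum_add_distrib, orbit]
        push_cast
        exact Finset.sum_congr rfl fun i _ => by ring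
    _ = _ := by
        rw [ℓ.sum_A, ℓ.sum_B]
        ring

theorem norm_eigenvalue_sub_le (hρ : 0 < ρ) {N : ℕ} {t t' ω ω' : ℝ}
    (hround : ∀ k < N + p.natDegree, round (ℓ.orbit ω t k) = round (ℓ.orbit ω' t' k))
    (j : Fin 2) :
    ‖ω * (ℓ.α j + t * ℓ.β j) - ω' * (ℓ.α j + t' * ℓ.β j)‖ ≤
      (∑ i ∈ Finset.range p.natDegree, ‖ℓ.g j i‖) * ρ⁻¹ ^ N := by
  have hclose : ∀ i < p.natDegree, |ℓ.orbit ω t (N + i) - ℓ.orbit ω' t' (N + i)| ≤ 1 := by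
    intro i hi
    have h := abs_sub_round (ℓ.orbit ω t (N + i))
    have h' := abs_sub_round (ℓ.orbit ω' t' (N + i))
    rw [← hround (N + i) (by omega), abs_sub_comm] at h'
    linarith [abs_sub_le (ℓ.orbit ω t (N + i)) (round (ℓ.orbit ω t (N + i)))
      (ℓ.orbit ω' t' (N + i))]
  rw [inv_pow, ← div_eq_mul_inv, le_div_iff₀ (by positivity), mul_comm]
  calc ρ ^ N * ‖ω * (ℓ.α j + t * ℓ.β j) - ω' * (ℓ.α j + t' * ℓ.β j)‖
      ≤ ‖ℓ.θ j ^ N * (ω * (ℓ.α j + t * ℓ.β j) - ω' * (ℓ.α j + t' * ℓ.β j))‖ := by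
        rw [norm_mul, norm_pow]
        gcongr
        exact ℓ.le_norm j
    _ = ‖∑ i ∈ Finset.range p.natDegree,
          ℓ.g j i * ((ℓ.orbit ω t (N + i) - ℓ.orbit ω' t' (N + i) : ℝ) : ℂ)‖ := by
        rw [mul_sub, ← sum_orbit, ← sum_orbit, ← Finset.sum_sub_distrib]
        push_cast
        simp only [mul_sub]
    _ ≤ ∑ i ∈ Finset.range p.natDegree, ‖ℓ.g j i‖ := by
        refine (norm_sum_le _ _).trans (Finset.sum_le_sum fun i hi => ?_)
        rw [norm_mul, Complex.norm_real, Real.norm_eq_abs]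
        exact mul_le_of_le_one_right (norm_nonneg _) (hclose i (Finset.mem_range.1 hi))

theorem exists_abs_sub_le_of_round_eq (hρ : 0 < ρ) {τ : ℝ} (hτ : 0 ≤ τ) :
    ∃ W ≥ 0, ∀ (N : ℕ) (t t' ω ω' : ℝ), |t| ≤ τ →
      (∀ k < N + p.natDegree, round (ℓ.orbit ω t k) = round (ℓ.orbit ω' t' k)) →
      |t - t'| * |ω'| ≤ W * ρ⁻¹ ^ N := by
  have hdet : 0 < ‖ℓ.α 0 * ℓ.β 1 - ℓ.α 1 * ℓ.β 0‖ := norm_pos_iff.2 ℓ.det_ne_zero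
  set Γ : ℝ := ∑ j, ∑ i ∈ Finset.range p.natDegree, ‖ℓ.g j i‖
  set E : ℝ := ∑ j, (‖ℓ.α j‖ + τ * ‖ℓ.β j‖)
  refine ⟨2 * E * Γ / ‖ℓ.α 0 * ℓ.β 1 - ℓ.α 1 * ℓ.β 0‖, by positivity,
    fun N t t' ω ω' ht hround => ?_⟩
  have hE : ∀ j, ‖ℓ.α j + t * ℓ.β j‖ ≤ E := fun j => calc
    ‖ℓ.α j + t * ℓ.β j‖ ≤ ‖ℓ.α j‖ + τ * ‖ℓ.β j‖ := by
      refine (norm_add_le _ _).trans ?_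
      rw [norm_mul, Complex.norm_real, Real.norm_eq_abs]
      gcongr
    _ ≤ E := Finset.single_le_sum (f := fun j => ‖ℓ.α j‖ + τ * ‖ℓ.β j‖)
      (fun _ _ => by positivity) (Finset.mem_univ j)
  have hX : ∀ j, ‖ω * (ℓ.α j + t * ℓ.β j) - ω' * (ℓ.α j + t' * ℓ.β j)‖ ≤ Γ * ρ⁻¹ ^ N :=
    fun j => (ℓ.norm_eigenvalue_sub_le hρ hround j).trans <| by
      gcongr
      exact Finset.single_le_sum (f := fun j => ∑ i ∈ Finset.range p.natDegree, ‖ℓ.g j i‖)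
        (fun _ _ => by positivity) (Finset.mem_univ j)
  rw [div_mul_eq_mul_div, le_div_iff₀ hdet, mul_assoc, mul_assoc (2 * E)]
  exact abs_sub_mul_norm_det_le hE hX

/-- The parameters for which the Erdős–Kahane sum of length `n` is small for some frequency. -/
def bad (ε η τ : ℝ) (n : ℕ) : Set ℝ :=
  {t | |t| ≤ τ ∧ ∃ ω : ℝ, Real.exp (-(ε * n)) ≤ |ω| ∧ |ω| ≤ Real.exp (ε * n) ∧
    ∑ k ∈ Finset.range n, ‖(ℓ.orbit ω t k : UnitAddCircle)‖ ^ 2 < η * n}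

theorem exists_abs_round_orbit_le {τ : ℝ} (hτ : 0 ≤ τ) :
    ∃ M : ℝ, 0 ≤ M ∧ ∀ (t ω e : ℝ), |t| ≤ τ → |ω| ≤ e → ∀ i < p.natDegree,
      |round (ℓ.orbit ω t i)| ≤ (⌈e * M⌉₊ + 1 : ℕ) := by
  refine ⟨∑ i ∈ Finset.range p.natDegree, (|ℓ.A i| + τ * |ℓ.B i|), by positivity,
    fun t ω e ht hω i hi => ?_⟩
  set M : ℝ := ∑ i ∈ Finset.range p.natDegree, (|ℓ.A i| + τ * |ℓ.B i|)
  have hpoint : |ℓ.A i + t * ℓ.B i| ≤ M := calc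
    |ℓ.A i + t * ℓ.B i| ≤ |ℓ.A i| + τ * |ℓ.B i| := by
      refine (abs_add_le _ _).trans ?_
      rw [abs_mul]
      gcongr
    _ ≤ M := Finset.single_le_sum (f := fun i => |ℓ.A i| + τ * |ℓ.B i|)
      (fun _ _ => by positivity) (Finset.mem_range.2 hi)
  have horbit : |ℓ.orbit ω t i| ≤ e * M := by
    rw [orbit, abs_mul]
    exact mul_le_mul hω hpoint (abs_nonneg _) ((abs_nonneg _).trans hω)
  have hround := abs_sub_abs_le_abs_sub (round (ℓ.orbit ω t i) : ℝ) (ℓ.orbit ω t i)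
  rw [abs_sub_comm] at hround
  have hle : |(round (ℓ.orbit ω t i) : ℝ)| ≤ (⌈e * M⌉₊ + 1 : ℕ) := by
    push_cast
    linarith [Nat.le_ceil (e * M), abs_sub_round (ℓ.orbit ω t i)]
  exact_mod_cast hle

theorem card_piFinset_Icc_ceil_le {e M : ℝ} (he : 1 ≤ e) (hM : 0 ≤ M) (m : ℕ) :
    ((Fintype.piFinset fun _ : Fin m =>
      Finset.Icc (-((⌈e * M⌉₊ + 1 : ℕ) : ℤ)) (⌈e * M⌉₊ + 1 : ℕ)).card : ℝ) ≤
        ((2 * M + 5) * e) ^ m := by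
  rw [Fintype.card_piFinset, Finset.prod_const, Finset.card_univ, Fintype.card_fin, Int.card_Icc,
    show (((⌈e * M⌉₊ + 1 : ℕ) : ℤ) + 1 - -((⌈e * M⌉₊ + 1 : ℕ) : ℤ)).toNat = 2 * ⌈e * M⌉₊ + 3 by
      omega]
  push_cast
  gcongr
  linarith [Nat.ceil_lt_add_one (a := e * M) (by positivity)]

/-- The rounded first `deg p` values of the orbit of `ω` at `t`, and the first `N` defects of the
rounded orbit; they determine the rounded orbit up to time `N + deg p`. -/
noncomputable def code (N : ℕ) (ω t : ℝ) : (Fin p.natDegree → ℤ) × (Fin N → ℤ) :=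
  (fun i => round (ℓ.orbit ω t i), fun k => recDefect p (fun k => round (ℓ.orbit ω t k)) k)

theorem round_orbit_eq_of_code_eq (hp : p.Monic) {N : ℕ} {t t' ω ω' : ℝ}
    (h : ℓ.code N ω t = ℓ.code N ω' t') :
    ∀ k < N + p.natDegree, round (ℓ.orbit ω t k) = round (ℓ.orbit ω' t' k) := by
  obtain ⟨hrounds, hdefects⟩ := Prod.mk.inj h
  exact eq_of_recDefect_eq hp (fun i hi => congrFun hrounds ⟨i, hi⟩)
    fun k hk => congrFun hdefects ⟨k, hk⟩

theorem code_snd_mem_sparseVectors {N : ℕ} {t ω J : ℝ}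
    (hJ : (∑ i ∈ Finset.range (p.natDegree + 1), |(p.coeff i : ℝ)| ^ 2) * (p.natDegree + 1) *
      ∑ k ∈ Finset.range (N + p.natDegree), ‖(ℓ.orbit ω t k : UnitAddCircle)‖ ^ 2 ≤ J) :
    (ℓ.code N ω t).2 ∈
      sparseVectors N (∑ i ∈ Finset.range (p.natDegree + 1), (p.coeff i).natAbs) J :=
  mem_sparseVectors.2
    ⟨fun k => abs_recDefect_round_le_sum_natAbs (ℓ.recDefect_orbit _ _) k,
      (card_recDefect_ne_zero_le (ℓ.recDefect_orbit _ _) N).trans hJ⟩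

-- Two bad parameters with the same code are at distance `O(e^{εn} ρ⁻ᴺ)`, and there are few codes.
theorem exists_volume_bad_le_of_card_le (hp : p.Monic) (hρ : 0 < ρ) {τ ε δ η : ℝ} (hτ : 0 ≤ τ)
    (hε : 0 ≤ ε)
    (hη : (∑ i ∈ Finset.range (p.natDegree + 1), |(p.coeff i : ℝ)| ^ 2) * (p.natDegree + 1) * η ≤ δ)
    (hδ : ∀ (N : ℕ) (n : ℝ), N ≤ n →
      ((sparseVectors N (∑ i ∈ Finset.range (p.natDegree + 1), (p.coeff i).natAbs)
        (δ * n)).card : ℝ) ≤ Real.exp (2 * (ε * n))) :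
    ∃ C : ℝ, ∀ N : ℕ, volume (ℓ.bad ε η τ (N + p.natDegree)) ≤ ENNReal.ofReal
      (C * (Real.exp (ε * (N + p.natDegree : ℕ)) ^ (p.natDegree + 3) * ρ⁻¹ ^ N)) := by
  obtain ⟨W, hW, hsep⟩ := ℓ.exists_abs_sub_le_of_round_eq hρ hτ
  obtain ⟨M, hM, hinit⟩ := ℓ.exists_abs_round_orbit_le hτ
  refine ⟨(2 * M + 5) ^ p.natDegree * W, fun N => ?_⟩
  set n : ℕ := N + p.natDegree with hn
  set e := Real.exp (ε * n) with he
  have he1 : 1 ≤ e := Real.one_le_exp (by positivity)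
  choose! ω hω using fun t (ht : t ∈ ℓ.bad ε η τ n) => ht.2
  set F₁ := Fintype.piFinset fun _ : Fin p.natDegree =>
    Finset.Icc (-((⌈e * M⌉₊ + 1 : ℕ) : ℤ)) (⌈e * M⌉₊ + 1 : ℕ) with hF₁
  set F₂ := sparseVectors N (∑ i ∈ Finset.range (p.natDegree + 1), (p.coeff i).natAbs) (δ * n)
  have hcode : ∀ t ∈ ℓ.bad ε η τ n, ℓ.code N (ω t) t ∈ F₁ ×ˢ F₂ := by
    intro t ht
    refine Finset.mem_product.2 ⟨?_, ℓ.code_snd_mem_sparseVectors ?_⟩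
    · simp only [hF₁, Fintype.mem_piFinset, Finset.mem_Icc, ← abs_le]
      exact fun i => hinit t (ω t) e ht.1 (hω t ht).2.1 i i.2
    · refine (mul_le_mul_of_nonneg_left (hω t ht).2.2.le (by positivity)).trans ?_
      rw [← mul_assoc]
      gcongr
  have hclose : ∀ t ∈ ℓ.bad ε η τ n, ∀ t' ∈ ℓ.bad ε η τ n,
      ℓ.code N (ω t) t = ℓ.code N (ω t') t' → |t - t'| ≤ W * ρ⁻¹ ^ N * e := by
    intro t ht t' ht' heq
    have hfreq := hsep N t t' (ω t) (ω t') ht.1 (ℓ.round_orbit_eq_of_code_eq hp heq)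
    have hlow := mul_le_mul_of_nonneg_left (hω t' ht').1 (abs_nonneg (t - t'))
    rw [Real.exp_neg, ← he, ← div_eq_mul_inv] at hlow
    exact (div_le_iff₀ (by positivity)).1 (hlow.trans hfreq)
  refine (volume_le_card_mul_of_abs_sub_le hcode hclose).trans (ENNReal.ofReal_le_ofReal ?_)
  have hF₂ : (F₂.card : ℝ) ≤ e ^ 2 := (hδ N n (by simp [hn])).trans_eq (by
    rw [he, ← Real.exp_nat_mul]
    norm_num)
  rw [Finset.card_product]
  push_cast
  calc (F₁.card : ℝ) * F₂.card * (W * ρ⁻¹ ^ N * e)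
      ≤ ((2 * M + 5) * e) ^ p.natDegree * e ^ 2 * (W * ρ⁻¹ ^ N * e) := by
        gcongr
        exact card_piFinset_Icc_ceil_le he1 hM _
    _ = (2 * M + 5) ^ p.natDegree * W * (e ^ (p.natDegree + 3) * ρ⁻¹ ^ N) := by
        rw [mul_pow]
        ring

end ExpandingLine

theorem exists_volume_expandingLine_bad_le {p : ℤ[X]} (hp : p.Monic) {ρ : ℝ} (hρ : 1 < ρ) :
    ∃ ε > 0, ∃ η > 0, ∀ (ℓ : ExpandingLine p ρ) (τ : ℝ), 0 ≤ τ → ∃ C : ℝ, ∀ N : ℕ,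
      volume (ℓ.bad ε η τ (N + p.natDegree)) ≤
        ENNReal.ofReal (C * Real.exp (-(Real.log ρ / 2)) ^ N) := by
  have hlog : 0 < Real.log ρ := Real.log_pos hρ
  set c : ℝ := (∑ i ∈ Finset.range (p.natDegree + 1), |(p.coeff i : ℝ)| ^ 2) * (p.natDegree + 1)
  have : 0 ≤ c := by positivity
  set ε : ℝ := Real.log ρ / (2 * (p.natDegree + 3)) with hε
  have hε0 : 0 < ε := by positivity
  obtain ⟨δ, hδ, hcard⟩ := exists_card_sparseVectors_le_exp
    (∑ i ∈ Finset.range (p.natDegree + 1), (p.coeff i).natAbs) hε0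
  have hη : c * (δ / (c + 1)) ≤ δ := by
    rw [mul_div_assoc', div_le_iff₀ (by positivity)]
    nlinarith
  refine ⟨ε, hε0, δ / (c + 1), by positivity, fun ℓ τ hτ => ?_⟩
  obtain ⟨C, hC⟩ := ℓ.exists_volume_bad_le_of_card_le hp (by linarith) hτ hε0.le hη hcard
  refine ⟨C * Real.exp (Real.log ρ / 2 * p.natDegree), fun N => (hC N).trans_eq ?_⟩
  rw [mul_assoc C]
  congr 2
  rw [show ρ⁻¹ = Real.exp (-Real.log ρ) by rw [Real.exp_neg, Real.exp_log (by linarith)],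
    ← Real.exp_nat_mul, ← Real.exp_nat_mul, ← Real.exp_nat_mul, ← Real.exp_add, ← Real.exp_add]
  congr 1
  rw [hε]
  push_cast
  field_simp
  ring

/-- The Erdős–Kahane condition on `L`: for all large `n`, every frequency in
`[e^{-εn}, e^{εn}]` stays away from the integers, in quadratic mean over the first `n` times. -/
def ErdosKahane (L : ℕ → ℝ) (ε η : ℝ) : Prop :=
  ∀ᶠ n : ℕ in Filter.atTop, ∀ ω : ℝ, Real.exp (-(ε * n)) ≤ |ω| → |ω| ≤ Real.exp (ε * n) →
    η * n ≤ ∑ k ∈ Finset.range n, ‖((ω * L k : ℝ) : UnitAddCircle)‖ ^ 2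

theorem exists_ae_erdosKahane_expandingLine {p : ℤ[X]} (hp : p.Monic) {ρ : ℝ} (hρ : 1 < ρ) :
    ∃ ε > 0, ∃ η > 0, ∀ ℓ : ExpandingLine p ρ,
      ∀ᵐ t : ℝ, ErdosKahane (fun k => ℓ.A k + t * ℓ.B k) ε η := by
  obtain ⟨ε, hε, η, hη, h⟩ := exists_volume_expandingLine_bad_le hp hρ
  refine ⟨ε, hε, η, hη, fun ℓ => ?_⟩
  have hτ : ∀ τ : ℕ, ∀ᵐ t : ℝ, ∀ᶠ N : ℕ in Filter.atTop,
      t ∉ ℓ.bad ε η τ (N + p.natDegree) := by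
    intro τ
    obtain ⟨C, hC⟩ := h ℓ τ (Nat.cast_nonneg _)
    refine ae_eventually_notMem (ne_top_of_le_ne_top ?_ (ENNReal.tsum_le_tsum hC))
    have hq : Real.exp (-(Real.log ρ / 2)) < 1 :=
      Real.exp_lt_one_iff.2 (by linarith [Real.log_pos hρ])
    exact ((summable_geometric_of_lt_one (Real.exp_pos _).le hq).mul_left C).tsum_ofReal_ne_top
  filter_upwards [ae_all_iff.2 hτ] with t ht
  obtain ⟨τ, hτt⟩ := exists_nat_ge |t|
  obtain ⟨N₀, hN₀⟩ := Filter.eventually_atTop.1 (ht τ)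
  refine Filter.eventually_atTop.2 ⟨N₀ + p.natDegree, fun n hn ω hlow hup => ?_⟩
  obtain ⟨N, rfl⟩ := Nat.exists_eq_add_of_le' (show p.natDegree ≤ n by omega)
  by_contra hlt
  exact hN₀ N (by omega) ⟨hτt, ω, hlow, hup, not_le.1 hlt⟩

end Line

/-! ### Cyclic vectors and eigenvectors -/

section Cyclic

open Polynomial

variable {m : ℕ} {K L : Type*} [Field K] [Field L]

/-- The Krylov matrix of `M` and `v`, with columns `v, M v, …, M ^ (m - 1) v`; it is invertible when
`v` is a cyclic vector of `M`. -/
def krylov (M : Matrix (Fin m) (Fin m) K) (v : Fin m → K) : Matrix (Fin m) (Fin m) K :=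
  Matrix.of fun i k => (M ^ (k : ℕ)).mulVec v i

theorem krylov_mulVec_coeff (M : Matrix (Fin m) (Fin m) K) (v : Fin m → K) {f : K[X]}
    (hf : f.natDegree < m) :
    (krylov M v).mulVec (fun k => f.coeff k) = (aeval M f).mulVec v := by
  rw [aeval_eq_sum_range' hf, ← Fin.sum_univ_eq_sum_range (fun k => f.coeff k • M ^ k),
    Matrix.sum_mulVec, Matrix.mulVec_eq_sum]
  simp only [op_smul_eq_smul, Matrix.smul_mulVec]
  rfl

theorem det_krylov_ne_zero {M : Matrix (Fin m) (Fin m) K} (hirr : Irreducible M.charpoly)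
    {v : Fin m → K} (hv : v ≠ 0) : (krylov M v).det ≠ 0 := by
  classical
  intro hdet
  obtain ⟨c, hc0, hc⟩ := Matrix.exists_mulVec_eq_zero_iff.2 hdet
  obtain ⟨i, -⟩ := Function.ne_iff.1 hv
  have hcoeff : (fun k : Fin m => (ofFn m c).coeff k) = c :=
    funext fun k => ofFn_coeff_eq_val_of_lt c k.isLt
  have hfv : (aeval M (ofFn m c)).mulVec v = 0 := by
    rw [← krylov_mulVec_coeff M v (ofFn_natDegree_lt i.pos c), hcoeff, hc]
  have hf0 : ofFn m c ≠ 0 := fun h0 => hc0 <| by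
    rw [← hcoeff, h0]
    rfl
  have hcop : IsCoprime M.charpoly (ofFn m c) := by
    refine hirr.coprime_iff_not_dvd.2 fun hdvd => (degree_le_of_dvd hdvd hf0).not_gt ?_
    rw [Matrix.charpoly_degree_eq_dim, Fintype.card_fin]
    exact ofFn_degree_lt c
  obtain ⟨a, b, hab⟩ := hcop
  have hone := congrArg (aeval M) hab
  rw [map_add, map_mul, map_mul, Matrix.aeval_self_charpoly, mul_zero, zero_add, map_one] at hone
  apply hv
  rw [← Matrix.one_mulVec v, ← hone, ← Matrix.mulVec_mulVec, hfv, Matrix.mulVec_zero]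

theorem krylov_map (φ : K →+* L) (M : Matrix (Fin m) (Fin m) K) (v : Fin m → K) :
    krylov (M.map φ) (φ ∘ v) = (krylov M v).map φ := by
  ext i k
  simp only [krylov, Matrix.of_apply, Matrix.map_apply]
  rw [RingHom.map_mulVec, Matrix.map_pow]

theorem aeval_mulVec_ne_zero_of_irreducible {M : Matrix (Fin m) (Fin m) K}
    (hirr : Irreducible M.charpoly) {v : Fin m → K} (hv : v ≠ 0) (φ : K →+* L) {f : L[X]}
    (hf0 : f ≠ 0) (hf : f.natDegree < m) :
    (aeval (M.map φ) f).mulVec (φ ∘ v) ≠ 0 := by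
  rw [← krylov_mulVec_coeff _ _ hf, krylov_map]
  intro h
  have hdet : ((krylov M v).map φ).det ≠ 0 := by
    rw [← RingHom.mapMatrix_apply, ← RingHom.map_det]
    exact (map_ne_zero φ).2 (det_krylov_ne_zero hirr hv)
  refine hdet (Matrix.exists_mulVec_eq_zero_iff.1 ⟨_, fun hc => hf0 ?_, h⟩)
  exact leadingCoeff_eq_zero.1 (congrFun hc ⟨f.natDegree, hf⟩)

theorem pow_mulVec_of_mulVec_eq_smul {M : Matrix (Fin m) (Fin m) K} {ξ : Fin m → K} {θ : K}
    (h : M.mulVec ξ = θ • ξ) (N : ℕ) : (M ^ N).mulVec ξ = θ ^ N • ξ := by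
  induction N with
  | zero => simp
  | succ N ih =>
    rw [pow_succ, ← Matrix.mulVec_mulVec, h, Matrix.mulVec_smul, ih, smul_smul, pow_succ']

theorem exists_eigenvector_of_isRoot {M : Matrix (Fin m) (Fin m) K}
    (hirr : Irreducible M.charpoly) {v : Fin m → K} (hv : v ≠ 0) (φ : K →+* L) {θ : L}
    (hθ : (M.map φ).charpoly.IsRoot θ) :
    ∃ (g : ℕ → L) (ξ : Fin m → L), ξ ≠ 0 ∧ (M.map φ).mulVec ξ = θ • ξ ∧
      ∀ N, ∑ i ∈ Finset.range m, g i • ((M.map φ) ^ (N + i)).mulVec (φ ∘ v) = θ ^ N • ξ := by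
  -- `G (M) v` is annihilated by `M - θ`, where `G = charpoly / (X - θ)`.
  obtain ⟨G, hG⟩ := dvd_iff_isRoot.2 hθ
  have hG0 : G ≠ 0 := by
    rintro rfl
    exact (Matrix.charpoly_monic _).ne_zero (hG.trans (mul_zero _))
  have hdeg : G.natDegree + 1 = m := by
    rw [← Fintype.card_fin m, ← Matrix.charpoly_natDegree_eq_dim (M.map φ), hG,
      natDegree_mul (X_sub_C_ne_zero θ) hG0, natDegree_X_sub_C, add_comm]
  have heig : (M.map φ).mulVec ((aeval (M.map φ) G).mulVec (φ ∘ v)) =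
      θ • (aeval (M.map φ) G).mulVec (φ ∘ v) := by
    have hCH := (M.map φ).aeval_self_charpoly
    rw [hG, map_mul, map_sub, aeval_X, aeval_C, sub_mul, sub_eq_zero] at hCH
    rw [Matrix.mulVec_mulVec, hCH, ← Algebra.smul_def, Matrix.smul_mulVec]
  refine ⟨G.coeff, _, aeval_mulVec_ne_zero_of_irreducible hirr hv φ hG0 (by omega), heig,
    fun N => ?_⟩
  rw [← pow_mulVec_of_mulVec_eq_smul heig, aeval_eq_sum_range, hdeg, Matrix.mulVec_mulVec,
    Finset.mul_sum, Matrix.sum_mulVec]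
  simp only [mul_smul_comm, ← pow_add, Matrix.smul_mulVec]

end Cyclic

section Orbit

open Polynomial

variable {m : ℕ}

/-- The heights `⟨s, M ^ k l⟩` along the orbit of `l` under the matrix `M`. If `M` is the
substitution matrix and `l` the population vector of a word `w`, this is the length of the tiles
over `ζ^k(w)` for the roof vector `s`. -/
def orbitDot (M : Matrix (Fin m) (Fin m) ℤ) (l : Fin m → ℤ) (s : Fin m → ℝ) (k : ℕ) : ℝ :=
  ∑ i, s i * ((M ^ k).mulVec l i : ℝ)

theorem orbitDot_add_smul (M : Matrix (Fin m) (Fin m) ℤ) (l : Fin m → ℤ) (s u : Fin m → ℝ) (t : ℝ)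
    (k : ℕ) : orbitDot M l (s + t • u) k = orbitDot M l s k + t * orbitDot M l u k := by
  simp only [orbitDot, Finset.mul_sum, ← Finset.sum_add_distrib, Pi.add_apply, Pi.smul_apply,
    smul_eq_mul]
  exact Finset.sum_congr rfl fun i _ => by ring

theorem recDefect_charpoly_orbitDot (M : Matrix (Fin m) (Fin m) ℤ) (l : Fin m → ℤ)
    (s : Fin m → ℝ) (k : ℕ) : recDefect M.charpoly (orbitDot M l s) k = 0 := by
  have hCH : ∀ a, ∑ i ∈ Finset.range (M.charpoly.natDegree + 1),
      M.charpoly.coeff i * (M ^ (k + i)).mulVec l a = 0 := by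
    intro a
    have h := congrArg (fun A => (M ^ k * A).mulVec l a) M.aeval_self_charpoly
    rw [aeval_eq_sum_range] at h
    simpa only [Finset.mul_sum, Matrix.mul_smul, ← pow_add, mul_zero, Matrix.zero_mulVec,
      Matrix.sum_mulVec, Matrix.smul_mulVec, Finset.sum_apply, Pi.smul_apply, Pi.zero_apply,
      smul_eq_mul] using h
  simp only [recDefect, orbitDot, Finset.mul_sum]
  rw [Finset.sum_comm]
  refine Finset.sum_eq_zero fun a _ => ?_
  rw [← mul_zero (s a), ← Int.cast_zero, ← hCH a, Int.cast_sum, Finset.mul_sum]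
  exact Finset.sum_congr rfl fun i _ => by push_cast; ring

theorem exists_eigenvector_orbitDot {M : Matrix (Fin m) (Fin m) ℤ}
    (hirr : Irreducible (M.map (Int.cast : ℤ → ℚ)).charpoly) {l : Fin m → ℤ} (hl : l ≠ 0) {θ : ℂ}
    (hθ : (M.map (Int.cast : ℤ → ℂ)).charpoly.IsRoot θ) :
    ∃ (g : ℕ → ℂ) (ξ : Fin m → ℂ), ξ ≠ 0 ∧ (M.map (Int.cast : ℤ → ℂ)).mulVec ξ = θ • ξ ∧
      ∀ (s : Fin m → ℝ) (N : ℕ),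
        ∑ i ∈ Finset.range M.charpoly.natDegree, g i * orbitDot M l s (N + i) =
          θ ^ N * Fintype.linearCombination ℝ ξ s := by
  have hmap : (M.map (Int.cast : ℤ → ℚ)).map (algebraMap ℚ ℂ) = M.map (Int.cast : ℤ → ℂ) := by
    ext i j
    simp
  have hlQ : (fun i => (l i : ℚ)) ≠ 0 := fun h => hl <| funext fun i =>
    Int.cast_eq_zero.1 (congrFun h i)
  rw [← hmap] at hθ
  obtain ⟨g, ξ, hξ0, hξ, hg⟩ := exists_eigenvector_of_isRoot hirr hlQ (algebraMap ℚ ℂ) hθ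
  rw [hmap] at hξ hg
  refine ⟨g, ξ, hξ0, hξ, fun s N => ?_⟩
  have horbit : ∀ k a, ((M.map (Int.cast : ℤ → ℂ)) ^ k).mulVec
      (algebraMap ℚ ℂ ∘ fun i => (l i : ℚ)) a = ((M ^ k).mulVec l a : ℂ) := by
    intro k a
    have hcast := RingHom.map_mulVec (Int.castRingHom ℂ) (M ^ k) l a
    rw [Matrix.map_pow] at hcast
    refine Eq.trans ?_ hcast.symm
    exact congrArg (((M.map (Int.cast : ℤ → ℂ)) ^ k).mulVec · a) (funext fun i => by simp)
  have hcoord : ∀ a, ∑ i ∈ Finset.range m, g i * ((M ^ (N + i)).mulVec l a : ℂ) = θ ^ N * ξ a := by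
    intro a
    simpa only [Finset.sum_apply, Pi.smul_apply, horbit, smul_eq_mul] using congrFun (hg N) a
  simp only [orbitDot, Complex.ofReal_sum, Complex.ofReal_mul, Complex.ofReal_intCast,
    Matrix.charpoly_natDegree_eq_dim, Fintype.card_fin, Finset.mul_sum,
    Fintype.linearCombination_apply, Complex.real_smul]
  rw [Finset.sum_comm]
  refine Finset.sum_congr rfl fun a _ => ?_
  rw [mul_left_comm, ← hcoord a, Finset.mul_sum]
  exact Finset.sum_congr rfl fun i _ => by ring

end Orbit

theorem exists_ne_of_lt_sort_getD_one {α : Type*} {s : Multiset α} (hs : s.Nodup)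
    {f : α → ℝ} {r : ℝ} (hr : 0 ≤ r) (h : r < ((s.map f).sort (· ≥ ·)).getD 1 0) :
    ∃ x ∈ s, ∃ y ∈ s, x ≠ y ∧ r < f x ∧ r < f y := by
  classical
  have hsort := (s.map f).pairwise_sort (· ≥ ·)
  have hcoe := (s.map f).sort_eq (· ≥ ·)
  generalize (s.map f).sort (· ≥ ·) = L at h hsort hcoe
  match L with
  | [] => exact absurd h hr.not_gt
  | [_] => exact absurd h hr.not_gt
  | a :: b :: L =>
    obtain ⟨x, hx, rfl, hrest⟩ := (Multiset.map_eq_cons f s (b :: L : List ℝ) a).2 hcoe.symm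
    obtain ⟨y, hy, rfl, -⟩ := (Multiset.map_eq_cons f _ (L : Multiset ℝ) b).2 hrest
    have hyx : f y ≤ f x := List.rel_of_pairwise_cons hsort List.mem_cons_self
    refine ⟨x, hx, y, Multiset.mem_of_mem_erase hy, ?_, lt_of_lt_of_le h hyx, h⟩
    rintro rfl
    exact hs.notMem_erase hy

/-! ### Almost every roof vector -/

theorem measurableSet_erdosKahane {E : Type*} [TopologicalSpace E] [MeasurableSpace E]
    [OpensMeasurableSpace E] {L : E → ℕ → ℝ} (hL : ∀ k, Continuous fun z => L z k) (ε η : ℝ) :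
    MeasurableSet {z | ErdosKahane (L z) ε η} := by
  have hset : {z | ErdosKahane (L z) ε η} = ⋃ N : ℕ, ⋂ n : ℕ, ⋂ (_ : N ≤ n), {z | ∀ ω : ℝ,
      Real.exp (-(ε * n)) ≤ |ω| → |ω| ≤ Real.exp (ε * n) →
      η * n ≤ ∑ k ∈ Finset.range n, ‖((ω * L z k : ℝ) : UnitAddCircle)‖ ^ 2} := by
    ext z
    simp [ErdosKahane, Filter.eventually_atTop]
  rw [hset]
  refine MeasurableSet.iUnion fun N => MeasurableSet.iInter fun n => MeasurableSet.iInter fun _ =>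
    IsClosed.measurableSet ?_
  simp only [Set.ofPred_forall]
  refine isClosed_iInter fun ω => isClosed_iInter fun _ => isClosed_iInter fun _ => ?_
  refine isClosed_le continuous_const (continuous_finsetSum _ fun k _ => ?_)
  exact ((AddCircle.continuous_mk' (1 : ℝ)).comp (continuous_const.mul (hL k))).norm.pow 2

section Hyperplane

variable {n : ℕ}

/-- The parametrization of the hyperplane `∑ s_a = 1` by all coordinates but the first. -/
def hyperplaneParam (z : Fin n → ℝ) : Fin (n + 1) → ℝ := Fin.cons (1 - ∑ i, z i) z

theorem sum_hyperplaneParam (z : Fin n → ℝ) : ∑ a, hyperplaneParam z a = 1 := by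
  simp [Fin.sum_univ_succ, hyperplaneParam]

theorem hyperplaneParam_tail {s : Fin (n + 1) → ℝ} (hs : ∑ a, s a = 1) :
    hyperplaneParam (Fin.tail s) = s := by
  rw [Fin.sum_univ_succ] at hs
  rw [hyperplaneParam, show 1 - ∑ i, Fin.tail s i = s 0 from (eq_sub_of_add_eq hs).symm,
    Fin.cons_self_tail]

theorem hyperplaneParam_add_smul (z : Fin n → ℝ) (t : ℝ) {u : Fin (n + 1) → ℝ}
    (hu : ∑ a, u a = 0) :
    hyperplaneParam (z + t • Fin.tail u) = hyperplaneParam z + t • u := by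
  have hsum : ∑ a, (hyperplaneParam z + t • u) a = 1 := by
    simp only [Pi.add_apply, Pi.smul_apply, smul_eq_mul, Finset.sum_add_distrib, ← Finset.mul_sum,
      hu, sum_hyperplaneParam, mul_zero, add_zero]
  exact hyperplaneParam_tail hsum

theorem lipschitzWith_hyperplaneParam :
    LipschitzWith (n + 1) (hyperplaneParam : (Fin n → ℝ) → Fin (n + 1) → ℝ) := by
  refine LipschitzWith.of_dist_le_mul fun z w => ?_
  have hcoord : ∀ i, dist (z i) (w i) ≤ dist z w := fun i => dist_le_pi_dist z w i
  push_cast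
  rw [dist_pi_le_iff (by positivity), Fin.forall_fin_succ]
  constructor
  · calc dist (1 - ∑ i, z i) (1 - ∑ i, w i) = dist (∑ i, z i) (∑ i, w i) := dist_sub_left _ _ _
      _ ≤ ∑ i, dist (z i) (w i) := dist_sum_sum_le _ _ _
      _ ≤ n * dist z w := by
        simpa using Finset.sum_le_card_nsmul Finset.univ _ _ fun i _ => hcoord i
      _ ≤ (n + 1) * dist z w := by gcongr; linarith
  · intro i
    exact (hcoord i).trans (le_mul_of_one_le_left dist_nonneg (by simp))

theorem continuous_hyperplaneParam_apply (a : Fin (n + 1)) :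
    Continuous fun z : Fin n → ℝ => hyperplaneParam z a :=
  (continuous_apply a).comp lipschitzWith_hyperplaneParam.continuous

theorem ae_roofSimplex_of_ae_hyperplaneParam {P : (Fin (n + 1) → ℝ) → Prop}
    (h : ∀ᵐ z : Fin n → ℝ, P (hyperplaneParam z)) :
    ∀ᵐ s ∂(Measure.hausdorffMeasure (((n + 1 : ℕ) : ℝ) - 1) : Measure (Fin (n + 1) → ℝ)),
      s ∈ roofSimplex (n + 1) → P s := by
  have hdim : ((n + 1 : ℕ) : ℝ) - 1 = n := by push_cast; ring
  have hnull : Measure.hausdorffMeasure (n : ℝ) {z : Fin n → ℝ | ¬ P (hyperplaneParam z)} = 0 := by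
    have hvol := hausdorffMeasure_pi_real (ι := Fin n)
    rw [Fintype.card_fin] at hvol
    rwa [hvol]
  rw [hdim, ae_iff]
  refine measure_mono_null (t := hyperplaneParam '' {z | ¬ P (hyperplaneParam z)}) ?_ ?_
  · intro s hs
    obtain ⟨hmem, hP⟩ := Classical.not_imp.1 hs
    refine ⟨Fin.tail s, ?_, hyperplaneParam_tail hmem.2⟩
    rwa [Set.mem_ofPred_eq, hyperplaneParam_tail hmem.2]
  · refine le_antisymm ((lipschitzWith_hyperplaneParam.hausdorffMeasure_image_le
      (Nat.cast_nonneg n) _).trans ?_) zero_le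
    rw [hnull, mul_zero]

theorem ae_of_forall_ae_line {G : Set (Fin n → ℝ)} (hG : MeasurableSet G) (u : Fin n → ℝ)
    (h : ∀ y : Fin n → ℝ, ∀ᵐ t : ℝ, y + t • u ∈ G) : ∀ᵐ y : Fin n → ℝ, y ∈ G :=
  ae_mem_of_ae_add_linearMap_mem (LinearMap.toSpanSingleton ℝ (Fin n → ℝ) u) volume volume hG
    fun y => by simpa using h y

theorem ae_linearCombination_hyperplaneParam_ne_zero {δ : Fin (n + 1) → ℂ} (hδ : δ ≠ 0) :
    ∀ᵐ z : Fin n → ℝ, Fintype.linearCombination ℝ δ (hyperplaneParam z) ≠ 0 := by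
  set F := Fintype.linearCombination ℝ δ with hF
  by_cases hconst : ∀ a b, δ a = δ b
  · refine Filter.Eventually.of_forall fun z => ?_
    obtain ⟨a, ha⟩ := Function.ne_iff.1 hδ
    simp only [hF, Fintype.linearCombination_apply, fun b => hconst b a, ← Finset.sum_smul,
      sum_hyperplaneParam, one_smul]
    exact ha
  push Not at hconst
  obtain ⟨a, b, hab⟩ := hconst
  set u : Fin (n + 1) → ℝ := Pi.single a 1 - Pi.single b 1 with hu
  have hu0 : ∑ i, u i = 0 := by simp [hu]
  have hFu : F u ≠ 0 := by
    simpa [hF, hu, Fintype.linearCombination_apply_single] using sub_ne_zero.2 hab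
  have hopen : IsOpen {z : Fin n → ℝ | F (hyperplaneParam z) ≠ 0} :=
    isOpen_ne_fun (F.continuous_of_finiteDimensional.comp
      lipschitzWith_hyperplaneParam.continuous) continuous_const
  refine ae_of_forall_ae_line hopen.measurableSet (Fin.tail u) fun y => ?_
  refine Set.Subsingleton.measure_zero
    (s := {t : ℝ | ¬ F (hyperplaneParam (y + t • Fin.tail u)) ≠ 0})
    (fun t ht t' ht' => ?_) volume
  simp only [Set.mem_ofPred_eq, not_not, hyperplaneParam_add_smul y _ hu0, map_add,
    map_smul] at ht ht'
  exact smul_left_injective ℝ hFu (add_left_cancel (ht.trans ht'.symm))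

end Hyperplane

theorem linearCombination_smul_sub_smul {ι : Type*} [Fintype ι] (ξ : Fin 2 → ι → ℂ) (c d : ℂ)
    (s : ι → ℝ) :
    Fintype.linearCombination ℝ (c • ξ 0 - d • ξ 1) s =
      Fintype.linearCombination ℝ (ξ 0) s * c - Fintype.linearCombination ℝ (ξ 1) s * d := by
  simp only [Fintype.linearCombination_apply, Pi.sub_apply, Pi.smul_apply, smul_eq_mul, smul_sub,
    Finset.sum_sub_distrib, Finset.sum_mul, smul_mul_assoc, mul_comm c, mul_comm d]

theorem exists_sum_eq_zero_smul_sub_smul_ne_zero {ι : Type*} [Fintype ι] {ξ : Fin 2 → ι → ℂ}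
    (hξ : LinearIndependent ℂ ξ) :
    ∃ u : ι → ℝ, ∑ i, u i = 0 ∧ Fintype.linearCombination ℝ (ξ 1) u • ξ 0 -
      Fintype.linearCombination ℝ (ξ 0) u • ξ 1 ≠ 0 := by
  classical
  have hind : ∀ c d : ℂ, c • ξ 0 - d • ξ 1 = 0 → c = 0 ∧ d = 0 := by
    intro c d h
    have hcoeff := Fintype.linearIndependent_iff.1 hξ ![c, -d] (by simpa [sub_eq_add_neg] using h)
    exact ⟨hcoeff 0, neg_eq_zero.1 (hcoeff 1)⟩
  by_contra! hcon
  have hconst : ∀ a b, ξ 0 a = ξ 0 b ∧ ξ 1 a = ξ 1 b := by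
    intro a b
    have h := hind _ _ (hcon (Pi.single a 1 - Pi.single b 1) (by simp))
    simpa [Fintype.linearCombination_apply_single, sub_eq_zero, and_comm] using h
  obtain ⟨a, ha⟩ := Function.ne_iff.1 (hξ.ne_zero 0)
  refine ha (hind (ξ 1 a) (ξ 0 a) (funext fun b => ?_)).2
  simp only [Pi.sub_apply, Pi.smul_apply, smul_eq_mul, Pi.zero_apply, (hconst b a).1,
    (hconst b a).2]
  ring

section ExpandingEigenvalues

variable {m : ℕ} {M : Matrix (Fin m) (Fin m) ℤ} {l : Fin m → ℤ} {θ : Fin 2 → ℂ}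

theorem exists_direction_ae_erdosKahane
    (hirr : Irreducible (M.map (Int.cast : ℤ → ℚ)).charpoly) (hl : l ≠ 0)
    (hinj : Function.Injective θ) (hroot : ∀ j, (M.map (Int.cast : ℤ → ℂ)).charpoly.IsRoot (θ j))
    (hnorm : ∀ j, 1 < ‖θ j‖) :
    ∃ ε > 0, ∃ η > 0, ∃ (u : Fin m → ℝ) (δ : Fin m → ℂ), ∑ a, u a = 0 ∧ δ ≠ 0 ∧
      Fintype.linearCombination ℝ δ u = 0 ∧ ∀ s, Fintype.linearCombination ℝ δ s ≠ 0 →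
        ∀ᵐ t : ℝ, ErdosKahane (orbitDot M l (s + t • u)) ε η := by
  choose g ξ hξ0 heig hg using fun j => exists_eigenvector_orbitDot hirr hl (hroot j)
  have hξ : LinearIndependent ℂ ξ :=
    Module.End.eigenvectors_linearIndependent' (Matrix.mulVecLin (M.map (Int.cast : ℤ → ℂ))) θ
      hinj ξ fun j => Module.End.hasEigenvector_iff.2
        ⟨Module.End.mem_eigenspace_iff.2 (heig j), hξ0 j⟩
  obtain ⟨u, hu0, hδ⟩ := exists_sum_eq_zero_smul_sub_smul_ne_zero hξ
  have hρ : 1 < min ‖θ 0‖ ‖θ 1‖ := lt_min (hnorm 0) (hnorm 1)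
  obtain ⟨ε, hε, η, hη, hline⟩ := exists_ae_erdosKahane_expandingLine M.charpoly_monic hρ
  refine ⟨ε, hε, η, hη, u, _, hu0, hδ, ?_, fun s hs => ?_⟩
  · rw [linearCombination_smul_sub_smul]
    ring
  let ℓ : ExpandingLine M.charpoly (min ‖θ 0‖ ‖θ 1‖) :=
    { A := orbitDot M l s
      B := orbitDot M l u
      θ := θ
      g := g
      α := fun j => Fintype.linearCombination ℝ (ξ j) s
      β := fun j => Fintype.linearCombination ℝ (ξ j) u
      recDefect_A := recDefect_charpoly_orbitDot M l s
      recDefect_B := recDefect_charpoly_orbitDot M l u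
      le_norm := Fin.forall_fin_two.2 ⟨min_le_left _ _, min_le_right _ _⟩
      sum_A := fun j => hg j s
      sum_B := fun j => hg j u
      det_ne_zero := by rwa [linearCombination_smul_sub_smul] at hs }
  filter_upwards [hline ℓ] with t ht
  rwa [show orbitDot M l (s + t • u) = fun k => ℓ.A k + t * ℓ.B k from
    funext fun k => orbitDot_add_smul M l s u t k]

theorem ae_roofSimplex_erdosKahane
    (hirr : Irreducible (M.map (Int.cast : ℤ → ℚ)).charpoly) (hl : l ≠ 0)
    (hinj : Function.Injective θ) (hroot : ∀ j, (M.map (Int.cast : ℤ → ℂ)).charpoly.IsRoot (θ j))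
    (hnorm : ∀ j, 1 < ‖θ j‖) :
    ∃ ε > 0, ∃ η > 0,
      ∀ᵐ s ∂(Measure.hausdorffMeasure ((m : ℝ) - 1) : Measure (Fin m → ℝ)),
        s ∈ roofSimplex m → ErdosKahane (orbitDot M l s) ε η := by
  obtain ⟨ε, hε, η, hη, u, δ, hu0, hδ, hδu, hline⟩ :=
    exists_direction_ae_erdosKahane hirr hl hinj hroot hnorm
  refine ⟨ε, hε, η, hη, ?_⟩
  obtain ⟨i, -⟩ := Function.ne_iff.1 hl
  obtain ⟨n, rfl⟩ := Nat.exists_eq_succ_of_ne_zero i.pos.ne'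
  set F := Fintype.linearCombination ℝ δ
  have hae : ∀ᵐ z : Fin n → ℝ, z ∈ {z | ErdosKahane (orbitDot M l (hyperplaneParam z)) ε η} ∪
      {z | F (hyperplaneParam z) = 0} := by
    refine ae_of_forall_ae_line (.union (measurableSet_erdosKahane (fun k => ?_) _ _)
      (isClosed_eq ?_ continuous_const).measurableSet) (Fin.tail u) fun y => ?_
    · exact continuous_finsetSum _ fun a _ =>
        (continuous_hyperplaneParam_apply a).mul continuous_const
    · exact F.continuous_of_finiteDimensional.comp lipschitzWith_hyperplaneParam.continuous
    simp only [Set.mem_union, Set.mem_ofPred_eq, hyperplaneParam_add_smul y _ hu0, map_add,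
      map_smul, hδu, smul_zero, add_zero]
    by_cases hy : F (hyperplaneParam y) = 0
    · exact Filter.Eventually.of_forall fun t => Or.inr hy
    · exact (hline _ hy).mono fun t => Or.inl
  refine ae_roofSimplex_of_ae_hyperplaneParam ?_
  filter_upwards [hae, ae_linearCombination_hyperplaneParam_ne_zero hδ] with z hz hne
  exact hz.resolve_right hne

end ExpandingEigenvalues

theorem Substitution.exists_expanding_eigenvalues {m : ℕ} {ζ : Substitution m}
    (hirr : Irreducible (ζ.matrix.map (Int.cast : ℤ → ℚ)).charpoly) (hθ : 1 < ζ.absTheta₂) :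
    ∃ θ : Fin 2 → ℂ, Function.Injective θ ∧
      (∀ j, (ζ.matrix.map (Int.cast : ℤ → ℂ)).charpoly.IsRoot (θ j)) ∧ ∀ j, 1 < ‖θ j‖ := by
  have hmap : (ζ.matrix.map (Int.cast : ℤ → ℂ)).charpoly =
      (ζ.matrix.map (Int.cast : ℤ → ℚ)).charpoly.map (algebraMap ℚ ℂ) := by
    rw [← Matrix.charpoly_map]
    congr 1
  have hnodup : (ζ.matrix.map (Int.cast : ℤ → ℂ)).charpoly.roots.Nodup := by
    rw [hmap]
    exact Polynomial.nodup_roots hirr.separable.map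
  obtain ⟨z, hz, w, hw, hne, hzn, hwn⟩ := exists_ne_of_lt_sort_getD_one hnodup zero_le_one hθ
  exact ⟨![z, w], by simpa [Fin.forall_fin_two, Function.Injective] using ⟨hne, hne.symm⟩,
    Fin.forall_fin_two.2 ⟨Polynomial.isRoot_of_mem_roots hz, Polynomial.isRoot_of_mem_roots hw⟩,
    Fin.forall_fin_two.2 ⟨hzn, hwn⟩⟩

/-! ### Frequency zero and functions of mean zero -/

theorem twistedSum_zero {α : Type*} (s : α → ℝ) (c : α → ℂ) (w : List α) :
    twistedSum s 0 c w = (w.map c).sum := by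
  induction w with
  | nil => rfl
  | cons a w ih => simp [twistedSum, ih]

theorem twistedSum_zero_sub_const {α : Type*} (s : α → ℝ) (c : α → ℂ) (z : ℂ) (w : List α) :
    twistedSum s 0 (fun a => c a - z) w = twistedSum s 0 c w - z * w.length := by
  simp only [twistedSum_zero]
  induction w with
  | nil => simp
  | cons a w ih =>
    simp only [List.map_cons, List.sum_cons, List.length_cons, ih]
    push_cast
    ring

/-- With `y` the average of `c` over `x`, subtracting `δ y` annihilates the fraction `δ` of the
word `u ++ (x ++ v)` that is filled by `x`. -/
theorem norm_twistedSum_zero_sub_average_le {α : Type*} (s : α → ℝ) {c : α → ℂ} {ρ δ : ℝ}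
    {u x v : List α} (hx0 : x ≠ []) (hu : ‖twistedSum s 0 c u‖ ≤ ρ * u.length)
    (hx : ‖twistedSum s 0 c x‖ ≤ ρ * x.length) (hv : ‖twistedSum s 0 c v‖ ≤ ρ * v.length)
    (hδ : δ * (u ++ (x ++ v)).length ≤ x.length) :
    ‖twistedSum s 0 (fun a => c a - δ * (twistedSum s 0 c x / x.length)) (u ++ (x ++ v))‖ ≤
      (1 - δ) * ρ * (u ++ (x ++ v)).length := by
  set y : ℂ := twistedSum s 0 c x / x.length with hy
  have hxy : twistedSum s 0 c x = y * x.length :=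
    (div_mul_cancel₀ _ (by simpa using hx0)).symm
  have hyρ : ‖y‖ ≤ ρ := by
    rwa [hy, norm_div, Complex.norm_natCast,
      div_le_iff₀ (Nat.cast_pos.2 (List.length_pos_of_ne_nil hx0))]
  set N : ℕ := (u ++ (x ++ v)).length with hN
  have hN_eq : (N : ℝ) = u.length + x.length + v.length := by
    simp only [hN, List.length_append]
    push_cast
    ring
  have hsum : twistedSum s 0 (fun a => c a - δ * y) (u ++ (x ++ v)) = twistedSum s 0 c u +
      twistedSum s 0 c v + ((x.length - δ * N : ℝ) : ℂ) * y := by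
    rw [twistedSum_zero_sub_const, ← hN]
    simp only [twistedSum_zero, List.map_append, List.sum_append] at hxy ⊢
    rw [hxy]
    push_cast
    ring
  have haverage : ‖((x.length - δ * N : ℝ) : ℂ) * y‖ ≤ (x.length - δ * N) * ρ := by
    rw [norm_mul, Complex.norm_real, Real.norm_of_nonneg (sub_nonneg.2 hδ)]
    exact mul_le_mul_of_nonneg_left hyρ (sub_nonneg.2 hδ)
  calc _ ≤ ρ * u.length + ρ * v.length + (x.length - δ * N) * ρ :=
        hsum ▸ norm_add₃_le.trans (add_le_add_three hu hv haverage)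
    _ = (1 - δ) * ρ * N := by linear_combination (-ρ) * hN_eq

namespace Substitution

section MeanZero

variable {m : ℕ} {ζ : Substitution m} {s : Fin m → ℝ}

theorem BlockBound.exists_sub_const_add {c : Fin m → ℂ} {z : ℂ} {k : ℕ} {r : ℝ}
    (h : ζ.BlockBound s 0 (fun a => c a - z) k r) {p : ℕ} (hp : ∀ a b, a ∈ ζ.onWord^[p] [b]) :
    ∃ z', ζ.BlockBound s 0 (fun a => c a - z') (k + p)
      ((1 - 1 / (ζ.maxLength : ℝ) ^ (p + p)) * r) := by
  rcases isEmpty_or_nonempty (Fin m) with _ | ⟨⟨d⟩⟩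
  · exact ⟨0, isEmptyElim⟩
  have hA : (0 : ℝ) < ζ.maxLength := zero_lt_one.trans_le ζ.one_le_maxLength
  refine ⟨z + (1 / (ζ.maxLength : ℝ) ^ (p + p) : ℝ) * (twistedSum s 0 (fun a => c a - z)
    (ζ.onWord^[k] [d]) / (ζ.onWord^[k] [d]).length), fun b => ?_⟩
  obtain ⟨P, R, hPR⟩ := List.append_of_mem (hp d b)
  have hsplit : ζ.onWord^[k + p] [b] = ζ.onWord^[k] P ++ (ζ.onWord^[k] [d] ++ ζ.onWord^[k] R) := by
    rw [Function.iterate_add_apply, hPR, ← onWord_iterate_append, ← onWord_iterate_append,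
      List.singleton_append]
  have hcomp : 1 / (ζ.maxLength : ℝ) ^ (p + p) * (ζ.onWord^[k + p] [b]).length ≤
      (ζ.onWord^[k] [d]).length := by
    rw [one_div_mul_eq_div, div_le_iff₀ (by positivity), mul_comm]
    exact_mod_cast length_onWord_iterate_add_le_mul hp k p b d
  rw [hsplit] at hcomp ⊢
  simpa only [sub_sub] using
    norm_twistedSum_zero_sub_average_le s (ζ.onWord_iterate_ne_nil k (List.cons_ne_nil d []))
      (h.norm_le P) (h.norm_le [d]) (h.norm_le R) hcomp

theorem exists_blockBound_sub_const {c : Fin m → ℂ} {B : ℝ} (hB : ∀ a, ‖c a‖ ≤ B)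
    {p : ℕ} (hp : ∀ a b, a ∈ ζ.onWord^[p] [b]) (j : ℕ) :
    ∃ z, ζ.BlockBound s 0 (fun a => c a - z) (p * j)
      ((1 - 1 / (ζ.maxLength : ℝ) ^ (p + p)) ^ j * B) := by
  induction j with
  | zero => exact ⟨0, fun b => by simpa using norm_twistedSum_le s 0 hB [b]⟩
  | succ j ih =>
    obtain ⟨z, hz⟩ := ih
    obtain ⟨z', hz'⟩ := hz.exists_sub_const_add hp
    refine ⟨z', ?_⟩
    rwa [mul_add_one, pow_succ', mul_assoc]

theorem length_block (x : ℤ → Fin m) (i : ℤ) (N : ℕ) : (block x i N).length = N := by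
  simp [block]

theorem exists_block_isInfix (x : ζ.Space) (N : ℕ) :
    ∃ K a, block x.1 0 N <:+: ζ.onWord^[K] [a] := by
  obtain ⟨K, a, h⟩ := x.2 N
  exact ⟨K, a,
    (block_infix x.1 0 (-(N : ℤ)) N (2 * N + 1) (by omega) (by push_cast; omega)).trans h⟩

theorem measurable_letter (i : ℤ) : Measurable fun x : ζ.Space => x.1 i :=
  (measurable_pi_apply i).comp measurable_subtype_coe

theorem integrable_letter (μ : Measure ζ.Space) [IsFiniteMeasure μ] (c : Fin m → ℂ) (i : ℤ) :
    Integrable (fun x : ζ.Space => c (x.1 i)) μ :=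
  (Integrable.of_finite (μ := μ.map fun x : ζ.Space => x.1 i) (f := c)).comp_measurable
    (measurable_letter i)

variable {μ : Measure ζ.Space}

theorem integral_letter_eq (hμ : MeasurePreserving (ζ.shift 1) μ μ) (c : Fin m → ℂ) (k : ℕ) :
    ∫ x : ζ.Space, c (x.1 k) ∂μ = ∫ x : ζ.Space, c (x.1 0) ∂μ := by
  induction k with
  | zero => rfl
  | succ k ih =>
    have hmeas : Measurable fun x : ζ.Space => c (x.1 k) :=
      (measurable_of_finite c).comp (measurable_letter _)
    have hmap := integral_map (μ := μ) (f := fun x : ζ.Space => c (x.1 k))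
      hμ.measurable.aemeasurable
      hmeas.aestronglyMeasurable
    rw [hμ.map_eq] at hmap
    rw [← ih, hmap]
    rfl

theorem integral_twistedSum_zero_block [IsFiniteMeasure μ]
    (hμ : MeasurePreserving (ζ.shift 1) μ μ) (s : Fin m → ℝ) (c : Fin m → ℂ) (N : ℕ) :
    ∫ x : ζ.Space, twistedSum s 0 c (block x.1 0 N) ∂μ = N * ∫ x : ζ.Space, c (x.1 0) ∂μ := by
  have hsum : ∀ x : ζ.Space,
      twistedSum s 0 c (block x.1 0 N) = ∑ k ∈ Finset.range N, c (x.1 k) := by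
    intro x
    rw [twistedSum_zero, block, List.map_map, ← List.sum_toFinset _ List.nodup_range,
      List.toFinset_range]
    simp
  simp only [hsum, integral_finsetSum _ fun _ _ => integrable_letter μ c _,
    integral_letter_eq hμ c, Finset.sum_const, Finset.card_range, nsmul_eq_mul]

theorem BlockBound.norm_integral_letter_le [IsProbabilityMeasure μ]
    (hμ : MeasurePreserving (ζ.shift 1) μ μ) {c : Fin m → ℂ} {n : ℕ} {r : ℝ} (hr : 0 ≤ r)
    (h : ζ.BlockBound s 0 c n r) : ‖∫ x : ζ.Space, c (x.1 0) ∂μ‖ ≤ r := by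
  set B : ℝ := ∑ a, ‖c a‖
  have hcB : ∀ a, ‖c a‖ ≤ B := fun a =>
    Finset.single_le_sum (f := fun a => ‖c a‖) (fun _ _ => norm_nonneg _) (Finset.mem_univ a)
  have hlinear : ∀ N : ℕ,
      N * ‖∫ x : ζ.Space, c (x.1 0) ∂μ‖ ≤ r * N + 2 * B * ζ.maxLength ^ n := by
    intro N
    rw [← Complex.norm_natCast, ← norm_mul, ← integral_twistedSum_zero_block hμ s]
    refine (norm_integral_le_of_norm_le_const (C := r * N + 2 * B * ζ.maxLength ^ n)
      (.of_forall fun x => ?_)).trans_eq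
      (by rw [probReal_univ, mul_one, Complex.norm_natCast])
    obtain ⟨K, a, hK⟩ := exists_block_isInfix x N
    simpa only [length_block] using
      h.norm_le_of_isInfix hr (Finset.sum_nonneg fun _ _ => norm_nonneg _) hcB hK
  by_contra! hlt
  obtain ⟨N, hN⟩ := exists_nat_gt
    (2 * B * ζ.maxLength ^ n / (‖∫ x : ζ.Space, c (x.1 0) ∂μ‖ - r))
  rw [div_lt_iff₀ (sub_pos.2 hlt)] at hN
  linarith [hlinear N]

theorem blockBound_of_integral_eq_zero [IsProbabilityMeasure μ]
    (hμ : MeasurePreserving (ζ.shift 1) μ μ) {c : Fin m → ℂ} {B : ℝ} (hB0 : 0 ≤ B)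
    (hB : ∀ a, ‖c a‖ ≤ B) (hc : ∫ x : ζ.Space, c (x.1 0) ∂μ = 0)
    {p : ℕ} (hp : ∀ a b, a ∈ ζ.onWord^[p] [b]) (j : ℕ) :
    ζ.BlockBound s 0 c (p * j) (2 * B * (1 - 1 / (ζ.maxLength : ℝ) ^ (p + p)) ^ j) := by
  obtain ⟨z, hz⟩ := exists_blockBound_sub_const (s := s) hB hp j
  set r : ℝ := (1 - 1 / (ζ.maxLength : ℝ) ^ (p + p)) ^ j * B with hr
  have hδ : 0 ≤ 1 - 1 / (ζ.maxLength : ℝ) ^ (p + p) :=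
    sub_nonneg.2 (div_le_one_of_le₀ (one_le_pow₀ ζ.one_le_maxLength) (by positivity))
  have hzr : ‖z‖ ≤ r := by
    have hle := hz.norm_integral_letter_le hμ (by positivity)
    rwa [integral_sub (integrable_letter μ c 0) (integrable_const z), hc, zero_sub, norm_neg,
      integral_const, probReal_univ, one_smul] at hle
  intro b
  set w := ζ.onWord^[p * j] [b]
  calc ‖twistedSum s 0 c w‖ = ‖twistedSum s 0 (fun a => c a - z) w + z * w.length‖ := by
        rw [twistedSum_zero_sub_const, sub_add_cancel]
    _ ≤ r * w.length + r * w.length := by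
        refine norm_add_le_of_le (hz b) ?_
        rw [norm_mul, Complex.norm_natCast]
        gcongr
    _ = _ := by rw [hr]; ring

end MeanZero

end Substitution

/-! ### Exponential decay at all frequencies -/

/-- The decay and continuity in the frequency `ω` that Fourier transforms `c ω a` of Lipschitz
profiles over tiles `a` of length at most one enjoy, with a common constant `Λ`. -/
structure LipschitzTransformBound {α : Type*} (c : ℝ → α → ℂ) (Λ : ℝ) : Prop where
  nonneg : 0 ≤ Λ
  norm_le : ∀ ω a, ‖c ω a‖ ≤ Λ
  norm_mul_abs_le : ∀ ω a, ‖c ω a‖ * |ω| ≤ 4 * Λ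
  norm_sub_le : ∀ ω a, ‖c ω a - c 0 a‖ ≤ 2 * Real.pi * |ω| * Λ

theorem exists_mul_le_and_pow_le_exp {p : ℕ} (hp : 0 < p) {A δ ε : ℝ} (hA : 1 < A) (hδ0 : 0 < δ)
    (hδ1 : δ ≤ 1) (hε : 0 < ε) :
    ∃ κ > 0, ∀ n : ℕ, ∃ j : ℕ, p * j ≤ n ∧ A ^ (p * j) ≤ Real.exp (ε * n) ∧
      (1 - δ) ^ j ≤ Real.exp 1 * Real.exp (-(κ * n)) := by
  have hp1 : (0 : ℝ) < p := Nat.cast_pos.2 hp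
  have hlogA : 0 < Real.log A := Real.log_pos hA
  set σ : ℝ := min (1 / p) (ε / (p * Real.log A))
  have : 0 < σ := lt_min (by positivity) (by positivity)
  have hσp : σ * p ≤ 1 := (le_div_iff₀ hp1).1 (min_le_left _ _)
  have hσA : σ * (p * Real.log A) ≤ ε := (le_div_iff₀ (by positivity)).1 (min_le_right _ _)
  refine ⟨δ * σ, by positivity, fun n => ⟨⌊σ * n⌋₊, ?_, ?_, ?_⟩⟩
  all_goals
    have hj_le : (⌊σ * n⌋₊ : ℝ) ≤ σ * n := Nat.floor_le (by positivity)
    have hj_ge : σ * n - 1 ≤ ⌊σ * n⌋₊ := (Nat.sub_one_lt_floor _).le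
  · have : (p : ℝ) * ⌊σ * n⌋₊ ≤ n := by
      calc (p : ℝ) * ⌊σ * n⌋₊ ≤ p * (σ * n) := by gcongr
        _ = σ * p * n := by ring
        _ ≤ n := mul_le_of_le_one_left (Nat.cast_nonneg n) hσp
    exact_mod_cast this
  · rw [← Real.exp_log (by positivity : 0 < A ^ (p * ⌊σ * n⌋₊)), Real.log_pow, Real.exp_le_exp]
    push_cast
    calc (p : ℝ) * ⌊σ * n⌋₊ * Real.log A ≤ p * (σ * n) * Real.log A := by gcongr
      _ = σ * (p * Real.log A) * n := by ring
      _ ≤ ε * n := by gcongr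
  · refine (pow_le_pow_left₀ (sub_nonneg.2 hδ1) (Real.one_sub_le_exp_neg δ) _).trans ?_
    rw [← Real.exp_nat_mul, ← Real.exp_add, Real.exp_le_exp]
    nlinarith

namespace Substitution

section Decay

variable {m : ℕ} {ζ : Substitution m} {s : Fin m → ℝ}

theorem BlockBound.of_zero {d : Fin m → ℂ} {n : ℕ} {ρ : ℝ} (h : ζ.BlockBound s 0 d n ρ)
    (hs : ∀ a, |s a| ≤ 1) {ω : ℝ} {c : Fin m → ℂ} {B κ : ℝ} (hB0 : 0 ≤ B) (hB : ∀ a, ‖c a‖ ≤ B)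
    (hκ : ∀ a, ‖c a - d a‖ ≤ κ) :
    ζ.BlockBound s ω c n (ρ + κ + 2 * Real.pi * |ω| * B * ζ.maxLength ^ n) := by
  intro b
  set w := ζ.onWord^[n] [b]
  have hlen : (w.length : ℝ) ≤ ζ.maxLength ^ n := by
    exact_mod_cast ζ.length_onWord_iterate_singleton_le n b
  have hsub := norm_twistedSum_sub_le hs (ω := ω) hB0 hB hκ w
  have hlen_mul : w.length * (2 * Real.pi * |ω| * B * w.length) ≤
      w.length * (2 * Real.pi * |ω| * B * (ζ.maxLength : ℝ) ^ n) := by gcongr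
  linarith [norm_le_norm_add_norm_sub' (twistedSum s ω c w) (twistedSum s 0 d w), h b]

theorem blockBound_of_exp_le_abs {c : ℝ → Fin m → ℂ} {Λ : ℝ} (hc : LipschitzTransformBound c Λ)
    {x ω : ℝ} (hω : Real.exp x ≤ |ω|) : ζ.BlockBound s ω (c ω) 0 (4 * Λ * Real.exp (-x)) := by
  refine fun b => norm_twistedSum_le s ω (fun a => ?_) _
  rw [Real.exp_neg, ← div_eq_mul_inv, le_div_iff₀ (Real.exp_pos x)]
  exact (mul_le_mul_of_nonneg_left hω (norm_nonneg _)).trans (hc.norm_mul_abs_le ω a)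

theorem exists_blockBound_of_abs_le_exp_neg (ζ : Substitution m) {p : ℕ} (hp : 0 < p) {δ ε : ℝ}
    (hδ0 : 0 < δ) (hδ1 : δ ≤ 1) (hε : 0 < ε) :
    ∃ κ > 0, ∀ {s : Fin m → ℝ}, (∀ a, |s a| ≤ 1) →
      ∀ {c : ℝ → Fin m → ℂ} {Λ : ℝ}, LipschitzTransformBound c Λ →
      (∀ j, ζ.BlockBound s 0 (c 0) (p * j) (2 * Λ * (1 - δ) ^ j)) →
      ∀ (n : ℕ) {ω : ℝ}, |ω| ≤ Real.exp (-(ε * n)) → ∃ k ≤ n,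
        ζ.BlockBound s ω (c ω) k ((2 * Real.exp 1 + 4 * Real.pi) * Λ * Real.exp (-(κ * n))) := by
  obtain ⟨κ, hκ0, hκ⟩ := exists_mul_le_and_pow_le_exp hp (A := ζ.maxLength)
    (Nat.one_lt_cast.2 ζ.two_le_maxLength) hδ0 hδ1 (half_pos hε)
  refine ⟨min κ (ε / 2), by positivity, fun {s} hs {c Λ} hc hmean n ω hω => ?_⟩
  obtain ⟨j, hj, hApj, hδj⟩ := hκ n
  refine ⟨p * j, hj, ((hmean j).of_zero hs hc.nonneg (hc.norm_le ω) (hc.norm_sub_le ω)).mono ?_⟩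
  set E := Real.exp (-(min κ (ε / 2) * n)) with hE
  have hΛ := hc.nonneg
  have hκE : Real.exp (-(κ * n)) ≤ E := by
    rw [hE]; gcongr; exact min_le_left _ _
  have hεE : Real.exp (-(ε / 2 * n)) ≤ E := by
    rw [hE]; gcongr; exact min_le_right _ _
  have hωA : |ω| * ζ.maxLength ^ (p * j) ≤ E := by
    calc |ω| * (ζ.maxLength : ℝ) ^ (p * j) ≤ Real.exp (-(ε * n)) * Real.exp (ε / 2 * n) := by
          gcongr
      _ = Real.exp (-(ε / 2 * n)) := by rw [← Real.exp_add]; congr 1; ring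
      _ ≤ E := hεE
  have hωE : |ω| ≤ E :=
    (le_mul_of_one_le_right (abs_nonneg ω) (one_le_pow₀ ζ.one_le_maxLength)).trans hωA
  calc 2 * Λ * (1 - δ) ^ j + 2 * Real.pi * |ω| * Λ +
        2 * Real.pi * |ω| * Λ * ζ.maxLength ^ (p * j)
      = 2 * Λ * (1 - δ) ^ j + 2 * Real.pi * Λ * (|ω| + |ω| * ζ.maxLength ^ (p * j)) := by ring
    _ ≤ 2 * Λ * (Real.exp 1 * E) + 2 * Real.pi * Λ * (E + E) := by
        gcongr
        exact hδj.trans (by gcongr)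
    _ = (2 * Real.exp 1 + 4 * Real.pi) * Λ * E := by ring

theorem blockBound_of_le_sum_norm_sq {ω : ℝ} {c : Fin m → ℂ} {Λ : ℝ} (hΛ : 0 ≤ Λ)
    (hc : ∀ a, ‖c a‖ ≤ Λ) {p q : ℕ} (hq : 0 < q) (hp : ∀ a b, a ∈ ζ.onWord^[p] [b]) {d : Fin m}
    {v : List (Fin m)} (hv : ∀ b, d :: v ++ [d] <:+: ζ.onWord^[q] [b]) {n : ℕ} {x : ℝ}
    (hx : x ≤ ∑ k ∈ Finset.range n,
      ‖((ω * wordLength s (ζ.onWord^[k] (d :: v)) : ℝ) : UnitAddCircle)‖ ^ 2) :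
    ζ.BlockBound s ω c (n + q) (Λ * Real.exp (-(4 / (ζ.maxLength : ℝ) ^ (p + q) / q * x))) := by
  have h0 : ζ.BlockBound s ω c 0 Λ := fun b => norm_twistedSum_le s ω hc _
  refine (h0.mul_exp_sum hΛ hq (fun n ρ hρ h => h.mul_exp_of_return_word hρ hp hv) n).mono ?_
  rw [← Finset.mul_sum, mul_div_right_comm]
  gcongr

/-- Frequencies of modulus between `exp (-ε n)` and `exp (ε n)` are controlled by the
Erdős–Kahane property, larger ones by the decay of the transforms and smaller ones by the
vanishing mean. -/
theorem exists_blockBound_exp {p q : ℕ} (hp0 : 0 < p) (hq0 : 0 < q)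
    (hp : ∀ a b, a ∈ ζ.onWord^[p] [b]) {d : Fin m} {v : List (Fin m)}
    (hv : ∀ b, d :: v ++ [d] <:+: ζ.onWord^[q] [b]) {ε η : ℝ} (hε : 0 < ε) (hη : 0 < η) :
    ∃ κ > 0, ∀ s : Fin m → ℝ, (∀ a, |s a| ≤ 1) →
      ErdosKahane (fun k => wordLength s (ζ.onWord^[k] (d :: v))) ε η →
      ∃ C > 0, ∀ (c : ℝ → Fin m → ℂ) (Λ : ℝ), LipschitzTransformBound c Λ →
        (∀ j, ζ.BlockBound s 0 (c 0) (p * j)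
          (2 * Λ * (1 - 1 / (ζ.maxLength : ℝ) ^ (p + p)) ^ j)) →
        ∀ (n : ℕ) (ω : ℝ), ∃ k ≤ n + q,
          ζ.BlockBound s ω (c ω) k (C * Λ * Real.exp (-(κ * n))) := by
  have hA : (0 : ℝ) < ζ.maxLength := zero_lt_one.trans_le ζ.one_le_maxLength
  obtain ⟨κ₀, hκ₀, hsmall⟩ := ζ.exists_blockBound_of_abs_le_exp_neg hp0
    (δ := 1 / (ζ.maxLength : ℝ) ^ (p + p)) (by positivity)
    (div_le_one_of_le₀ (one_le_pow₀ ζ.one_le_maxLength) (by positivity)) hε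
  set γ : ℝ := 4 / (ζ.maxLength : ℝ) ^ (p + q) / q * η with hγ
  set κ : ℝ := min κ₀ (min ε γ)
  have hκκ₀ : κ ≤ κ₀ := min_le_left _ _
  have hκε : κ ≤ ε := (min_le_right _ _).trans (min_le_left _ _)
  have hκγ : κ ≤ γ := (min_le_right _ _).trans (min_le_right _ _)
  have hκ0 : 0 < κ := by positivity
  refine ⟨κ, hκ0, fun s hs hEK => ?_⟩
  obtain ⟨n₀, hn₀⟩ := Filter.eventually_atTop.1 hEK
  have hexp1 : 2 ≤ 2 * Real.exp 1 := by linarith [Real.one_le_exp zero_le_one]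
  have hpi := Real.two_le_pi
  refine ⟨max (Real.exp (κ * n₀)) (2 * Real.exp 1 + 4 * Real.pi), by positivity,
    fun c Λ hc hmean n ω => ?_⟩
  have hΛ := hc.nonneg
  have hmono : ∀ {C x : ℝ}, 0 ≤ C → C ≤ 2 * Real.exp 1 + 4 * Real.pi → κ * n ≤ x →
      C * Λ * Real.exp (-x) ≤ max (Real.exp (κ * n₀)) (2 * Real.exp 1 + 4 * Real.pi) * Λ *
        Real.exp (-(κ * n)) := fun _ hC hx => by
    gcongr
    exact hC.trans (le_max_right _ _)
  rcases lt_or_ge n n₀ with hn | hn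
  · refine ⟨0, Nat.zero_le _, fun b => norm_twistedSum_le s ω (fun a => ?_) _⟩
    have : Real.exp (κ * n) ≤ max (Real.exp (κ * n₀)) (2 * Real.exp 1 + 4 * Real.pi) :=
      le_max_of_le_left (by gcongr)
    rw [mul_right_comm, Real.exp_neg, ← div_eq_mul_inv]
    exact (hc.norm_le ω a).trans
      (le_mul_of_one_le_left hΛ ((one_le_div (Real.exp_pos _)).2 this))
  rcases le_total (Real.exp (ε * n)) |ω| with hlarge | hlarge
  · exact ⟨0, Nat.zero_le _, (blockBound_of_exp_le_abs hc hlarge).mono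
      (hmono (by norm_num) (by linarith) (by gcongr))⟩
  rcases le_total |ω| (Real.exp (-(ε * n))) with hlow | hlow
  · obtain ⟨k, hk, h⟩ := hsmall hs hc hmean n hlow
    exact ⟨k, hk.trans (Nat.le_add_right n q), h.mono (hmono (by positivity) le_rfl (by gcongr))⟩
  · refine ⟨n + q, le_rfl, (blockBound_of_le_sum_norm_sq hΛ (hc.norm_le ω) hq0 hp hv
      (hn₀ n hn ω hlow hlarge)).mono ?_⟩
    have hmid := hmono (x := γ * n) zero_le_one (by linarith) (by gcongr)
    rwa [one_mul, hγ, mul_assoc _ η] at hmid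

end Decay

end Substitution

/-! ### Transference of Fourier bounds to measure-preserving flows -/

theorem norm_integral_mul_le_of_integral_norm_sq_le {α : Type*} [MeasurableSpace α]
    {μ : Measure α} {F H V : α → ℂ} (hF : MemLp F 2 μ) (hH : MemLp H 2 μ) {M : ℝ} (hM : 0 < M)
    (hV : ∀ x, ‖V x‖ ≤ ‖F x‖) (hle : ∫ x, ‖H x‖ ^ 2 ∂μ ≤ M ^ 2 * ∫ x, ‖F x‖ ^ 2 ∂μ) :
    ‖∫ x, V x * H x ∂μ‖ ≤ M * ∫ x, ‖F x‖ ^ 2 ∂μ := by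
  have hF2 : Integrable (fun x => ‖F x‖ ^ 2) μ := hF.integrable_norm_pow two_ne_zero
  have hH2 : Integrable (fun x => ‖H x‖ ^ 2) μ := hH.integrable_norm_pow two_ne_zero
  have hpt : ∀ x, ‖V x * H x‖ ≤ (2 * M)⁻¹ * ‖H x‖ ^ 2 + M / 2 * ‖F x‖ ^ 2 := fun x => by
    have hamgm : 0 ≤ (2 * M)⁻¹ * (‖H x‖ - M * ‖F x‖) ^ 2 := by positivity
    calc ‖V x * H x‖ ≤ ‖F x‖ * ‖H x‖ := by rw [norm_mul]; gcongr; exact hV x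
      _ ≤ ‖F x‖ * ‖H x‖ + (2 * M)⁻¹ * (‖H x‖ - M * ‖F x‖) ^ 2 := le_add_of_nonneg_right hamgm
      _ = _ := by field_simp; ring
  calc ‖∫ x, V x * H x ∂μ‖ ≤ ∫ x, ((2 * M)⁻¹ * ‖H x‖ ^ 2 + M / 2 * ‖F x‖ ^ 2) ∂μ :=
        norm_integral_le_of_norm_le ((hH2.const_mul _).add (hF2.const_mul _)) (.of_forall hpt)
    _ = (2 * M)⁻¹ * ∫ x, ‖H x‖ ^ 2 ∂μ + M / 2 * ∫ x, ‖F x‖ ^ 2 ∂μ := by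
        rw [integral_add (hH2.const_mul _) (hF2.const_mul _), integral_const_mul,
          integral_const_mul]
    _ ≤ (2 * M)⁻¹ * (M ^ 2 * ∫ x, ‖F x‖ ^ 2 ∂μ) + M / 2 * ∫ x, ‖F x‖ ^ 2 ∂μ := by gcongr
    _ = _ := by field_simp; ring

section Circle

open AddCircle

variable {T : ℝ}

theorem fourier_neg_eq_mul (n : ℤ) (t τ : AddCircle T) :
    fourier (-n) τ = fourier n t * fourier (-n) (t + τ) := by
  simp only [fourier_apply]
  rw [← Circle.coe_mul, ← toCircle_add]
  congr 2
  simp only [neg_smul, smul_add]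
  abel

variable [hT : Fact (0 < T)] {U G : AddCircle T → ℂ} {B M : ℝ}

theorem hasSum_norm_fourierCoeff_sq (hG : MemLp G 2 haarAddCircle) :
    HasSum (fun n => ‖fourierCoeff G n‖ ^ 2) (∫ τ, ‖G τ‖ ^ 2 ∂haarAddCircle) := by
  have hnorm : ∫ τ, ‖hG.toLp G τ‖ ^ 2 ∂haarAddCircle = ∫ τ, ‖G τ‖ ^ 2 ∂haarAddCircle :=
    integral_congr_ae (hG.coeFn_toLp.mono fun τ hτ => by simp only [hτ])
  rw [← fourierCoeff_congr_ae hG.coeFn_toLp, ← hnorm]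
  exact hasSum_sq_fourierCoeff hG.toLp

/-- The correlation `τ ↦ ∫ U(t) G(t + τ) dt` on the circle: a convolution, up to the reflection of
`U`, so that it diagonalizes in the Fourier basis. -/
noncomputable def circleCorrelation (U G : AddCircle T → ℂ) (τ : AddCircle T) : ℂ :=
  ∫ t, U t * G (t + τ) ∂haarAddCircle

theorem norm_circleCorrelation_le (hG : Integrable G haarAddCircle) (hB : ∀ t, ‖U t‖ ≤ B)
    (τ : AddCircle T) : ‖circleCorrelation U G τ‖ ≤ B * ∫ t, ‖G t‖ ∂haarAddCircle := by
  rw [← integral_add_right_eq_self (fun t => ‖G t‖) τ, ← integral_const_mul]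
  refine norm_integral_le_of_norm_le ((hG.norm.comp_add_right τ).const_mul B)
    (.of_forall fun t => ?_)
  rw [norm_mul]
  gcongr
  exact hB t

theorem memLp_circleCorrelation (hU : Measurable U) (hG : Measurable G)
    (hG1 : Integrable G haarAddCircle) (hB : ∀ t, ‖U t‖ ≤ B) :
    MemLp (circleCorrelation U G) 2 haarAddCircle := by
  have hmeas : Measurable fun z : AddCircle T × AddCircle T => U z.2 * G (z.2 + z.1) := by fun_prop
  exact .of_bound hmeas.stronglyMeasurable.integral_prod_right'.aestronglyMeasurable _
    (.of_forall (norm_circleCorrelation_le hG1 hB))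

theorem fourierCoeff_circleCorrelation (hU : Measurable U) (hG : Integrable G haarAddCircle)
    (hB : ∀ t, ‖U t‖ ≤ B) (n : ℤ) :
    fourierCoeff (circleCorrelation U G) n =
      (∫ t, U t * fourier n t ∂haarAddCircle) * fourierCoeff G n := by
  have hint : Integrable (Function.uncurry fun τ t => fourier (-n) τ * (U t * G (t + τ)))
      ((haarAddCircle (T := T)).prod haarAddCircle) := by
    have hshift : Integrable (fun z : AddCircle T × AddCircle T => G (z.1 + z.2))
        (haarAddCircle.prod haarAddCircle) :=
      (measurePreserving_prod_add haarAddCircle haarAddCircle).integrable_comp_of_integrable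
        (hG.comp_snd haarAddCircle)
    refine (hshift.bdd_mul (hU.comp measurable_fst).aestronglyMeasurable
      (.of_forall fun z => hB z.1)).swap.bdd_mul (c := 1)
      (((map_continuous (fourier (-n))).comp continuous_fst).aestronglyMeasurable)
      (.of_forall fun z => ?_)
    rw [fourier_apply, Circle.norm_coe]
  calc fourierCoeff (circleCorrelation U G) n
      = ∫ τ, ∫ t, fourier (-n) τ * (U t * G (t + τ)) ∂haarAddCircle ∂haarAddCircle := by
        simp only [fourierCoeff, circleCorrelation, smul_eq_mul, integral_const_mul]
    _ = ∫ t, ∫ τ, fourier (-n) τ * (U t * G (t + τ)) ∂haarAddCircle ∂haarAddCircle :=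
        integral_integral_swap hint
    _ = ∫ t, U t * fourier n t * fourierCoeff G n ∂haarAddCircle := by
        congr 1 with t
        rw [fourierCoeff,
          ← integral_add_left_eq_self (fun τ => fourier (-n) τ • G τ) t, ← integral_const_mul]
        congr 1 with τ
        rw [fourier_neg_eq_mul n t τ, smul_eq_mul]
        ring
    _ = _ := integral_mul_const _ _

/-- By Parseval's identity, correlating with `U` acts as a Fourier multiplier bounded by `M`. -/
theorem integral_norm_circleCorrelation_sq_le (hU : Measurable U) (hB : ∀ t, ‖U t‖ ≤ B)
    (hG : Measurable G) (hG2 : MemLp G 2 haarAddCircle)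
    (hM : ∀ n : ℤ, ‖∫ t, U t * fourier n t ∂haarAddCircle‖ ≤ M) :
    ∫ τ, ‖circleCorrelation U G τ‖ ^ 2 ∂haarAddCircle ≤
      M ^ 2 * ∫ τ, ‖G τ‖ ^ 2 ∂haarAddCircle := by
  have hG1 := hG2.integrable one_le_two
  refine hasSum_le (fun n => ?_)
    (hasSum_norm_fourierCoeff_sq (memLp_circleCorrelation hU hG hG1 hB))
    ((hasSum_norm_fourierCoeff_sq hG2).mul_left (M ^ 2))
  rw [fourierCoeff_circleCorrelation hU hG1 hB, norm_mul, mul_pow]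
  gcongr
  exact hM n

theorem norm_integral_mul_circleCorrelation_le (hU : Measurable U) (hB : ∀ t, ‖U t‖ ≤ B)
    (hG : Measurable G) (hG2 : MemLp G 2 haarAddCircle) (hM0 : 0 < M)
    (hM : ∀ n : ℤ, ‖∫ t, U t * fourier n t ∂haarAddCircle‖ ≤ M) {V : AddCircle T → ℂ}
    (hV : ∀ τ, ‖V τ‖ ≤ ‖G τ‖) :
    ‖∫ τ, V τ * circleCorrelation U G τ ∂haarAddCircle‖ ≤ M * ∫ τ, ‖G τ‖ ^ 2 ∂haarAddCircle :=
  norm_integral_mul_le_of_integral_norm_sq_le hG2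
    (memLp_circleCorrelation hU hG (hG2.integrable one_le_two) hB) hM0 hV
    (integral_norm_circleCorrelation_sq_le hU hB hG hG2 hM)

end Circle

section Line

open scoped FourierTransform

variable {T R : ℝ}

theorem measurable_liftIoc [Fact (0 < T)] {f : ℝ → ℂ} (hf : Measurable f) :
    Measurable (AddCircle.liftIoc T 0 f) :=
  (hf.comp measurable_subtype_coe).comp (AddCircle.measurableEquivIoc T 0).measurable

theorem integral_haarAddCircle_eq_setIntegral [hT : Fact (0 < T)] {E : Type*}
    [NormedAddCommGroup E] [NormedSpace ℝ E] (f : AddCircle T → E) :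
    ∫ t, f t ∂AddCircle.haarAddCircle = T⁻¹ • ∫ t in Set.Ioc 0 T, f (t : AddCircle T) := by
  rw [AddCircle.integral_haarAddCircle, ← AddCircle.intervalIntegral_preimage T 0 f, zero_add,
    intervalIntegral.integral_of_le hT.out.le]

theorem norm_liftIoc_indicator_le [Fact (0 < T)] (S : Set ℝ) (f : ℝ → ℂ) (τ : AddCircle T) :
    ‖AddCircle.liftIoc T 0 (S.indicator f) τ‖ ≤ ‖AddCircle.liftIoc T 0 f τ‖ :=
  norm_indicator_le_norm_self f _

theorem integral_liftIoc_indicator_mul [Fact (0 < T)] (hRT : R ≤ T) (u : ℝ → ℂ)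
    (F : AddCircle T → ℂ) :
    ∫ t, AddCircle.liftIoc T 0 ((Set.Ioc 0 R).indicator u) t * F t ∂AddCircle.haarAddCircle =
      T⁻¹ • ∫ t in Set.Ioc 0 R, u t * F (t : AddCircle T) := by
  rw [integral_haarAddCircle_eq_setIntegral]
  conv_rhs => rw [← Set.inter_eq_right.2 (Set.Ioc_subset_Ioc_right hRT : Set.Ioc 0 R ⊆ _),
    ← setIntegral_indicator measurableSet_Ioc]
  congr 1
  refine setIntegral_congr_fun measurableSet_Ioc fun t ht => ?_
  rw [AddCircle.liftIoc_zero_coe_apply ht, Set.indicator_mul_left]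

theorem norm_integral_liftIoc_indicator_mul_fourier_le [hT : Fact (0 < T)] (hR : 0 ≤ R)
    (hRT : R ≤ T) {u : ℝ → ℂ} {M : ℝ}
    (hM : ∀ ω : ℝ, ‖∫ t in (0 : ℝ)..R, (𝐞 (ω * t) : ℂ) * u t‖ ≤ M) (n : ℤ) :
    ‖∫ t, AddCircle.liftIoc T 0 ((Set.Ioc 0 R).indicator u) t * fourier n t
      ∂AddCircle.haarAddCircle‖ ≤ T⁻¹ * M := by
  have hT0 := hT.out
  have hchar : ∀ t : ℝ, u t * fourier n (t : AddCircle T) = (𝐞 (n / T * t) : ℂ) * u t := fun t => by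
    rw [fourier_coe_apply, Real.fourierChar_apply, mul_comm]
    congr 2
    push_cast
    ring
  rw [integral_liftIoc_indicator_mul hRT, norm_smul, Real.norm_of_nonneg (by positivity),
    ← intervalIntegral.integral_of_le hR]
  simp only [hchar]
  gcongr
  exact hM _

theorem circleCorrelation_liftIoc [Fact (0 < T)] (hRT : 2 * R ≤ T) (u G : ℝ → ℂ) {x : ℝ}
    (hx : x ∈ Set.Ioc 0 R) :
    circleCorrelation (AddCircle.liftIoc T 0 ((Set.Ioc 0 R).indicator u))
      (AddCircle.liftIoc T 0 G) x = T⁻¹ • ∫ t in Set.Ioc 0 R, u t * G (t + x) := by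
  rw [circleCorrelation, integral_liftIoc_indicator_mul (by linarith [hx.1, hx.2]) u
    fun t => AddCircle.liftIoc T 0 G (t + (x : AddCircle T))]
  congr 1
  refine setIntegral_congr_fun measurableSet_Ioc fun t ht => ?_
  rw [← AddCircle.coe_add, AddCircle.liftIoc_zero_coe_apply
    ⟨add_pos ht.1 hx.1, by linarith [ht.2, hx.2]⟩]

/-- Lifting to the circle of length `2 * R` keeps the translates `t + x` in a fundamental
domain. -/
theorem norm_integral_conj_mul_correlation_le (hR : 0 < R) {u G : ℝ → ℂ} (hu : Measurable u)
    {B : ℝ} (hB : ∀ t, ‖u t‖ ≤ B) (hG : Measurable G)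
    (hG2 : MemLp G 2 (volume.restrict (Set.Ioc 0 (2 * R)))) {M : ℝ} (hM0 : 0 < M)
    (hM : ∀ ω : ℝ, ‖∫ t in (0 : ℝ)..R, (𝐞 (ω * t) : ℂ) * u t‖ ≤ M) :
    ‖∫ x in Set.Ioc 0 R, (starRingEnd ℂ) (G x) * ∫ t in Set.Ioc 0 R, u t * G (t + x)‖ ≤
      M * ∫ t in Set.Ioc 0 (2 * R), ‖G t‖ ^ 2 := by
  have hT : 0 < 2 * R := by positivity
  have : Fact (0 < 2 * R) := ⟨hT⟩
  have hRT : R ≤ 2 * R := by linarith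
  have hGL2 : MemLp (AddCircle.liftIoc (2 * R) 0 G) 2 AddCircle.haarAddCircle :=
    MemLp.haarAddCircle (MemLp.memLp_liftIoc (by rwa [zero_add]))
  have hV : ∀ τ, ‖AddCircle.liftIoc (2 * R) 0 ((Set.Ioc 0 R).indicator fun x =>
      (starRingEnd ℂ) (G x)) τ‖ ≤ ‖AddCircle.liftIoc (2 * R) 0 G τ‖ := fun τ =>
    (norm_liftIoc_indicator_le _ _ τ).trans (RCLike.norm_conj _).le
  have key := norm_integral_mul_circleCorrelation_le
    (measurable_liftIoc (hu.indicator measurableSet_Ioc))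
    (fun t => (norm_liftIoc_indicator_le _ _ t).trans (hB _)) (measurable_liftIoc hG) hGL2
    (by positivity) (norm_integral_liftIoc_indicator_mul_fourier_le hR.le hRT hM) hV
  have hG_lift : ∫ t in Set.Ioc 0 (2 * R), ‖AddCircle.liftIoc (2 * R) 0 G t‖ ^ 2 =
      ∫ t in Set.Ioc 0 (2 * R), ‖G t‖ ^ 2 :=
    setIntegral_congr_fun measurableSet_Ioc fun t ht => by
      simp only [AddCircle.liftIoc_zero_coe_apply ht]
  rw [integral_liftIoc_indicator_mul hRT, integral_haarAddCircle_eq_setIntegral,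
    setIntegral_congr_fun measurableSet_Ioc fun x hx => by
      rw [circleCorrelation_liftIoc le_rfl u G hx], hG_lift] at key
  simp only [mul_smul_comm, integral_smul, norm_smul, smul_eq_mul,
    Real.norm_of_nonneg (inv_nonneg.2 hT.le), mul_assoc] at key
  refine le_of_mul_le_mul_left (le_of_mul_le_mul_left (key.trans_eq ?_) (inv_pos.2 hT))
    (inv_pos.2 hT)
  ring

end Line

section Flow

open scoped FourierTransform

variable {Y : Type*} [MeasurableSpace Y] [AddAction ℝ Y] [MeasurableVAdd₂ ℝ Y] {ν : Measure Y}
  [VAddInvariantMeasure ℝ Y ν] [SFinite ν]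

theorem integrable_comp_vadd {α : Type*} [MeasurableSpace α] {μ : Measure α} [IsFiniteMeasure μ]
    {k : α → ℝ} (hk : Measurable k) {F : Y → ℝ} (hF : Integrable F ν) :
    Integrable (fun z : α × Y => F (k z.1 +ᵥ z.2)) (μ.prod ν) := by
  have hskew : MeasurePreserving (fun z : α × Y => (z.1, k z.1 +ᵥ z.2)) (μ.prod ν) (μ.prod ν) :=
    (MeasurePreserving.id μ).skew_product (g := fun a y => k a +ᵥ y)
      ((hk.comp measurable_fst).vadd measurable_snd)
      (.of_forall fun a => (measurePreserving_vadd (k a) ν).map_eq)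
  exact hskew.integrable_comp_of_integrable (hF.comp_snd μ)

variable {R B M : ℝ} {u : ℝ → ℂ} {g : Y → ℂ}

theorem integrable_autocorrelation_kernel {lam : Measure ℝ} [IsFiniteMeasure lam]
    (hu : Measurable u) (hB : ∀ t, ‖u t‖ ≤ B) (hg : Measurable g) (hg2 : MemLp g 2 ν) :
    Integrable (fun z : (ℝ × ℝ) × Y =>
        (starRingEnd ℂ) (g (z.1.1 +ᵥ z.2)) * (u z.1.2 * g ((z.1.2 + z.1.1) +ᵥ z.2)))
      ((lam.prod lam).prod ν) := by
  have hgsq : Integrable (fun y => ‖g y‖ ^ 2) ν := hg2.integrable_norm_pow two_ne_zero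
  have h_base := integrable_comp_vadd (μ := lam.prod lam) (k := fun a => a.1) (by fun_prop) hgsq
  have h_shift := integrable_comp_vadd (μ := lam.prod lam) (k := fun a => a.2 + a.1)
    (by fun_prop) hgsq
  have hgm : Measurable fun z : ℝ × Y => g (z.1 +ᵥ z.2) :=
    hg.comp (measurable_fst.vadd measurable_snd)
  refine ((h_base.add h_shift).const_mul B).mono' (Measurable.aestronglyMeasurable ?_)
    (.of_forall fun z => ?_)
  · exact (Complex.continuous_conj.measurable.comp
      (hgm.comp ((measurable_fst.comp measurable_fst).prodMk measurable_snd))).mul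
      ((hu.comp (measurable_snd.comp measurable_fst)).mul
        (hgm.comp (Measurable.prodMk (by fun_prop) measurable_snd)))
  · have hB0 : 0 ≤ B := (norm_nonneg _).trans (hB 0)
    rw [norm_mul, norm_mul, RCLike.norm_conj, mul_left_comm, Pi.add_apply]
    gcongr
    · exact hB _
    · nlinarith [two_mul_le_add_sq ‖g (z.1.1 +ᵥ z.2)‖ ‖g ((z.1.2 + z.1.1) +ᵥ z.2)‖]

theorem mul_integral_autocorrelation_eq (hR : 0 ≤ R) (hu : Measurable u) (hB : ∀ t, ‖u t‖ ≤ B)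
    (hg : Measurable g) (hg2 : MemLp g 2 ν) :
    R * ∫ t in (0 : ℝ)..R, u t * ∫ y, g (t +ᵥ y) * (starRingEnd ℂ) (g y) ∂ν =
      ∫ y, (∫ x in Set.Ioc 0 R, (starRingEnd ℂ) (g (x +ᵥ y)) *
        ∫ t in Set.Ioc 0 R, u t * g ((t + x) +ᵥ y)) ∂ν := by
  set lam : Measure ℝ := volume.restrict (Set.Ioc 0 R)
  have hK := integrable_autocorrelation_kernel (lam := lam) hu hB hg hg2
  have hinv : ∀ x : ℝ, ∫ t, (∫ y, (starRingEnd ℂ) (g (x +ᵥ y)) * (u t * g ((t + x) +ᵥ y)) ∂ν) ∂lam =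
      ∫ t in (0 : ℝ)..R, u t * ∫ y, g (t +ᵥ y) * (starRingEnd ℂ) (g y) ∂ν := fun x => by
    rw [intervalIntegral.integral_of_le hR]
    congr 1 with t
    rw [← integral_vadd_eq_self (fun y => g (t +ᵥ y) * (starRingEnd ℂ) (g y)) (g := x),
      ← integral_const_mul]
    congr 1 with y
    rw [add_vadd]
    ring
  calc _ = ∫ x, (∫ t, (∫ y, (starRingEnd ℂ) (g (x +ᵥ y)) * (u t * g ((t + x) +ᵥ y)) ∂ν) ∂lam)
          ∂lam := by
        simp only [hinv]
        rw [integral_const, measureReal_restrict_apply_univ, Real.volume_real_Ioc_of_le hR,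
          sub_zero, Complex.real_smul]
    _ = ∫ a, (∫ y, (starRingEnd ℂ) (g (a.1 +ᵥ y)) * (u a.2 * g ((a.2 + a.1) +ᵥ y)) ∂ν)
          ∂(lam.prod lam) := (integral_prod _ hK.integral_prod_left).symm
    _ = ∫ y, (∫ a, (starRingEnd ℂ) (g (a.1 +ᵥ y)) * (u a.2 * g ((a.2 + a.1) +ᵥ y))
          ∂(lam.prod lam)) ∂ν := integral_integral_swap hK
    _ = _ := integral_congr_ae (hK.prod_left_ae.mono fun y hy => by
        simp only [integral_prod _ hy, integral_const_mul])

/-- Averaging over the starting point along the orbit turns the autocorrelation into a correlation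
of functions on the line, where Fourier analysis applies. -/
theorem norm_integral_mul_autocorrelation_le (hR : 0 < R) (hu : Measurable u)
    (hB : ∀ t, ‖u t‖ ≤ B) (hM0 : 0 < M)
    (hM : ∀ ω : ℝ, ‖∫ t in (0 : ℝ)..R, (𝐞 (ω * t) : ℂ) * u t‖ ≤ M) (hg : Measurable g)
    (hg2 : MemLp g 2 ν) :
    ‖∫ t in (0 : ℝ)..R, u t * ∫ y, g (t +ᵥ y) * (starRingEnd ℂ) (g y) ∂ν‖ ≤
      2 * M * ∫ y, ‖g y‖ ^ 2 ∂ν := by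
  have hgsq : Integrable (fun z : ℝ × Y => ‖g (z.1 +ᵥ z.2)‖ ^ 2)
      ((volume.restrict (Set.Ioc 0 (2 * R))).prod ν) :=
    integrable_comp_vadd measurable_id (hg2.integrable_norm_pow two_ne_zero)
  have horbit : ∀ᵐ y ∂ν, ‖∫ x in Set.Ioc 0 R, (starRingEnd ℂ) (g (x +ᵥ y)) *
      ∫ t in Set.Ioc 0 R, u t * g ((t + x) +ᵥ y)‖ ≤
        M * ∫ t in Set.Ioc 0 (2 * R), ‖g (t +ᵥ y)‖ ^ 2 := by
    filter_upwards [hgsq.prod_left_ae] with y hy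
    have hgy : Measurable fun t : ℝ => g (t +ᵥ y) :=
      hg.comp (measurable_id.vadd measurable_const)
    exact norm_integral_conj_mul_correlation_le hR hu hB hgy
      ((memLp_two_iff_integrable_sq_norm hgy.aestronglyMeasurable).2 hy) hM0 hM
  have hnorm : ∫ y, (∫ t in Set.Ioc 0 (2 * R), ‖g (t +ᵥ y)‖ ^ 2) ∂ν =
      2 * R * ∫ y, ‖g y‖ ^ 2 ∂ν := by
    rw [integral_integral_swap (f := fun y (t : ℝ) => ‖g (t +ᵥ y)‖ ^ 2) hgsq.swap]
    simp only [integral_vadd_eq_self (fun y => ‖g y‖ ^ 2)]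
    rw [integral_const, measureReal_restrict_apply_univ,
      Real.volume_real_Ioc_of_le (by positivity), sub_zero, smul_eq_mul]
  refine le_of_mul_le_mul_left ?_ hR
  calc R * ‖∫ t in (0 : ℝ)..R, u t * ∫ y, g (t +ᵥ y) * (starRingEnd ℂ) (g y) ∂ν‖
      = ‖R * ∫ t in (0 : ℝ)..R, u t * ∫ y, g (t +ᵥ y) * (starRingEnd ℂ) (g y) ∂ν‖ := by
        rw [norm_mul, Complex.norm_of_nonneg hR.le]
    _ ≤ ∫ y, (M * ∫ t in Set.Ioc 0 (2 * R), ‖g (t +ᵥ y)‖ ^ 2) ∂ν := by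
        rw [mul_integral_autocorrelation_eq hR.le hu hB hg hg2]
        exact norm_integral_le_of_norm_le (hgsq.integral_prod_right.const_mul M) horbit
    _ = R * (2 * M * ∫ y, ‖g y‖ ^ 2 ∂ν) := by
        rw [integral_const_mul, hnorm]
        ring

end Flow

/-! ### Finite Fourier transforms of Lipschitz functions -/

section Transform

open scoped FourierTransform

/-- The Fourier transform `∫₀^ℓ 𝐞(ω r) φ(r) dr` of the restriction of `φ` to `[0, ℓ]`. The phase has
a plus sign, as in `twistedSum`. -/
noncomputable def intervalFourier (φ : ℝ → ℂ) (ℓ ω : ℝ) : ℂ :=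
  ∫ r in (0 : ℝ)..ℓ, (𝐞 (ω * r) : ℂ) * φ r

variable {φ : ℝ → ℂ} {Λ ℓ : ℝ}

theorem continuous_fourierChar_mul (hφ : Continuous φ) (ω : ℝ) :
    Continuous fun r => (𝐞 (ω * r) : ℂ) * φ r :=
  (continuous_subtype_val.comp (Real.continuous_fourierChar.comp (continuous_const_mul ω))).mul hφ

theorem intervalFourier_zero_right (φ : ℝ → ℂ) (ℓ : ℝ) :
    intervalFourier φ ℓ 0 = ∫ r in (0 : ℝ)..ℓ, φ r := by
  simp only [intervalFourier, zero_mul, AddChar.map_zero_eq_one, Circle.coe_one, one_mul]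

theorem norm_intervalFourier_le (hb : ∀ r, ‖φ r‖ ≤ Λ) (ω : ℝ) :
    ‖intervalFourier φ ℓ ω‖ ≤ Λ * |ℓ| := by
  simpa only [sub_zero, intervalFourier] using
    intervalIntegral.norm_integral_le_of_norm_le_const (a := 0) (b := ℓ) fun r _ => by
      rw [norm_mul, Circle.norm_coe, one_mul]
      exact hb r

theorem norm_intervalFourier_sub_zero_le (hφ : Continuous φ) (hb : ∀ r, ‖φ r‖ ≤ Λ) (hℓ : 0 ≤ ℓ)
    (ω : ℝ) :
    ‖intervalFourier φ ℓ ω - intervalFourier φ ℓ 0‖ ≤ 2 * Real.pi * |ω| * Λ * ℓ ^ 2 := by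
  rw [intervalFourier_zero_right, intervalFourier, ← intervalIntegral.integral_sub
    ((continuous_fourierChar_mul hφ ω).intervalIntegrable _ _) (hφ.intervalIntegrable _ _)]
  refine (intervalIntegral.norm_integral_le_of_norm_le_const
    (C := 2 * Real.pi * (|ω| * ℓ) * Λ) fun r hr => ?_).trans_eq ?_
  · rw [Set.uIoc_of_le hℓ] at hr
    calc ‖(𝐞 (ω * r) : ℂ) * φ r - φ r‖ = ‖(𝐞 (ω * r) : ℂ) - 1‖ * ‖φ r‖ := by
          rw [← norm_mul, sub_one_mul]
      _ ≤ 2 * Real.pi * |ω * r| * Λ := by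
          gcongr
          exacts [norm_fourierChar_sub_one_le _, hb r]
      _ ≤ 2 * Real.pi * (|ω| * ℓ) * Λ := by
          have hΛ : 0 ≤ Λ := (norm_nonneg _).trans (hb 0)
          rw [abs_mul, abs_of_pos hr.1]
          gcongr
          exact hr.2
  · rw [sub_zero, abs_of_nonneg hℓ]
    ring

theorem fourierChar_mul_add_half_period {ω : ℝ} (hω : ω ≠ 0) (r : ℝ) :
    (𝐞 (ω * (r + 1 / (2 * ω))) : ℂ) = -𝐞 (ω * r) := by
  have hperiod : ω * (r + 1 / (2 * ω)) = ω * r + 1 / 2 := by field_simp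
  have hhalf : (𝐞 (1 / 2) : ℂ) = -1 := by
    rw [Real.fourierChar_apply, ← Complex.exp_pi_mul_I]
    congr 1
    push_cast
    ring
  rw [hperiod, AddChar.map_add_eq_mul, Circle.coe_mul, hhalf, mul_neg_one]

/-- Translating by half a period changes the sign of the phase, so that twice the transform is the
transform of an increment of `φ`, up to two boundary integrals. -/
theorem two_mul_intervalFourier_eq (hφ : Continuous φ) {ω : ℝ} (hω : ω ≠ 0) {h : ℝ}
    (hh : h = 1 / (2 * ω)) :
    2 * intervalFourier φ ℓ ω = (∫ r in (0 : ℝ)..ℓ, (𝐞 (ω * r) : ℂ) * (φ r - φ (r + h))) +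
      ((∫ r in (0 : ℝ)..(0 + h), (𝐞 (ω * r) : ℂ) * φ r) -
        ∫ r in ℓ..ℓ + h, (𝐞 (ω * r) : ℂ) * φ r) := by
  have hint : ∀ a b, IntervalIntegrable (fun r => (𝐞 (ω * r) : ℂ) * φ r) volume a b :=
    (continuous_fourierChar_mul hφ ω).intervalIntegrable
  have htranslate : ∫ r in (0 + h)..(ℓ + h), (𝐞 (ω * r) : ℂ) * φ r =
      -∫ r in (0 : ℝ)..ℓ, (𝐞 (ω * r) : ℂ) * φ (r + h) := by
    rw [← intervalIntegral.integral_comp_add_right (fun r => (𝐞 (ω * r) : ℂ) * φ r) h,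
      ← intervalIntegral.integral_neg]
    simp only [hh, fourierChar_mul_add_half_period hω, neg_mul]
  have hincrement : ∫ r in (0 : ℝ)..ℓ, (𝐞 (ω * r) : ℂ) * (φ r - φ (r + h)) =
      intervalFourier φ ℓ ω - ∫ r in (0 : ℝ)..ℓ, (𝐞 (ω * r) : ℂ) * φ (r + h) := by
    simp only [mul_sub]
    exact intervalIntegral.integral_sub (hint _ _)
      ((continuous_fourierChar_mul (hφ.comp (continuous_add_const h)) ω).intervalIntegrable _ _)
  have hcomm := intervalIntegral.integral_interval_sub_interval_comm (hint 0 ℓ)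
    (hint (0 + h) (ℓ + h)) (hint 0 (0 + h))
  rw [htranslate, sub_neg_eq_add] at hcomm
  rw [← hcomm, hincrement, intervalFourier]
  ring

theorem norm_intervalFourier_mul_abs_le (hb : ∀ r, ‖φ r‖ ≤ Λ)
    (hlip : ∀ r r', ‖φ r - φ r'‖ ≤ Λ * |r - r'|) (hℓ : |ℓ| ≤ 1) (ω : ℝ) :
    ‖intervalFourier φ ℓ ω‖ * |ω| ≤ Λ := by
  have hΛ : 0 ≤ Λ := (norm_nonneg _).trans (hb 0)
  rcases eq_or_ne ω 0 with rfl | hω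
  · rwa [abs_zero, mul_zero]
  have hφ : Continuous φ := (LipschitzWith.of_dist_le' fun r r' => by
    rw [dist_eq_norm, Real.dist_eq]; exact hlip r r').continuous
  obtain ⟨h, hh⟩ : ∃ h, h = 1 / (2 * ω) := ⟨_, rfl⟩
  have hboundary : ∀ a : ℝ, ‖∫ r in a..a + h, (𝐞 (ω * r) : ℂ) * φ r‖ ≤ Λ * |h| := fun a => by
    simpa only [add_sub_cancel_left] using
      intervalIntegral.norm_integral_le_of_norm_le_const (a := a) (b := a + h) fun r _ => by
        rw [norm_mul, Circle.norm_coe, one_mul]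
        exact hb r
  have hincrement : ‖∫ r in (0 : ℝ)..ℓ, (𝐞 (ω * r) : ℂ) * (φ r - φ (r + h))‖ ≤ Λ * |h| :=
    (intervalIntegral.norm_integral_le_of_norm_le_const (C := Λ * |h|) fun r _ => by
      rw [norm_mul, Circle.norm_coe, one_mul]
      simpa only [sub_add_cancel_left, abs_neg] using hlip r (r + h)).trans
      (mul_le_of_le_one_right (by positivity) (by rwa [sub_zero]))
  have hωh : 2 * (|h| * |ω|) = 1 := by
    rw [← abs_mul, hh, div_mul_eq_mul_div, one_mul, div_mul_cancel_right₀ hω]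
    norm_num
  have htwo : 2 * ‖intervalFourier φ ℓ ω‖ ≤ 3 * (Λ * |h|) := by
    rw [← Complex.norm_ofNat 2, ← norm_mul, two_mul_intervalFourier_eq hφ hω hh]
    linarith [norm_add_le (∫ r in (0 : ℝ)..ℓ, (𝐞 (ω * r) : ℂ) * (φ r - φ (r + h)))
      ((∫ r in (0 : ℝ)..(0 + h), (𝐞 (ω * r) : ℂ) * φ r) -
        ∫ r in ℓ..ℓ + h, (𝐞 (ω * r) : ℂ) * φ r),
      norm_sub_le (∫ r in (0 : ℝ)..(0 + h), (𝐞 (ω * r) : ℂ) * φ r)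
        (∫ r in ℓ..ℓ + h, (𝐞 (ω * r) : ℂ) * φ r), hboundary 0, hboundary ℓ]
  nlinarith [mul_le_mul_of_nonneg_right htwo (abs_nonneg ω)]

theorem lipschitzTransformBound_intervalFourier {α : Type*} [Nonempty α] {φ : α → ℝ → ℂ}
    {s : α → ℝ} (hs0 : ∀ a, 0 ≤ s a) (hs1 : ∀ a, s a ≤ 1) (hb : ∀ a r, ‖φ a r‖ ≤ Λ)
    (hlip : ∀ a r r', ‖φ a r - φ a r'‖ ≤ Λ * |r - r'|) :
    LipschitzTransformBound (fun ω a => intervalFourier (φ a) (s a) ω) Λ := by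
  have hΛ : 0 ≤ Λ := (norm_nonneg _).trans (hb (Classical.arbitrary α) 0)
  have hs : ∀ a, |s a| ≤ 1 := fun a => (abs_of_nonneg (hs0 a)).trans_le (hs1 a)
  have hφ : ∀ a, Continuous (φ a) := fun a => (LipschitzWith.of_dist_le' fun r r' => by
    rw [dist_eq_norm, Real.dist_eq]; exact hlip a r r').continuous
  refine ⟨hΛ, fun ω a => ?_, fun ω a => ?_, fun ω a => ?_⟩
  · exact (norm_intervalFourier_le (hb a) ω).trans (mul_le_of_le_one_right hΛ (hs a))
  · have h := norm_intervalFourier_mul_abs_le (hb a) (hlip a) (hs a) ω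
    exact h.trans (by linarith)
  · exact (norm_intervalFourier_sub_zero_le (hφ a) (hb a) (hs0 a) ω).trans
      (mul_le_of_le_one_right (by positivity) (pow_le_one₀ (hs0 a) (hs1 a)))

end Transform

namespace Substitution

/-! ### The suspension flow in coordinates -/

section Tiles

open scoped FourierTransform

variable {m : ℕ}

theorem block_succ (x : ℤ → Fin m) (N : ℕ) : block x 0 (N + 1) = block x 0 N ++ [x N] := by
  rw [block_add]
  simp [block]

theorem roofSum_zero (s : Fin m → ℝ) (x : ℤ → Fin m) : roofSum s x 0 = 0 := by
  change roofSum s x (Int.ofNat 0) = 0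
  simp [roofSum]

theorem wordLength_block (s : Fin m → ℝ) (x : ℤ → Fin m) (N : ℕ) :
    wordLength s (block x 0 N) = roofSum s x N := by
  induction N with
  | zero => simp [block, wordLength, roofSum_zero]
  | succ N ih =>
    rw [block_succ, wordLength_append, ih, Nat.cast_succ, roofSum_add_one]
    simp [wordLength]

theorem natCast_mul_le_roofSum {s : Fin m → ℝ} {σ : ℝ} (hσ : ∀ a, σ ≤ s a) (x : ℤ → Fin m)
    (N : ℕ) : N * σ ≤ roofSum s x N := by
  induction N with
  | zero => simp [roofSum_zero]
  | succ N ih =>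
    push_cast
    rw [roofSum_add_one]
    linarith [hσ (x N)]

theorem measurable_roofSum (s : Fin m → ℝ) (n : ℤ) :
    Measurable fun x : ℤ → Fin m => roofSum s x n := by
  have hletter : ∀ i : ℤ, Measurable fun x : ℤ → Fin m => s (x i) := fun i =>
    (measurable_of_finite s).comp (measurable_pi_apply i)
  rcases n with n | n
  · exact Finset.measurable_fun_sum _ fun i _ => hletter i
  · exact (Finset.measurable_fun_sum _ fun i _ => hletter _).neg

theorem strictMono_roofSum {s : Fin m → ℝ} (hs : ∀ a, 0 < s a) (x : ℤ → Fin m) :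
    StrictMono (roofSum s x) :=
  strictMono_int_of_lt_succ fun n => by rw [roofSum_add_one]; linarith [hs (x n)]

variable {s : Fin m → ℝ} (hs : ∀ a, 0 < s a)

theorem tileIndex_spec (x : ℤ → Fin m) (u : ℝ) :
    roofSum s x (tileIndex s hs x u) ≤ u ∧ u < roofSum s x (tileIndex s hs x u + 1) :=
  (exists_tile s hs x u).choose_spec

theorem tileIndex_eq {x : ℤ → Fin m} {u : ℝ} {n : ℤ} (hle : roofSum s x n ≤ u)
    (hlt : u < roofSum s x (n + 1)) : tileIndex s hs x u = n := by
  have hmono := strictMono_roofSum hs x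
  obtain ⟨hle', hlt'⟩ := tileIndex_spec hs x u
  have hindex_lt := hmono.lt_iff_lt.1 (hle'.trans_lt hlt)
  have hlt_index := hmono.lt_iff_lt.1 (hle.trans_lt hlt')
  omega

theorem tileIndex_nonneg (x : ℤ → Fin m) {u : ℝ} (hu : 0 ≤ u) : 0 ≤ tileIndex s hs x u := by
  have hlt := hu.trans_lt (tileIndex_spec hs x u).2
  rw [← roofSum_zero s x, (strictMono_roofSum hs x).lt_iff_lt] at hlt
  omega

theorem measurable_tileIndex :
    Measurable fun z : (ℤ → Fin m) × ℝ => tileIndex s hs z.1 z.2 := by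
  refine measurable_to_countable' fun n => ?_
  have hpreimage : (fun z : (ℤ → Fin m) × ℝ => tileIndex s hs z.1 z.2) ⁻¹' {n} =
      {z | roofSum s z.1 n ≤ z.2} ∩ {z | z.2 < roofSum s z.1 (n + 1)} := by
    ext z
    constructor
    · rintro rfl
      exact tileIndex_spec hs z.1 z.2
    · rintro ⟨hle, hlt⟩
      exact tileIndex_eq hs hle hlt
  rw [hpreimage]
  exact (measurableSet_le ((measurable_roofSum s n).comp measurable_fst) measurable_snd).inter
    (measurableSet_lt measurable_snd ((measurable_roofSum s (n + 1)).comp measurable_fst))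

/-- The values of the cylindrical function with profiles `ψ` along the orbit of the point `(x, 0)`:
in terms of the tiling of the line by the letters of `x`, the profile of the tile containing `u`,
evaluated at the position of `u` in that tile. -/
noncomputable def orbitFun (ψ : Fin m → ℝ → ℂ) (x : ℤ → Fin m) (u : ℝ) : ℂ :=
  ψ (x (tileIndex s hs x u)) (u - roofSum s x (tileIndex s hs x u))

variable {ψ : Fin m → ℝ → ℂ} {Λ : ℝ}

theorem cylindrical_flow (ζ : Substitution m) (ψ : Fin m → ℝ → ℂ) (t : ℝ) (p : ζ.Suspension s) :
    ζ.cylindrical s ψ (ζ.flow s hs t p) = orbitFun hs ψ p.1.1.1 (p.1.2 + t) := by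
  simp only [cylindrical, flow, shift, zero_add, orbitFun]

theorem measurable_orbitFun (hψ : ∀ a, Measurable (ψ a)) :
    Measurable fun z : (ℤ → Fin m) × ℝ => orbitFun hs ψ z.1 z.2 := by
  have hprofile : Measurable fun w : Fin m × ℝ => ψ w.1 w.2 :=
    measurable_from_prod_countable_right hψ
  have htile : Measurable fun w : ℤ × ((ℤ → Fin m) × ℝ) =>
      ψ (w.2.1 w.1) (w.2.2 - roofSum s w.2.1 w.1) :=
    measurable_from_prod_countable_right fun n =>
      hprofile.comp (((measurable_pi_apply n).comp measurable_fst).prodMk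
        (measurable_snd.sub ((measurable_roofSum s n).comp measurable_fst)))
  exact htile.comp ((measurable_tileIndex hs).prodMk measurable_id)

theorem measurable_cylindrical (ζ : Substitution m) (hψ : ∀ a, Measurable (ψ a)) :
    Measurable (ζ.cylindrical s ψ) := by
  have hprofile : Measurable fun w : Fin m × ℝ => ψ w.1 w.2 :=
    measurable_from_prod_countable_right hψ
  exact hprofile.comp (((measurable_letter 0).comp
    (measurable_fst.comp measurable_subtype_coe)).prodMk
      (measurable_snd.comp measurable_subtype_coe))

theorem measurable_cylindrical_flow (ζ : Substitution m) (hψ : ∀ a, Measurable (ψ a)) :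
    Measurable fun z : ℝ × ζ.Suspension s => ζ.cylindrical s ψ (ζ.flow s hs z.1 z.2) := by
  simp only [cylindrical_flow]
  have hpoint : Measurable fun z : ℝ × ζ.Suspension s => z.2.1 :=
    measurable_subtype_coe.comp measurable_snd
  exact (measurable_orbitFun hs hψ).comp
    ((measurable_subtype_coe.comp (measurable_fst.comp hpoint)).prodMk
      ((measurable_snd.comp hpoint).add measurable_fst))

/-! ### Twisted integrals along orbits -/

theorem norm_integral_fourierChar_mul_orbitFun_le (hb : ∀ a r, ‖ψ a r‖ ≤ Λ) (x : ℤ → Fin m)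
    (ω a b : ℝ) : ‖∫ u in a..b, (𝐞 (ω * u) : ℂ) * orbitFun hs ψ x u‖ ≤ Λ * |b - a| :=
  intervalIntegral.norm_integral_le_of_norm_le_const fun u _ => by
    rw [norm_mul, Circle.norm_coe, one_mul]
    exact hb _ _

theorem intervalIntegrable_fourierChar_mul_orbitFun (hψ : ∀ a, Measurable (ψ a))
    (hb : ∀ a r, ‖ψ a r‖ ≤ Λ) (x : ℤ → Fin m) (ω a b : ℝ) :
    IntervalIntegrable (fun u => (𝐞 (ω * u) : ℂ) * orbitFun hs ψ x u) volume a b := by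
  have hmeas : Measurable fun u => (𝐞 (ω * u) : ℂ) * orbitFun hs ψ x u :=
    (continuous_subtype_val.comp
      (Real.continuous_fourierChar.comp (continuous_const_mul ω))).measurable.mul
        ((measurable_orbitFun hs hψ).comp measurable_prodMk_left)
  refine intervalIntegrable_iff.2 (Measure.integrableOn_of_bounded (M := Λ) (by simp [Set.uIoc])
    hmeas.aestronglyMeasurable (.of_forall fun u => ?_))
  rw [norm_mul, Circle.norm_coe, one_mul]
  exact hb _ _

theorem integral_tile (x : ℤ → Fin m) (ω : ℝ) (n : ℤ) :
    ∫ u in roofSum s x n..roofSum s x (n + 1), (𝐞 (ω * u) : ℂ) * orbitFun hs ψ x u =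
      𝐞 (ω * roofSum s x n) * intervalFourier (ψ (x n)) (s (x n)) ω := by
  have hle := (strictMono_roofSum hs x).monotone (Int.lt_succ n).le
  have hprofile : ∫ u in roofSum s x n..roofSum s x (n + 1), (𝐞 (ω * u) : ℂ) * orbitFun hs ψ x u =
      ∫ u in roofSum s x n..roofSum s x (n + 1),
        (𝐞 (ω * u) : ℂ) * ψ (x n) (u - roofSum s x n) := by
    rw [intervalIntegral.integral_of_le hle, intervalIntegral.integral_of_le hle,
      integral_Ioc_eq_integral_Ioo, integral_Ioc_eq_integral_Ioo]
    refine setIntegral_congr_fun measurableSet_Ioo fun u hu => ?_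
    simp only [orbitFun, tileIndex_eq hs hu.1.le hu.2]
  have hshift := intervalIntegral.integral_comp_add_right (a := 0) (b := s (x n))
    (fun u => (𝐞 (ω * u) : ℂ) * ψ (x n) (u - roofSum s x n)) (roofSum s x n)
  rw [zero_add, add_comm (s (x n)), ← roofSum_add_one] at hshift
  rw [hprofile, ← hshift, intervalFourier, ← intervalIntegral.integral_const_mul]
  refine intervalIntegral.integral_congr fun r _ => ?_
  simp only [add_sub_cancel_right, mul_add, AddChar.map_add_eq_mul, Circle.coe_mul]
  ring

theorem integral_tiles (hψ : ∀ a, Measurable (ψ a)) (hb : ∀ a r, ‖ψ a r‖ ≤ Λ)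
    (x : ℤ → Fin m) (ω : ℝ) (N : ℕ) :
    ∫ u in (0 : ℝ)..roofSum s x N, (𝐞 (ω * u) : ℂ) * orbitFun hs ψ x u =
      twistedSum s ω (fun a => intervalFourier (ψ a) (s a) ω) (block x 0 N) := by
  have hint := intervalIntegrable_fourierChar_mul_orbitFun hs hψ hb x ω
  induction N with
  | zero => simp [block, twistedSum, roofSum_zero]
  | succ N ih =>
    rw [block_succ, twistedSum_append, ← ih, wordLength_block, Nat.cast_succ,
      ← intervalIntegral.integral_add_adjacent_intervals (hint 0 (roofSum s x N)) (hint _ _),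
      integral_tile]
    simp [twistedSum]

theorem fourierChar_mul_integral_cylindrical_flow (ζ : Substitution m) (p : ζ.Suspension s)
    (ω R : ℝ) :
    (𝐞 (ω * p.1.2) : ℂ) *
        ∫ t in (0 : ℝ)..R, (𝐞 (ω * t) : ℂ) * ζ.cylindrical s ψ (ζ.flow s hs t p) =
      ∫ u in p.1.2..p.1.2 + R, (𝐞 (ω * u) : ℂ) * orbitFun hs ψ p.1.1.1 u := by
  have hshift := intervalIntegral.integral_comp_add_left (a := 0) (b := R)
    (fun u => (𝐞 (ω * u) : ℂ) * orbitFun hs ψ p.1.1.1 u) p.1.2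
  rw [add_zero] at hshift
  rw [← hshift, ← intervalIntegral.integral_const_mul]
  simp only [cylindrical_flow, mul_add, AddChar.map_add_eq_mul, Circle.coe_mul, mul_assoc]

theorem exists_norm_twisted_integral_le (ζ : Substitution m) (hs1 : ∀ a, s a ≤ 1) {σ : ℝ}
    (hσ0 : 0 < σ) (hσ : ∀ a, σ ≤ s a) (hψ : ∀ a, Measurable (ψ a)) (hb : ∀ a r, ‖ψ a r‖ ≤ Λ)
    (p : ζ.Suspension s) (ω : ℝ) {R : ℝ} (hR : 0 ≤ R) :
    ∃ N : ℕ, N ≤ (R + 1) / σ ∧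
      ‖∫ t in (0 : ℝ)..R, (𝐞 (ω * t) : ℂ) * ζ.cylindrical s ψ (ζ.flow s hs t p)‖ ≤
        ‖twistedSum s ω (fun a => intervalFourier (ψ a) (s a) ω) (block p.1.1.1 0 N)‖ +
          2 * Λ := by
  obtain ⟨⟨⟨x, hx⟩, r⟩, hr0, hr⟩ := p
  have hr1 : r ≤ 1 := hr.le.trans (hs1 _)
  have hΛ : 0 ≤ Λ := (norm_nonneg _).trans (hb (x 0) 0)
  obtain ⟨N, hN⟩ := Int.eq_ofNat_of_zero_le (tileIndex_nonneg hs x (add_nonneg hr0 hR))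
  obtain ⟨hle, hlt⟩ := tileIndex_spec hs x (r + R)
  rw [hN] at hle hlt
  rw [roofSum_add_one] at hlt
  refine ⟨N, ?_, ?_⟩
  · rw [le_div_iff₀ hσ0]
    linarith [natCast_mul_le_roofSum hσ x N]
  have hint := intervalIntegrable_fourierChar_mul_orbitFun hs hψ hb x ω
  have hbound := norm_integral_fourierChar_mul_orbitFun_le hs hb x ω
  have hstart := (hbound 0 r).trans
    (mul_le_of_le_one_right hΛ (abs_le.2 ⟨by linarith, by linarith⟩))
  have hend := (hbound (roofSum s x N) (r + R)).trans
    (mul_le_of_le_one_right hΛ (abs_le.2 ⟨by linarith, by linarith [hs1 (x N)]⟩))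
  rw [← one_mul ‖∫ t in (0 : ℝ)..R, _‖, ← Circle.norm_coe (𝐞 (ω * r)), ← norm_mul,
    fourierChar_mul_integral_cylindrical_flow hs ζ ⟨⟨⟨x, hx⟩, r⟩, hr0, hr⟩,
    ← intervalIntegral.integral_add_adjacent_intervals (hint r (roofSum s x N)) (hint _ (r + R)),
    ← intervalIntegral.integral_interval_sub_left (hint 0 _) (hint 0 r),
    integral_tiles hs hψ hb x ω N]
  refine (norm_add_le_of_le (norm_sub_le_of_le le_rfl hstart) hend).trans_eq ?_
  ring

end Tiles

end Substitution

/-! ### Lipschitz profiles -/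

section LipschitzProfiles

variable {ℓ : ℝ} {φ : ℝ → ℂ} {K : NNReal}

theorem bddAbove_range_slope_of_lipschitzOnWith (h : LipschitzOnWith K φ (Set.Icc 0 ℓ)) :
    BddAbove (Set.range fun p : Set.Icc (0 : ℝ) ℓ × Set.Icc (0 : ℝ) ℓ =>
      ‖φ p.1 - φ p.2‖ / |(p.1 : ℝ) - p.2|) := by
  refine ⟨K, ?_⟩
  rintro _ ⟨p, rfl⟩
  refine div_le_of_le_mul₀ (abs_nonneg _) K.2 ?_
  have hdist := h.dist_le_mul p.1 p.1.2 p.2 p.2.2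
  rwa [dist_eq_norm, Real.dist_eq] at hdist

theorem norm_le_lipNorm (h : LipschitzOnWith K φ (Set.Icc 0 ℓ)) {t : ℝ} (ht : t ∈ Set.Icc 0 ℓ) :
    ‖φ t‖ ≤ lipNorm ℓ φ := by
  have hbdd : BddAbove (Set.range fun t : Set.Icc (0 : ℝ) ℓ => ‖φ t‖) :=
    (isCompact_range (continuousOn_iff_continuous_domRestrict.1 h.continuousOn.norm)).bddAbove
  exact (le_ciSup hbdd ⟨t, ht⟩).trans
    (le_add_of_nonneg_right (Real.iSup_nonneg fun p => by positivity))

theorem norm_sub_le_lipNorm_mul (h : LipschitzOnWith K φ (Set.Icc 0 ℓ)) {t t' : ℝ}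
    (ht : t ∈ Set.Icc 0 ℓ) (ht' : t' ∈ Set.Icc 0 ℓ) :
    ‖φ t - φ t'‖ ≤ lipNorm ℓ φ * |t - t'| := by
  rcases eq_or_ne t t' with rfl | hne
  · simp
  rw [← div_le_iff₀ (abs_pos.2 (sub_ne_zero.2 hne))]
  exact (le_ciSup (bddAbove_range_slope_of_lipschitzOnWith h) (⟨t, ht⟩, ⟨t', ht'⟩)).trans
    (le_add_of_nonneg_left (Real.iSup_nonneg fun _ => norm_nonneg _))

theorem norm_iccExtend_domRestrict_le (hℓ : 0 ≤ ℓ) (h : LipschitzOnWith K φ (Set.Icc 0 ℓ))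
    (r : ℝ) :
    ‖Set.IccExtend hℓ ((Set.Icc 0 ℓ).domRestrict φ) r‖ ≤ lipNorm ℓ φ :=
  norm_le_lipNorm h (Set.projIcc 0 ℓ hℓ r).2

theorem norm_iccExtend_domRestrict_sub_le (hℓ : 0 ≤ ℓ) (h : LipschitzOnWith K φ (Set.Icc 0 ℓ))
    (r r' : ℝ) :
    ‖Set.IccExtend hℓ ((Set.Icc 0 ℓ).domRestrict φ) r -
      Set.IccExtend hℓ ((Set.Icc 0 ℓ).domRestrict φ) r'‖ ≤ lipNorm ℓ φ * |r - r'| := by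
  have hnonneg : 0 ≤ lipNorm ℓ φ := (norm_nonneg _).trans (norm_iccExtend_domRestrict_le hℓ h r)
  have hproj := (LipschitzWith.projIcc hℓ).dist_le_mul r r'
  rw [Subtype.dist_eq, Real.dist_eq, Real.dist_eq, NNReal.coe_one, one_mul] at hproj
  exact (norm_sub_le_lipNorm_mul h (Set.projIcc 0 ℓ hℓ r).2 (Set.projIcc 0 ℓ hℓ r').2).trans
    (mul_le_mul_of_nonneg_left hproj hnonneg)

theorem lipNorm_le_cylLipNorm {m : ℕ} (s : Fin m → ℝ) (ψ : Fin m → ℝ → ℂ) (a : Fin m) :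
    lipNorm (s a) (ψ a) ≤ cylLipNorm s ψ :=
  le_ciSup (f := fun a => lipNorm (s a) (ψ a)) (Set.finite_range _).bddAbove a

theorem cylindrical_iccExtend {m : ℕ} (ζ : Substitution m) {s : Fin m → ℝ} (hs : ∀ a, 0 ≤ s a)
    (ψ : Fin m → ℝ → ℂ) :
    ζ.cylindrical s (fun a => Set.IccExtend (hs a) ((Set.Icc 0 (s a)).domRestrict (ψ a))) =
      ζ.cylindrical s ψ := by
  funext p
  exact Set.IccExtend_of_mem (hs _) _ ⟨p.2.1, p.2.2.le⟩

end LipschitzProfiles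

/-! ### The measure on the suspension -/

namespace Substitution

section SuspensionMeasure

variable {m : ℕ} (ζ : Substitution m) (s : Fin m → ℝ) (μ : Measure ζ.Space)

theorem measurableSet_suspension :
    MeasurableSet {p : ζ.Space × ℝ | 0 ≤ p.2 ∧ p.2 < s (p.1.1 0)} :=
  (measurableSet_le measurable_const measurable_snd).inter (measurableSet_lt measurable_snd
    ((measurable_of_finite s).comp ((measurable_letter 0).comp measurable_fst)))

theorem suspensionMeasure_univ_le_one : ζ.suspensionMeasure s μ Set.univ ≤ 1 :=
  ENNReal.inv_mul_le_one _

theorem prod_volume_suspension_lt_top [IsFiniteMeasure μ] :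
    (μ.prod (volume : Measure ℝ)) {p : ζ.Space × ℝ | 0 ≤ p.2 ∧ p.2 < s (p.1.1 0)} < ⊤ := by
  obtain ⟨b, hb⟩ := (Set.finite_range s).bddAbove
  refine (measure_mono (t := Set.univ ×ˢ Set.Icc 0 b) ?_).trans_lt ?_
  · rintro z ⟨hz0, hz⟩
    exact ⟨trivial, hz0, hz.le.trans (hb ⟨_, rfl⟩)⟩
  · rw [Measure.prod_prod]
    exact ENNReal.mul_lt_top (measure_lt_top _ _) measure_Icc_lt_top

variable {s μ}

theorem integral_cylindrical_comap [IsFiniteMeasure μ] (hs : ∀ a, 0 ≤ s a) {ψ : Fin m → ℝ → ℂ}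
    {Λ : ℝ} (hψ : ∀ a, Measurable (ψ a)) (hb : ∀ a r, ‖ψ a r‖ ≤ Λ) :
    ∫ p : ζ.Suspension s, ζ.cylindrical s ψ p
        ∂((μ.prod (volume : Measure ℝ)).comap Subtype.val) =
      ∫ x : ζ.Space, (∫ r in (0 : ℝ)..s (x.1 0), ψ (x.1 0) r) ∂μ := by
  set D : Set (ζ.Space × ℝ) := {p | 0 ≤ p.2 ∧ p.2 < s (p.1.1 0)}
  have hDm : MeasurableSet D := ζ.measurableSet_suspension s
  set F : ζ.Space × ℝ → ℂ := fun z => ψ (z.1.1 0) z.2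
  have hFm : Measurable F := by
    have hprofile : Measurable fun w : Fin m × ℝ => ψ w.1 w.2 :=
      measurable_from_prod_countable_right hψ
    exact hprofile.comp (((measurable_letter 0).comp measurable_fst).prodMk measurable_snd)
  have hFi : Integrable (D.indicator F) (μ.prod (volume : Measure ℝ)) :=
    (integrable_indicator_iff hDm).2 (Measure.integrableOn_of_bounded (M := Λ)
      (ζ.prod_volume_suspension_lt_top s μ).ne hFm.aestronglyMeasurable
      (.of_forall fun z => hb _ _))
  have hfibre : ∀ x : ζ.Space, (fun r => D.indicator F (x, r)) =
      (Set.Ico 0 (s (x.1 0))).indicator (ψ (x.1 0)) := fun x => rfl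
  calc ∫ p : ζ.Suspension s, F p ∂((μ.prod (volume : Measure ℝ)).comap Subtype.val)
      = ∫ z, D.indicator F z ∂(μ.prod (volume : Measure ℝ)) :=
        (integral_subtype_comap hDm F).trans (integral_indicator hDm).symm
    _ = ∫ x : ζ.Space, (∫ r in (0 : ℝ)..s (x.1 0), ψ (x.1 0) r) ∂μ := by
        rw [integral_prod _ hFi]
        refine integral_congr_ae (.of_forall fun x => ?_)
        simp only [hfibre]
        rw [integral_indicator measurableSet_Ico, integral_Ico_eq_integral_Ioc,
          ← intervalIntegral.integral_of_le (hs _)]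

theorem integral_profile_eq_zero [IsFiniteMeasure μ] (hs : ∀ a, 0 ≤ s a) {ψ : Fin m → ℝ → ℂ}
    {Λ : ℝ} (hψ : ∀ a, Measurable (ψ a)) (hb : ∀ a r, ‖ψ a r‖ ≤ Λ)
    (hmean : ∫ p, ζ.cylindrical s ψ p ∂(ζ.suspensionMeasure s μ) = 0) :
    ∫ x : ζ.Space, (∫ r in (0 : ℝ)..s (x.1 0), ψ (x.1 0) r) ∂μ = 0 := by
  rw [← ζ.integral_cylindrical_comap hs hψ hb]
  have hfinite : IsFiniteMeasure ((μ.prod (volume : Measure ℝ)).comap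
      (Subtype.val : ζ.Suspension s → ζ.Space × ℝ)) := by
    refine ⟨(comap_subtype_coe_apply (ζ.measurableSet_suspension s) _ _).trans_lt ?_⟩
    rw [Set.image_univ, Subtype.range_coe]
    exact ζ.prod_volume_suspension_lt_top s μ
  rw [← measure_smul_average]
  exact smul_eq_zero_of_right _ hmean

end SuspensionMeasure

end Substitution

/-! ### Power saving for twisted ergodic integrals -/

theorem card_le_natDegree_of_injective_of_isRoot {K ι : Type*} [CommRing K] [IsDomain K]
    [Fintype ι] {P : Polynomial K} (hP : P ≠ 0) {θ : ι → K} (hinj : Function.Injective θ)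
    (hroot : ∀ j, P.IsRoot (θ j)) : Fintype.card ι ≤ P.natDegree := by
  rw [← Finset.card_univ, ← Finset.card_map ⟨θ, hinj⟩]
  refine Polynomial.card_le_degree_of_subset_roots fun z hz => ?_
  obtain ⟨j, -, rfl⟩ := Finset.mem_map.1 hz
  exact (Polynomial.mem_roots hP).2 (hroot j)

/-- Balances the scale `A ^ n` against the gain `exp (-κ n)`: the choice is `A ^ n ≈ √R`. -/
theorem exists_scale_pow_le_rpow {A κ : ℝ} (hA : 1 < A) (hκ : 0 < κ) :
    ∃ α : ℝ, 0 < α ∧ α ≤ 1 / 2 ∧ ∀ R : ℝ, 1 ≤ R → ∃ n : ℕ, A ^ n ≤ R ^ (1 - α) ∧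
      Real.exp (-(κ * n)) * R ≤ Real.exp κ * R ^ (1 - α) := by
  have hlogA : 0 < Real.log A := Real.log_pos hA
  set α : ℝ := min (1 / 2) (κ / (2 * Real.log A))
  refine ⟨α, lt_min (by norm_num) (by positivity), min_le_left _ _, fun R hR => ?_⟩
  have hR0 : 0 < R := zero_lt_one.trans_le hR
  have hlogR : 0 ≤ Real.log R := Real.log_nonneg hR
  have hle : (⌊Real.log R / (2 * Real.log A)⌋₊ : ℝ) ≤ Real.log R / (2 * Real.log A) :=
    Nat.floor_le (by positivity)
  have hlt := (Nat.sub_one_lt_floor (Real.log R / (2 * Real.log A))).le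
  refine ⟨⌊Real.log R / (2 * Real.log A)⌋₊, ?_, ?_⟩
  · rw [← Real.exp_log (pow_pos (zero_lt_one.trans hA) _), Real.log_pow,
      Real.rpow_def_of_pos hR0, Real.exp_le_exp]
    rw [le_div_iff₀ (by positivity)] at hle
    nlinarith [min_le_left (1 / 2) (κ / (2 * Real.log A))]
  · nth_rewrite 2 [← Real.exp_log hR0]
    rw [Real.rpow_def_of_pos hR0, ← Real.exp_add, ← Real.exp_add, Real.exp_le_exp]
    have hα_log : α * Real.log R ≤ κ * (Real.log R / (2 * Real.log A)) := by
      rw [← mul_comm_div]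
      gcongr
      exact min_le_right _ _
    linarith [mul_le_mul_of_nonneg_left hlt hκ.le]

namespace Substitution

open scoped FourierTransform

variable {m : ℕ} {ζ : Substitution m}

theorem population_cons_ne_zero (a : Fin m) (w : List (Fin m)) : population (a :: w) ≠ 0 :=
  fun h => List.count_eq_zero.1 (Int.natCast_eq_zero.1 (congrFun h a)) List.mem_cons_self

theorem wordLength_eq_sum_population (s : Fin m → ℝ) (w : List (Fin m)) :
    wordLength s w = ∑ i, s i * population w i := by
  simp only [wordLength, population]
  rw [Finset.sum_list_map_count, Finset.sum_subset (Finset.subset_univ w.toFinset)]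
  · exact Finset.sum_congr rfl fun i _ => by rw [nsmul_eq_mul, mul_comm, Int.cast_natCast]
  · intro i _ hi
    rw [List.count_eq_zero.2 (mt List.mem_toFinset.2 hi), zero_smul]

theorem wordLength_onWord_iterate (ζ : Substitution m) (s : Fin m → ℝ) (w : List (Fin m)) (k : ℕ) :
    wordLength s (ζ.onWord^[k] w) = orbitDot ζ.matrix (population w) s k := by
  rw [wordLength_eq_sum_population, population_onWord_iterate, orbitDot]

section TwistedIntegral

variable {s : Fin m → ℝ} (hs : ∀ a, 0 < s a) {ψ : Fin m → ℝ → ℂ} {Λ : ℝ}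

theorem norm_twisted_integral_le_mul (hb : ∀ a r, ‖ψ a r‖ ≤ Λ) (p : ζ.Suspension s) (ω : ℝ) {R : ℝ}
    (hR : 0 ≤ R) :
    ‖∫ t in (0 : ℝ)..R, (𝐞 (ω * t) : ℂ) * ζ.cylindrical s ψ (ζ.flow s hs t p)‖ ≤ Λ * R := by
  have h := intervalIntegral.norm_integral_le_of_norm_le_const (a := 0) (b := R) (C := Λ)
    (f := fun t => (𝐞 (ω * t) : ℂ) * ζ.cylindrical s ψ (ζ.flow s hs t p)) fun t _ => by
      rw [norm_mul, Circle.norm_coe, one_mul]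
      exact hb _ _
  rwa [sub_zero, abs_of_nonneg hR] at h

theorem BlockBound.norm_twisted_integral_le {ω ρ : ℝ} {k : ℕ}
    (h : ζ.BlockBound s ω (fun a => intervalFourier (ψ a) (s a) ω) k ρ) (hρ : 0 ≤ ρ)
    (hs1 : ∀ a, s a ≤ 1) {σ : ℝ} (hσ0 : 0 < σ) (hσ : ∀ a, σ ≤ s a)
    (hψ : ∀ a, Measurable (ψ a)) (hb : ∀ a r, ‖ψ a r‖ ≤ Λ) (p : ζ.Suspension s) {R : ℝ}
    (hR : 0 ≤ R) :
    ‖∫ t in (0 : ℝ)..R, (𝐞 (ω * t) : ℂ) * ζ.cylindrical s ψ (ζ.flow s hs t p)‖ ≤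
      ρ * ((R + 1) / σ) + 2 * Λ * ζ.maxLength ^ k + 2 * Λ := by
  have hΛ : 0 ≤ Λ := (norm_nonneg _).trans (hb (p.1.1.1 0) 0)
  have htransform : ∀ a, ‖intervalFourier (ψ a) (s a) ω‖ ≤ Λ := fun a =>
    (norm_intervalFourier_le (hb a) ω).trans
      (mul_le_of_le_one_right hΛ ((abs_of_pos (hs a)).trans_le (hs1 a)))
  obtain ⟨N, hN, hint⟩ := exists_norm_twisted_integral_le hs ζ hs1 hσ0 hσ hψ hb p ω hR
  obtain ⟨K, a, hK⟩ := exists_block_isInfix p.1.1 N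
  have hword := h.norm_le_of_isInfix hρ hΛ htransform hK
  rw [length_block] at hword
  linarith [mul_le_mul_of_nonneg_left hN hρ]

theorem norm_twisted_integral_le_rpow {α κ C σ ω : ℝ} {q : ℕ} (hα0 : 0 ≤ α) (hα1 : α ≤ 1)
    (hscale : ∀ R : ℝ, 1 ≤ R → ∃ n : ℕ, (ζ.maxLength : ℝ) ^ n ≤ R ^ (1 - α) ∧
      Real.exp (-(κ * n)) * R ≤ Real.exp κ * R ^ (1 - α)) (hC : 0 ≤ C)
    (hblock : ∀ n : ℕ, ∃ k ≤ n + q, ζ.BlockBound s ω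
      (fun a => intervalFourier (ψ a) (s a) ω) k (C * Λ * Real.exp (-(κ * n))))
    (hs1 : ∀ a, s a ≤ 1) (hσ0 : 0 < σ) (hσ : ∀ a, σ ≤ s a) (hψ : ∀ a, Measurable (ψ a))
    (hb : ∀ a r, ‖ψ a r‖ ≤ Λ) (p : ζ.Suspension s) {R : ℝ} (hR : 0 < R) :
    ‖∫ t in (0 : ℝ)..R, (𝐞 (ω * t) : ℂ) * ζ.cylindrical s ψ (ζ.flow s hs t p)‖ ≤
      (C * Real.exp κ * (2 / σ) + 2 * ζ.maxLength ^ q + 2) * Λ * R ^ (1 - α) := by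
  have hΛ : 0 ≤ Λ := (norm_nonneg _).trans (hb (p.1.1.1 0) 0)
  set A : ℝ := (ζ.maxLength : ℝ)
  have hA : 1 ≤ A := ζ.one_le_maxLength
  rcases lt_or_ge R 1 with hR1 | hR1
  · have hconst : 1 ≤ C * Real.exp κ * (2 / σ) + 2 * A ^ q + 2 := by
      have : 0 ≤ C * Real.exp κ * (2 / σ) + 2 * A ^ q := by positivity
      linarith
    calc _ ≤ Λ * R := norm_twisted_integral_le_mul hs hb p ω hR.le
      _ ≤ Λ * R ^ (1 - α) := by
        gcongr
        exact Real.self_le_rpow_of_le_one hR.le hR1.le (by linarith)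
      _ ≤ _ := by
        rw [mul_assoc]
        exact le_mul_of_one_le_left (by positivity) hconst
  obtain ⟨n, hAn, hexp⟩ := hscale R hR1
  obtain ⟨k, hk, hkb⟩ := hblock n
  have hAk : A ^ k ≤ A ^ q * R ^ (1 - α) := by
    calc A ^ k ≤ A ^ (n + q) := pow_le_pow_right₀ hA hk
      _ = A ^ q * A ^ n := by rw [pow_add, mul_comm]
      _ ≤ A ^ q * R ^ (1 - α) := by gcongr
  have hone : 1 ≤ R ^ (1 - α) := Real.one_le_rpow hR1 (by linarith)
  have hRσ : (R + 1) / σ ≤ 2 / σ * R := by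
    rw [div_mul_eq_mul_div]
    gcongr
    linarith
  calc _ ≤ C * Λ * Real.exp (-(κ * n)) * ((R + 1) / σ) + 2 * Λ * A ^ k + 2 * Λ :=
        hkb.norm_twisted_integral_le hs (by positivity) hs1 hσ0 hσ hψ hb p hR.le
    _ ≤ C * Λ * Real.exp (-(κ * n)) * (2 / σ * R) + 2 * Λ * (A ^ q * R ^ (1 - α)) +
        2 * Λ * R ^ (1 - α) := by
        refine add_le_add ?_ (le_mul_of_one_le_right (by positivity) hone)
        gcongr
    _ = C * Λ * (2 / σ) * (Real.exp (-(κ * n)) * R) + 2 * Λ * (A ^ q * R ^ (1 - α)) +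
        2 * Λ * R ^ (1 - α) := by ring
    _ ≤ C * Λ * (2 / σ) * (Real.exp κ * R ^ (1 - α)) + 2 * Λ * (A ^ q * R ^ (1 - α)) +
        2 * Λ * R ^ (1 - α) := by gcongr
    _ = _ := by ring

end TwistedIntegral

/-- The twisted ergodic integrals along the suspension flow with roof vector `s` have a power
saving with exponent `α`, uniformly in the starting point and the frequency: this is the estimate
that makes all spectral measures of the flow uniformly Hölder. -/
def TwistedPowerSaving (ζ : Substitution m) (s : Fin m → ℝ) (hs : ∀ a, 0 < s a) (α C : ℝ) : Prop :=
  ∀ (μ : Measure ζ.Space) [IsProbabilityMeasure μ], MeasurePreserving (ζ.shift 1) μ μ →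
  ∀ (ψ : Fin m → ℝ → ℂ) (Λ : ℝ), (∀ a r, ‖ψ a r‖ ≤ Λ) →
    (∀ a r r', ‖ψ a r - ψ a r'‖ ≤ Λ * |r - r'|) →
    ∫ p, ζ.cylindrical s ψ p ∂(ζ.suspensionMeasure s μ) = 0 →
  ∀ (p : ζ.Suspension s) (ω R : ℝ), 0 < R →
    ‖∫ t in (0 : ℝ)..R, (𝐞 (ω * t) : ℂ) * ζ.cylindrical s ψ (ζ.flow s hs t p)‖ ≤
      C * Λ * R ^ (1 - α)

theorem le_one_of_mem_roofSimplex {s : Fin m → ℝ} (hs : s ∈ roofSimplex m) (a : Fin m) :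
    s a ≤ 1 := by
  rw [← hs.2]
  exact Finset.single_le_sum (f := s) (fun i _ => (hs.1 i).le) (Finset.mem_univ a)

theorem exists_twistedPowerSaving_of_erdosKahane {p q : ℕ} (hp0 : 0 < p) (hq0 : 0 < q)
    (hp : ∀ a b, a ∈ ζ.onWord^[p] [b]) {d : Fin m} {v : List (Fin m)}
    (hv : ∀ b, d :: v ++ [d] <:+: ζ.onWord^[q] [b]) {ε η : ℝ} (hε : 0 < ε) (hη : 0 < η) :
    ∃ α > 0, ∀ (s : Fin m → ℝ) (hs : s ∈ roofSimplex m),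
      ErdosKahane (orbitDot ζ.matrix (population (d :: v)) s) ε η →
      ∃ C > 0, ζ.TwistedPowerSaving s hs.1 α C := by
  obtain ⟨κ, hκ, hblock⟩ := exists_blockBound_exp hp0 hq0 hp hv hε hη
  have hA : (1 : ℝ) < ζ.maxLength := Nat.one_lt_cast.2 ζ.two_le_maxLength
  obtain ⟨α, hα, hα_half, hscale⟩ := exists_scale_pow_le_rpow hA hκ
  refine ⟨α, hα, fun s hs hEK => ?_⟩
  have : Nonempty (Fin m) := ⟨d⟩
  have hs1 : ∀ a, s a ≤ 1 := le_one_of_mem_roofSimplex hs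
  obtain ⟨C, hC, hbound⟩ := hblock s (fun a => (abs_of_pos (hs.1 a)).trans_le (hs1 a))
    (by simpa only [wordLength_onWord_iterate] using hEK)
  obtain ⟨b, hb_min⟩ := Finite.exists_min s
  have hσ := hs.1 b
  refine ⟨C * Real.exp κ * (2 / s b) + 2 * ζ.maxLength ^ q + 2, by positivity, ?_⟩
  intro μ _ hμ ψ Λ hb hlip hmean p ω R hR
  have hψ : ∀ a, Measurable (ψ a) := fun a => (LipschitzWith.of_dist_le' fun r r' => by
    rw [dist_eq_norm, Real.dist_eq]; exact hlip a r r').continuous.measurable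
  have htransform := lipschitzTransformBound_intervalFourier (fun a => (hs.1 a).le) hs1 hb hlip
  have hmean_letter : ∫ x : ζ.Space, intervalFourier (ψ (x.1 0)) (s (x.1 0)) 0 ∂μ = 0 := by
    simp only [intervalFourier_zero_right]
    exact integral_profile_eq_zero ζ (fun a => (hs.1 a).le) hψ hb hmean
  exact norm_twisted_integral_le_rpow hs.1 hα.le (by linarith) hscale hC.le
    (fun n => hbound _ Λ htransform (blockBound_of_integral_eq_zero hμ htransform.nonneg
      (htransform.norm_le 0) hmean_letter hp) n ω) hs1 hσ hb_min hψ hb p hR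

theorem Primitive.exists_ae_twistedPowerSaving (hprim : ζ.Primitive)
    (hirr : Irreducible (ζ.matrix.map (Int.cast : ℤ → ℚ)).charpoly) (hθ : 1 < ζ.absTheta₂) :
    ∃ α > 0, ∀ᵐ s ∂(Measure.hausdorffMeasure ((m : ℝ) - 1) : Measure (Fin m → ℝ)),
      ∀ hs : s ∈ roofSimplex m, ∃ C > 0, ζ.TwistedPowerSaving s hs.1 α C := by
  obtain ⟨θ, hinj, hroot, hnorm⟩ := exists_expanding_eigenvalues hirr hθ
  have hm : 2 ≤ m := by
    simpa only [Fintype.card_fin, Matrix.charpoly_natDegree_eq_dim] using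
      card_le_natDegree_of_injective_of_isRoot (Matrix.charpoly_monic _).ne_zero hinj hroot
  obtain ⟨p, hp0, hp⟩ := hprim.exists_forall_mem
  obtain ⟨q, d, v, hq0, hv⟩ := hprim.exists_return_word hm
  obtain ⟨ε, hε, η, hη, hae⟩ :=
    ae_roofSimplex_erdosKahane hirr (population_cons_ne_zero d v) hinj hroot hnorm
  obtain ⟨α, hα, hsaving⟩ := exists_twistedPowerSaving_of_erdosKahane hp0 hq0 hp hv hε hη
  exact ⟨α, hα, hae.mono fun s hgood hs => hsaving s hs (hgood hs)⟩

end Substitution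

/-! ### Correlations of tensor products -/

theorem integral_norm_sq_eq_eLpNorm_sq {Y : Type*} [MeasurableSpace Y] {ν : Measure Y} {g : Y → ℂ}
    (hg : MemLp g 2 ν) : ∫ y, ‖g y‖ ^ 2 ∂ν = (eLpNorm g 2 ν).toReal ^ 2 := by
  have : 0 ≤ ∫ y, ‖g y‖ ^ 2 ∂ν := integral_nonneg fun y => by positivity
  rw [hg.eLpNorm_eq_integral_rpow_norm (by norm_num) (by norm_num),
    ENNReal.toReal_ofReal (by positivity), ← Real.rpow_natCast, ← Real.rpow_mul (by positivity)]
  simp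

section TensorProduct

open scoped FourierTransform

variable {X Y : Type*} [MeasurableSpace X] [MeasurableSpace Y] [AddAction ℝ Y]
  [MeasurableVAdd₂ ℝ Y] {ρ : Measure X} {ν : Measure Y}

theorem measurable_autocorrelation [SFinite ν] {g : Y → ℂ} (hg : Measurable g) :
    Measurable fun t : ℝ => ∫ y, g (t +ᵥ y) * (starRingEnd ℂ) (g y) ∂ν := by
  have hkernel : Measurable fun z : ℝ × Y => g (z.1 +ᵥ z.2) * (starRingEnd ℂ) (g z.2) :=
    (hg.comp measurable_vadd).mul
      (Complex.continuous_conj.measurable.comp (hg.comp measurable_snd))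
  exact hkernel.stronglyMeasurable.integral_prod_right'.measurable

theorem intervalIntegral_integral_mul_swap [IsFiniteMeasure ρ] {R : ℝ} (hR : 0 ≤ R)
    {F : ℝ → X → ℂ} {h : X → ℂ} {φ : ℝ → ℂ} (hF : Measurable fun z : ℝ × X => F z.1 z.2)
    (hh : Measurable h) (hφ : Measurable φ) {A B E : ℝ} (hFb : ∀ t x, ‖F t x‖ ≤ A)
    (hhb : ∀ x, ‖h x‖ ≤ B) (hφb : ∀ t, ‖φ t‖ ≤ E) :
    ∫ t in (0 : ℝ)..R, (∫ x, F t x * h x ∂ρ) * φ t =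
      ∫ x, h x * (∫ t in (0 : ℝ)..R, F t x * φ t) ∂ρ := by
  have hint : Integrable (fun z : ℝ × X => F z.1 z.2 * h z.2 * φ z.1)
      ((volume.restrict (Set.uIoc 0 R)).prod ρ) := by
    rw [Set.uIoc_of_le hR]
    refine .of_bound ((hF.mul (hh.comp measurable_snd)).mul
      (hφ.comp measurable_fst)).aestronglyMeasurable (A * B * E) (.of_forall fun z => ?_)
    rw [norm_mul, norm_mul]
    have hA : 0 ≤ A := (norm_nonneg _).trans (hFb z.1 z.2)
    have hB : 0 ≤ B := (norm_nonneg _).trans (hhb z.2)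
    gcongr
    exacts [hFb _ _, hhb _, hφb _]
  calc ∫ t in (0 : ℝ)..R, (∫ x, F t x * h x ∂ρ) * φ t
      = ∫ t in (0 : ℝ)..R, ∫ x, F t x * h x * φ t ∂ρ := by simp only [integral_mul_const]
    _ = ∫ x, (∫ t in (0 : ℝ)..R, F t x * h x * φ t) ∂ρ :=
        intervalIntegral_integral_swap hint
    _ = ∫ x, h x * (∫ t in (0 : ℝ)..R, F t x * φ t) ∂ρ := by
        simp only [← intervalIntegral.integral_const_mul]
        simp only [mul_left_comm, mul_assoc]

variable [VAddInvariantMeasure ℝ Y ν]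

theorem norm_autocorrelation_le {g : Y → ℂ} (hg2 : MemLp g 2 ν) (t : ℝ) :
    ‖∫ y, g (t +ᵥ y) * (starRingEnd ℂ) (g y) ∂ν‖ ≤ ∫ y, ‖g y‖ ^ 2 ∂ν := by
  have hi : Integrable (fun y => ‖g y‖ ^ 2) ν := hg2.norm.integrable_sq
  have hit : Integrable (fun y => ‖g (t +ᵥ y)‖ ^ 2) ν :=
    (measurePreserving_vadd t ν).integrable_comp_of_integrable hi
  calc ‖∫ y, g (t +ᵥ y) * (starRingEnd ℂ) (g y) ∂ν‖
      ≤ ∫ y, (‖g (t +ᵥ y)‖ ^ 2 / 2 + ‖g y‖ ^ 2 / 2) ∂ν := by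
        refine norm_integral_le_of_norm_le ((hit.div_const 2).add (hi.div_const 2))
          (.of_forall fun y => ?_)
        rw [norm_mul, RCLike.norm_conj]
        linarith [two_mul_le_add_sq ‖g (t +ᵥ y)‖ ‖g y‖]
    _ = ∫ y, ‖g y‖ ^ 2 ∂ν := by
        rw [integral_add (hit.div_const 2) (hi.div_const 2), integral_div, integral_div,
          integral_vadd_eq_self (fun y => ‖g y‖ ^ 2), add_halves]

theorem autocorrelation_congr_ae {g g' : Y → ℂ} (h : g =ᵐ[ν] g') (t : ℝ) :
    ∫ y, g (t +ᵥ y) * (starRingEnd ℂ) (g y) ∂ν = ∫ y, g' (t +ᵥ y) * (starRingEnd ℂ) (g' y) ∂ν := by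
  refine integral_congr_ae ?_
  filter_upwards [h, (measurePreserving_vadd t ν).quasiMeasurePreserving.ae_eq_comp h]
    with y hy hty
  simp only [Function.comp_apply] at hty
  rw [hy, hty]

variable [SFinite ν] [IsFiniteMeasure ρ] {R : ℝ} {F : ℝ → X → ℂ} {f : X → ℂ} {Λ M : ℝ} {g : Y → ℂ}

theorem norm_integral_mul_autocorrelation_le_of_measurable (hρ : ρ Set.univ ≤ 1) (hR : 0 < R)
    (hF : Measurable fun z : ℝ × X => F z.1 z.2) (hf : Measurable f) (hFb : ∀ t x, ‖F t x‖ ≤ Λ)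
    (hfb : ∀ x, ‖f x‖ ≤ Λ) (hΛ : 0 ≤ Λ) (hM0 : 0 < M)
    (hM : ∀ x, ∀ ω : ℝ, ‖∫ t in (0 : ℝ)..R, (𝐞 (ω * t) : ℂ) * F t x‖ ≤ M)
    (hg : Measurable g) (hg2 : MemLp g 2 ν) :
    ‖∫ t in (0 : ℝ)..R, (∫ x, F t x * (starRingEnd ℂ) (f x) ∂ρ) *
        ∫ y, g (t +ᵥ y) * (starRingEnd ℂ) (g y) ∂ν‖ ≤ 2 * Λ * M * ∫ y, ‖g y‖ ^ 2 ∂ν := by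
  have : 0 ≤ ∫ y, ‖g y‖ ^ 2 ∂ν := integral_nonneg fun y => by positivity
  rw [intervalIntegral_integral_mul_swap (h := fun x => (starRingEnd ℂ) (f x)) hR.le hF
    (Complex.continuous_conj.measurable.comp hf) (measurable_autocorrelation hg) hFb
    (fun x => (RCLike.norm_conj _).trans_le (hfb x))
    (norm_autocorrelation_le hg2)]
  have hpoint : ∀ x, ‖(starRingEnd ℂ) (f x) * ∫ t in (0 : ℝ)..R, F t x *
      ∫ y, g (t +ᵥ y) * (starRingEnd ℂ) (g y) ∂ν‖ ≤ 2 * Λ * M * ∫ y, ‖g y‖ ^ 2 ∂ν := fun x => by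
    have h := norm_integral_mul_autocorrelation_le hR (u := fun t => F t x)
      (hF.comp measurable_prodMk_right) (fun t => hFb t x) hM0 (hM x) hg hg2
    rw [norm_mul, RCLike.norm_conj]
    calc _ ≤ Λ * (2 * M * ∫ y, ‖g y‖ ^ 2 ∂ν) := mul_le_mul (hfb x) h (norm_nonneg _) hΛ
      _ = _ := by ring
  refine (norm_integral_le_of_norm_le_const (.of_forall hpoint)).trans
    (mul_le_of_le_one_right (by positivity) ?_)
  exact ENNReal.toReal_le_of_le_ofReal zero_le_one (by rwa [ENNReal.ofReal_one])

theorem norm_integral_tensorFun_autocorrelation_le (hρ : ρ Set.univ ≤ 1) (hR : 0 < R)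
    (hF : Measurable fun z : ℝ × X => F z.1 z.2) (hf : Measurable f) (hFb : ∀ t x, ‖F t x‖ ≤ Λ)
    (hfb : ∀ x, ‖f x‖ ≤ Λ) (hΛ : 0 ≤ Λ) (hM0 : 0 < M)
    (hM : ∀ x, ∀ ω : ℝ, ‖∫ t in (0 : ℝ)..R, (𝐞 (ω * t) : ℂ) * F t x‖ ≤ M)
    (hg2 : MemLp g 2 ν) :
    ‖∫ t in (0 : ℝ)..R, ∫ z : X × Y, tensorFun (F t) (fun y => g (t +ᵥ y)) z *
        (starRingEnd ℂ) (tensorFun f g z) ∂(ρ.prod ν)‖ ≤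
      2 * Λ * M * (eLpNorm g 2 ν).toReal ^ 2 := by
  obtain ⟨g', hg', hmk⟩ : ∃ g', Measurable g' ∧ g =ᵐ[ν] g' :=
    ⟨hg2.1.mk g, hg2.1.stronglyMeasurable_mk.measurable, hg2.1.ae_eq_mk⟩
  have hfactor : ∀ t : ℝ, ∫ z : X × Y, tensorFun (F t) (fun y => g (t +ᵥ y)) z *
      (starRingEnd ℂ) (tensorFun f g z) ∂(ρ.prod ν) =
      (∫ x, F t x * (starRingEnd ℂ) (f x) ∂ρ) *
        ∫ y, g' (t +ᵥ y) * (starRingEnd ℂ) (g' y) ∂ν := fun t => by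
    rw [← autocorrelation_congr_ae hmk, ← integral_prod_mul]
    simp only [tensorFun, map_mul, mul_mul_mul_comm]
  simp only [hfactor]
  rw [eLpNorm_congr_ae hmk, ← integral_norm_sq_eq_eLpNorm_sq (hg2.ae_eq hmk)]
  exact norm_integral_mul_autocorrelation_le_of_measurable hρ hR hF hf hFb hfb hΛ hM0 hM
    hg' (hg2.ae_eq hmk)

end TensorProduct

theorem Substitution.TwistedPowerSaving.norm_integral_tensorFun_flow_le {m : ℕ}
    {ζ : Substitution m} {s : Fin m → ℝ} {hs : ∀ a, 0 < s a} {α C : ℝ}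
    (h : ζ.TwistedPowerSaving s hs α C) (hC : 0 < C) {μ : Measure ζ.Space} [IsProbabilityMeasure μ]
    (hμ : MeasurePreserving (ζ.shift 1) μ μ) {ψ : Fin m → ℝ → ℂ}
    (hψ : ∀ a, ∃ K, LipschitzOnWith K (ψ a) (Set.Icc 0 (s a)))
    (hmean : ∫ p, ζ.cylindrical s ψ p ∂(ζ.suspensionMeasure s μ) = 0)
    {Y : Type*} [MeasurableSpace Y] [AddAction ℝ Y] [MeasurableVAdd₂ ℝ Y] {ν : Measure Y}
    [SFinite ν] [VAddInvariantMeasure ℝ Y ν] {g : Y → ℂ} (hg : MemLp g 2 ν) {R : ℝ} (hR : 0 < R) :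
    ‖∫ t in (0 : ℝ)..R, ∫ p : ζ.Suspension s × Y,
        tensorFun (ζ.cylindrical s ψ) g (ζ.flow s hs t p.1, t +ᵥ p.2) *
          (starRingEnd ℂ) (tensorFun (ζ.cylindrical s ψ) g p)
        ∂((ζ.suspensionMeasure s μ).prod ν)‖ ≤
      2 * C * (|cylLipNorm s ψ| + 1) ^ 2 * ((eLpNorm g 2 ν).toReal ^ 2 + 1) * R ^ (1 - α) := by
  have hρ := ζ.suspensionMeasure_univ_le_one s μ
  have : IsFiniteMeasure (ζ.suspensionMeasure s μ) := ⟨hρ.trans_lt ENNReal.one_lt_top⟩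
  set Λ := |cylLipNorm s ψ| + 1
  have hΛ : 0 < Λ := by positivity
  have hnorm : ∀ a, lipNorm (s a) (ψ a) ≤ Λ := fun a =>
    (lipNorm_le_cylLipNorm s ψ a).trans ((le_abs_self _).trans (le_add_of_nonneg_right zero_le_one))
  rw [← cylindrical_iccExtend ζ (fun a => (hs a).le) ψ] at hmean ⊢
  set ψ' : Fin m → ℝ → ℂ := fun a => Set.IccExtend (hs a).le ((Set.Icc 0 (s a)).domRestrict (ψ a))
  have hb : ∀ a r, ‖ψ' a r‖ ≤ Λ := fun a r =>
    (norm_iccExtend_domRestrict_le (hs a).le (hψ a).choose_spec r).trans (hnorm a)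
  have hlip : ∀ a r r', ‖ψ' a r - ψ' a r'‖ ≤ Λ * |r - r'| := fun a r r' =>
    (norm_iccExtend_domRestrict_sub_le (hs a).le (hψ a).choose_spec r r').trans
      (mul_le_mul_of_nonneg_right (hnorm a) (abs_nonneg _))
  have hψ' : ∀ a, Measurable (ψ' a) := fun a => (LipschitzWith.of_dist_le' fun r r' => by
    rw [dist_eq_norm, Real.dist_eq]; exact hlip a r r').continuous.measurable
  calc _ ≤ 2 * Λ * (C * Λ * R ^ (1 - α)) * (eLpNorm g 2 ν).toReal ^ 2 :=
        norm_integral_tensorFun_autocorrelation_le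
          (F := fun t p => ζ.cylindrical s ψ' (ζ.flow s hs t p)) hρ hR
          (measurable_cylindrical_flow hs ζ hψ') (measurable_cylindrical ζ hψ')
          (fun _ _ => hb _ _) (fun _ => hb _ _) hΛ.le (by positivity)
          (fun p ω => h μ hμ ψ' Λ hb hlip hmean p ω R hR) hg
    _ = 2 * C * Λ ^ 2 * (eLpNorm g 2 ν).toReal ^ 2 * R ^ (1 - α) := by ring
    _ ≤ 2 * C * Λ ^ 2 * ((eLpNorm g 2 ν).toReal ^ 2 + 1) * R ^ (1 - α) := by
        gcongr; exact le_add_of_nonneg_right zero_le_one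

theorem theorem1_general (m : ℕ) (ζ : Substitution m) (hprim : ζ.Primitive)
    (hirr : Irreducible (ζ.matrix.map (Int.cast : ℤ → ℚ)).charpoly)
    (hθ : 1 < ζ.absTheta₂) :
    ∃ α : ℝ, 0 < α ∧
      ∀ᵐ s ∂(Measure.hausdorffMeasure ((m : ℝ) - 1) : Measure (Fin m → ℝ)),
      ∀ hs : s ∈ roofSimplex m,
      ∃ C : ℝ → ℝ → ℝ, (∀ a b, 0 < C a b) ∧
      ∀ (μ : Measure ζ.Space) [IsProbabilityMeasure μ], MeasurePreserving (ζ.shift 1) μ μ →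
      ∀ ψ : Fin m → ℝ → ℂ,
        (∀ a, ∃ K, LipschitzOnWith K (ψ a) (Set.Icc 0 (s a))) →
        ∫ p, ζ.cylindrical s ψ p ∂(ζ.suspensionMeasure s μ) = 0 →
      ∀ (Y : Type*) [MeasurableSpace Y] [AddAction ℝ Y] [MeasurableVAdd₂ ℝ Y]
        (ν : Measure Y) [SFinite ν] [VAddInvariantMeasure ℝ Y ν] (g : Y → ℂ), MemLp g 2 ν →
      ∀ R : ℝ, 0 < R →
        ‖∫ t in (0 : ℝ)..R, ∫ p : ζ.Suspension s × Y,
            tensorFun (ζ.cylindrical s ψ) g (ζ.flow s hs.1 t p.1, t +ᵥ p.2) *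
              (starRingEnd ℂ) (tensorFun (ζ.cylindrical s ψ) g p)
            ∂((ζ.suspensionMeasure s μ).prod ν)‖
          ≤ C (cylLipNorm s ψ) (eLpNorm g 2 ν).toReal * R ^ (1 - α) := by
  obtain ⟨α, hα, hae⟩ := hprim.exists_ae_twistedPowerSaving hirr hθ
  refine ⟨α, hα, hae.mono fun s hgood hs => ?_⟩
  obtain ⟨C, hC, hsaving⟩ := hgood hs
  exact ⟨fun a b => 2 * C * (|a| + 1) ^ 2 * (b ^ 2 + 1), fun a b => by positivity,
    fun μ _ hμ ψ hψ hmean Y _ _ _ ν _ _ g hg R hR =>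
      hsaving.norm_integral_tensorFun_flow_le hC hμ hψ hmean hg hR⟩

/- The `(m-1)`-dimensional Hausdorff measure restricted to the affine hyperplane `∑ s_a = 1` is a
constant positive multiple of its Lebesgue measure, so "almost every" below means Lebesgue-a.e. in
the simplex. The flow `H_t` is written as the action `H_t y = t +ᵥ y` of `ℝ` on `Y`. -/
theorem theorem1 (m : ℕ) (ζ : Substitution m) (hprim : ζ.Primitive) (haper : ζ.Aperiodic)
    (hirr : Irreducible (ζ.matrix.map (Int.cast : ℤ → ℚ)).charpoly)
    (hθ : 1 < ζ.absTheta₂) :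
    ∃ α : ℝ, 0 < α ∧
      ∀ᵐ s ∂(Measure.hausdorffMeasure ((m : ℝ) - 1) : Measure (Fin m → ℝ)),
      ∀ hs : s ∈ roofSimplex m,
      ∃ C : ℝ → ℝ → ℝ, (∀ a b, 0 < C a b) ∧
      -- the invariant probability measure of `(X_ζ, T_ζ)`
      ∀ (μ : Measure ζ.Space) [IsProbabilityMeasure μ], MeasurePreserving (ζ.shift 1) μ μ →
      -- the mean-zero Lipschitz cylindrical function `f`
      ∀ ψ : Fin m → ℝ → ℂ,
        (∀ a, ∃ K, LipschitzOnWith K (ψ a) (Set.Icc 0 (s a))) →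
        ∫ p, ζ.cylindrical s ψ p ∂(ζ.suspensionMeasure s μ) = 0 →
      -- the ergodic flow `(Y, H_t, ν)` and the function `g ∈ L²₀(Y, ν)`
      ∀ (Y : Type*) [MeasurableSpace Y] [AddAction ℝ Y] [MeasurableVAdd₂ ℝ Y]
        (ν : Measure Y) [IsProbabilityMeasure ν] [ErgodicVAdd ℝ Y ν]
        (g : Y → ℂ), MemLp g 2 ν → ∫ y, g y ∂ν = 0 →
      ∀ R : ℝ, 0 < R →
        ‖∫ t in (0 : ℝ)..R, ∫ p : ζ.Suspension s × Y,
            tensorFun (ζ.cylindrical s ψ) g (ζ.flow s hs.1 t p.1, t +ᵥ p.2) *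
              (starRingEnd ℂ) (tensorFun (ζ.cylindrical s ψ) g p)
            ∂((ζ.suspensionMeasure s μ).prod ν)‖
          ≤ C (cylLipNorm s ψ) (eLpNorm g 2 ν).toReal * R ^ (1 - α) := by
  obtain ⟨α, hα, h⟩ := theorem1_general m ζ hprim hirr hθ
  exact ⟨α, hα, h.mono fun s hs hΔ => (hs hΔ).imp fun C hC => ⟨hC.1,
    fun μ _ hμ ψ hψ h0 Y _ _ _ ν _ _ g hg _ => hC.2 μ hμ ψ hψ h0 Y ν g hg⟩⟩
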